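/- Let $F$ be the free group of rank $n$ with basis $\mathcal B$, let $\mathcal T$ be its Cayley tree, let $W\subset F$ be a finite set of words, and let $\mathcal L$ be the line pattern consisting of the lines $\{gw^k\}_{k\in\mathbb Z}$, $g\in F$, $1\neq w\in W$. Let $\mathcal D$ be the decomposition space: the quotient $q\colon\partial_\infty F\to\mathcal D$ that identifies the two ends of each line of $\mathcal L$. For a finite (nonempty) subtree $\mathcal X\subset\mathcal T$, the Whitehead graph $\mathrm{Wh}(\mathcal X)$ has as vertices the vertices of $\mathcal T$ adjacent to $\mathcal X$, two of them being joined when a line of $\mathcal L$ passes through both. A cover associated to $\mathcal X$ is an open cover $\mathcal U_{\mathcal X}=\{U_a\}$ of $\mathcal D$, indexed by the vertices $a$ of $\mathrm{Wh}(\mathcal X)$, without triple intersections, such that $U_a$ contains the image under $q$ of the shadow of $a$ (the ends $\xi$ such that the geodesics from $\mathcal X$ to $\xi$ pass through $a$), and such that for $a\ne b$ the sets $U_a,U_b$ meet if and only if $a,b$ are joined in $\mathrm{Wh}(\mathcal X)$. If $\mathcal X\subset\mathcal X'$, the refinement map sends a vertex of $\mathrm{Wh}(\mathcal X')$ to the vertex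 of $\mathrm{Wh}(\mathcal X)$ in the same component of $\mathcal T-\mathcal X$. Let $M=\varinjlim_{\mathcal X}\check{\mathrm C}^1(\mathcal U_{\mathcal X},\mathbb Z)$ be the direct limit of the groups of (alternating) Čech 1-cochains along these refinements. It is a right $F$-module, where $g\in F$ carries the class of a cochain of $\mathcal U_{\mathcal X}$ to the class of its translate, a cochain of $g^{-1}\mathcal U_{\mathcal X}$. An element of $M$ is supported on $\mathcal X$ if it is represented by a cochain of a cover associated to $\mathcal X$. **Theorem.** There are a computable function $N$ of $(n,W)$ and algorithms that, given $(n,W)$ and an integer $r$, compute finite lists such that the following holds for all $n$ and $W$. 1. $M$ is generated as an abelian group by its elements supported on subtrees with fewer than $N(n,W)$ vertices. 2. Let $r\ge N(n,W)$, and let $B_r$ be the ball of radius $r$ about the identity in $\mathcal T$. The first algorithm lists the edges $\epsilon_1,\dots,\epsilon_k$ of $\mathrm{Wh}(B_r)$, each exactly once and with an orientation. A cover associated to $B_r$ exists and, for each such cover, the classes $\sigma_j\in M$ of the cochains that assign $1$ to the oriented edge $\epsilon_j$ and $0$ to the other edges generate $M$ as an $F$-module. The second algorithm computes a finite set of relators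 for $M$ with respect to these generators: a finite subset of $\mathbb ZF^k$ that generates, as a right $\mathbb ZF$-module, the kernel of the surjection $p\colon\mathbb ZF^k\to M$, $e_j\mapsto\sigma_j$. -/

import Mathlib

noncomputable section
namespace LinePattern
open Filter Topology Set

/-- The free group of rank `n`. -/
abbrev Gp (n : ℕ) : Type := FreeGroup (Fin n)

/-- A letter: a basis element or the inverse of one. -/
abbrev Letter (n : ℕ) : Type := Fin n × Bool

variable {n : ℕ}

/-- The element of the free group represented by a letter. -/
def letter (s : Letter n) : Gp n := FreeGroup.mk [s]

/-- The Cayley graph of the free group with respect to its basis, which is a tree. -/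
def tree (n : ℕ) : SimpleGraph (Gp n) :=
  SimpleGraph.mulCayley (Set.range (FreeGroup.of : Fin n → Gp n))

theorem tree_adj {u v : Gp n} : (tree n).Adj u v ↔ ∃ s : Letter n, v = u * letter s := by
  rw [tree, SimpleGraph.mulCayley_adj']
  constructor
  · rintro ⟨-, g, ⟨i, rfl⟩, h | h⟩
    · exact ⟨(i, true), h.symm⟩
    · refine ⟨(i, false), ?_⟩
      rw [h, mul_assoc]
      have : FreeGroup.of i * letter (i, false) = 1 := by
        show FreeGroup.of i * (FreeGroup.of i)⁻¹ = 1
        simp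
      rw [this, mul_one]
  · rintro ⟨⟨i, b⟩, rfl⟩
    have key : letter (i, b) ≠ (1 : Gp n) := by
      intro h
      have := congrArg FreeGroup.toWord h
      simp [letter] at this
    refine ⟨fun h => key (by simpa using h), FreeGroup.of i, ⟨i, rfl⟩, ?_⟩
    cases b
    · right
      have : letter (i, false) * FreeGroup.of i = 1 := by
        show (FreeGroup.of i)⁻¹ * FreeGroup.of i = 1
        simp
      rw [mul_assoc, this, mul_one]
    · left; rfl

theorem head_append (s t : Letter n) (L : List (Letter n))
    (hL : FreeGroup.reduce (s :: L) = s :: L)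
    (h : FreeGroup.reduce (s :: L ++ [t]) ≠ []) :
    (FreeGroup.reduce (s :: L ++ [t])).head? = some s := by
  induction L generalizing s with
  | nil =>
    simp only [List.cons_append, List.nil_append, FreeGroup.reduce.cons, FreeGroup.reduce_nil] at h ⊢
    split_ifs at h ⊢ <;> simp_all
  | cons s' L ih =>
    have hred := FreeGroup.IsReduced.of_reduce_eq hL
    have hred' : FreeGroup.IsReduced (s' :: L) := by
      unfold FreeGroup.IsReduced at hred ⊢
      exact hred.tail
    have hs : s.1 = s'.1 → s.2 = s'.2 := by
      unfold FreeGroup.IsReduced at hred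
      exact (List.isChain_cons_cons.1 hred).1
    have := ih s' hred'.reduce_eq
    rw [List.cons_append, FreeGroup.reduce.cons] at h ⊢
    generalize FreeGroup.reduce (s' :: L ++ [t]) = M at *
    cases M with
    | nil => simp
    | cons m M =>
      have hm : m = s' := by simpa using this (by simp)
      subst hm
      have : ¬ (s.1 = m.1 ∧ s.2 = !m.2) := by
        rintro ⟨h1, h2⟩
        have := hs h1
        rw [this] at h2
        cases hb : m.2 <;> simp [hb] at h2
      simp [this]

/-- The first letter of the geodesic from `1` to `u` does not change when a further letter is
appended, unless the geodesic becomes trivial. -/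
theorem head_mul_letter (u : Gp n) (t : Letter n) (hu : u ≠ 1) (hut : u * letter t ≠ 1) :
    (u * letter t).toWord.head? = u.toWord.head? := by
  have h1 : (u * letter t).toWord = FreeGroup.reduce (u.toWord ++ [t]) := by
    rw [FreeGroup.toWord_mul]; simp [letter]
  have h2 := FreeGroup.reduce_toWord u
  have h3 : (u * letter t).toWord ≠ [] := by simpa using hut
  have h4 : u.toWord ≠ [] := by simpa using hu
  rw [h1] at h3 ⊢
  generalize u.toWord = L at *
  cases L with
  | nil => exact absurd rfl h4
  | cons s L => simpa using head_append s t L h2 h3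

/-- A finite subtree of the Cayley tree, as the set of its vertices (nonempty). -/
def IsFiniteSubtree (X : Set (Gp n)) : Prop :=
  X.Finite ∧ ((tree n).induce X).Connected

/-- The vertices of the Whitehead graph at `X`: the vertices of the tree adjacent to `X`. -/
def whVertices (X : Set (Gp n)) : Set (Gp n) :=
  {a | a ∉ X ∧ ∃ x ∈ X, (tree n).Adj x a}

/-- `a` and `b` lie in the same component of the complement of `X` in the tree. -/
def SameBranch (X : Set (Gp n)) (a b : Gp n) : Prop :=
  ∃ p : (tree n).Walk a b, ∀ v ∈ p.support, v ∉ X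

theorem head_walk (x : Gp n) {u v : Gp n} (p : (tree n).Walk u v) (hp : x ∉ p.support) :
    (x⁻¹ * u).toWord.head? = (x⁻¹ * v).toWord.head? := by
  induction p with
  | nil => rfl
  | @cons u v w h q ih =>
    simp only [SimpleGraph.Walk.support_cons, List.mem_cons, not_or] at hp
    rw [← ih hp.2]
    obtain ⟨s, rfl⟩ := tree_adj.1 h
    have hv : x ≠ u * letter s := fun h' => hp.2 (h' ▸ q.start_mem_support)
    rw [← mul_assoc, head_mul_letter]
    · intro h'; exact hp.1 (inv_mul_eq_one.1 h')
    · intro h'; rw [mul_assoc] at h'; exact hv (inv_mul_eq_one.1 h')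

theorem SameBranch.symm {X : Set (Gp n)} {a b : Gp n} (h : SameBranch X a b) :
    SameBranch X b a := by
  obtain ⟨p, hp⟩ := h
  exact ⟨p.reverse, fun v hv => hp v (by simpa using hv)⟩

theorem SameBranch.trans {X : Set (Gp n)} {a b c : Gp n} (h : SameBranch X a b)
    (h' : SameBranch X b c) : SameBranch X a c := by
  obtain ⟨p, hp⟩ := h
  obtain ⟨q, hq⟩ := h'
  refine ⟨p.append q, fun v hv => ?_⟩
  rcases (SimpleGraph.Walk.mem_support_append_iff _ _).1 hv with h | h
  exacts [hp v h, hq v h]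

theorem SameBranch.mono {X Y : Set (Gp n)} (hXY : X ⊆ Y) {a b : Gp n} (h : SameBranch Y a b) :
    SameBranch X a b :=
  ⟨h.choose, fun v hv hvX => h.choose_spec v hv (hXY hvX)⟩

theorem SameBranch.refl {X : Set (Gp n)} {a : Gp n} (h : a ∉ X) : SameBranch X a a :=
  ⟨.nil, by simpa using h⟩

theorem head_letter (s : Letter n) : (letter s).toWord.head? = some s := by
  simp [letter]

theorem whVertices_unique {X : Set (Gp n)} (hX : IsFiniteSubtree X) {a a' : Gp n}
    (ha : a ∈ whVertices X) (ha' : a' ∈ whVertices X) (h : SameBranch X a a') : a = a' := by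
  obtain ⟨haX, x, hx, hxa⟩ := ha
  obtain ⟨haX', x', hx', hxa'⟩ := ha'
  obtain ⟨p, hp⟩ := h
  have h1 := head_walk x p (fun h => hp x h hx)
  obtain ⟨s, rfl⟩ := tree_adj.1 hxa
  rw [inv_mul_cancel_left, head_letter] at h1
  by_cases hxx : x' = x
  · subst hxx
    obtain ⟨s', rfl⟩ := tree_adj.1 hxa'
    rw [inv_mul_cancel_left, head_letter] at h1
    rw [Option.some.inj h1]
  · exfalso
    have h2 := head_walk x (.cons hxa' .nil) (by
      simp only [SimpleGraph.Walk.support_cons, SimpleGraph.Walk.support_nil, List.mem_cons,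
        List.not_mem_nil, or_false, not_or]
      exact ⟨fun h => hxx h.symm, fun h => haX' (h ▸ hx)⟩)
    obtain ⟨q⟩ := hX.2.preconnected ⟨x, hx⟩ ⟨x', hx'⟩
    classical
    obtain ⟨q, hq⟩ := q.toPath
    cases q with
    | nil => exact hxx rfl
    | @cons _ y _ hy q =>
      rw [SimpleGraph.Walk.cons_isPath_iff] at hq
      have h3 := head_walk x (q.map (SimpleGraph.Embedding.induce X).toHom) (by
        rw [SimpleGraph.Walk.support_map, List.mem_map]
        rintro ⟨z, hz, hzx⟩
        apply hq.2
        have : z = ⟨x, hx⟩ := Subtype.ext hzx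
        rwa [← this])
      have hy' : (tree n).Adj x y.1 := hy
      obtain ⟨t, ht⟩ := tree_adj.1 hy'
      have h4 : (x⁻¹ * y.1).toWord.head? = (x⁻¹ * x').toWord.head? := h3
      rw [h2, ← h1, ht, inv_mul_cancel_left, head_letter] at h4
      rw [← Option.some.inj h4, ← ht] at haX
      exact haX y.2

theorem exists_sameBranch {X : Set (Gp n)} (hX : X.Nonempty) {b : Gp n} (hb : b ∉ X) :
    ∃ a ∈ whVertices X, SameBranch X a b := by
  obtain ⟨x, hx⟩ := hX
  obtain ⟨L, hL⟩ : ∃ L, x⁻¹ * b = FreeGroup.mk L := ⟨_, FreeGroup.mk_toWord.symm⟩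
  induction L using List.reverseRecOn generalizing b with
  | nil =>
    have h0 : x⁻¹ * b = 1 := hL
    rw [inv_mul_eq_one] at h0
    exact absurd (h0 ▸ hx) hb
  | append_singleton L s ih =>
    have hb' : b = x * FreeGroup.mk L * letter s := by
      rw [mul_assoc, letter, FreeGroup.mul_mk, ← hL, mul_inv_cancel_left]
    have hadj : (tree n).Adj (x * FreeGroup.mk L) b := tree_adj.2 ⟨s, hb'⟩
    by_cases h : x * FreeGroup.mk L ∈ X
    · exact ⟨b, ⟨hb, _, h, hadj⟩, .refl hb⟩
    · obtain ⟨a, ha, hab⟩ := ih h (by simp)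
      refine ⟨a, ha, hab.trans ⟨.cons hadj .nil, ?_⟩⟩
      simp [h, hb]

open Classical in
/-- The refinement map on vertices of Whitehead graphs: it sends a vertex `b` outside of the
subtree `X` to the vertex of the Whitehead graph at `X` that lies in the same component of the
complement of `X`. (Vertices of `X` are sent to themselves; this value is never used.) -/
def retract (X : Set (Gp n)) (b : Gp n) : Gp n :=
  if h : ∃ a ∈ whVertices X, SameBranch X a b then h.choose else b

theorem retract_eq {X : Set (Gp n)} (hX : IsFiniteSubtree X) {a b : Gp n}
    (ha : a ∈ whVertices X) (hab : SameBranch X a b) : retract X b = a := by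
  have h : ∃ a ∈ whVertices X, SameBranch X a b := ⟨a, ha, hab⟩
  rw [retract, dif_pos h]
  exact whVertices_unique hX h.choose_spec.1 ha (h.choose_spec.2.trans hab.symm)

theorem retract_spec {X : Set (Gp n)} (hX : X.Nonempty) {b : Gp n} (hb : b ∉ X) :
    retract X b ∈ whVertices X ∧ SameBranch X (retract X b) b := by
  have h := exists_sameBranch hX hb
  rw [retract, dif_pos h]
  exact h.choose_spec

/-- The translate `g⁻¹ X`. -/
def translateSet (X : Set (Gp n)) (g : Gp n) : Set (Gp n) := {v | g * v ∈ X}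

theorem tree_adj_mul (g : Gp n) {u v : Gp n} : (tree n).Adj (g * u) (g * v) ↔ (tree n).Adj u v := by
  simp only [tree_adj, mul_assoc, mul_right_inj]

/-- Left multiplication by `g`, an automorphism of the tree. -/
def mulLeftHom (g : Gp n) : tree n →g tree n :=
  ⟨fun v => g * v, fun h => (tree_adj_mul g).2 h⟩

theorem IsFiniteSubtree.translate {X : Set (Gp n)} (hX : IsFiniteSubtree X) (g : Gp n) :
    IsFiniteSubtree (translateSet X g) := by
  refine ⟨hX.1.preimage (mul_right_injective g).injOn, ?_⟩
  let e : (tree n).induce (translateSet X g) ≃g (tree n).induce X :=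
    { toFun := fun v => ⟨g * v.1, v.2⟩
      invFun := fun v => ⟨g⁻¹ * v.1, by
        show g * (g⁻¹ * v.1) ∈ X
        rw [mul_inv_cancel_left]; exact v.2⟩
      left_inv := fun v => by simp
      right_inv := fun v => by simp
      map_rel_iff' := by
        intro a b
        exact tree_adj_mul g }
  exact e.connected_iff.2 hX.2

theorem mem_whVertices_translate {X : Set (Gp n)} {g a : Gp n} :
    a ∈ whVertices (translateSet X g) ↔ g * a ∈ whVertices X := by
  constructor
  · rintro ⟨h, x, hx, hxa⟩
    exact ⟨h, g * x, hx, (tree_adj_mul g).2 hxa⟩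
  · rintro ⟨h, x, hx, hxa⟩
    refine ⟨h, g⁻¹ * x, ?_, ?_⟩
    · show g * (g⁻¹ * x) ∈ X
      rwa [mul_inv_cancel_left]
    · rw [← tree_adj_mul g, mul_inv_cancel_left]; exact hxa

theorem SameBranch.translate {X : Set (Gp n)} {g a b : Gp n}
    (h : SameBranch (translateSet X g) a b) : SameBranch X (g * a) (g * b) := by
  obtain ⟨p, hp⟩ := h
  refine ⟨p.map (mulLeftHom g), fun v hv => ?_⟩
  have hv' := List.mem_map.1 ((SimpleGraph.Walk.support_map (mulLeftHom g) p) ▸ hv)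
  obtain ⟨w, hw, rfl⟩ := hv'
  exact hp w hw

theorem retract_translate {X : Set (Gp n)} (hX : IsFiniteSubtree X) (g : Gp n) {b : Gp n}
    (hb : g * b ∉ X) : retract X (g * b) = g * retract (translateSet X g) b := by
  have hne : (translateSet X g).Nonempty := by
    obtain ⟨v⟩ := (hX.translate g).2.nonempty
    exact ⟨v.1, v.2⟩
  obtain ⟨h1, h2⟩ := retract_spec hne (b := b) hb
  exact retract_eq hX (mem_whVertices_translate.1 h1) h2.translate

/-! ### The boundary, the lines and the decomposition space -/

/-- The boundary at infinity of the tree. An end `ξ` is given by the function that sends each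
vertex `v` to the label `ξ v` of the first edge of the geodesic ray `[v, ξ)`. These functions are
the ones such that each edge is directed towards `ξ` from exactly one of its two endpoints. -/
def Boundary (n : ℕ) : Type :=
  {ξ : Gp n → Letter n // ∀ v s, ξ (v * letter s) = (s.1, !s.2) ↔ ξ v ≠ s}

/-- The topology generated by the shadows `{ξ | ξ v = s}`. -/
instance : TopologicalSpace (Boundary n) := instTopologicalSpaceSubtype

instance : MulAction (Gp n) (Boundary n) where
  smul g ξ := ⟨fun v => ξ.1 (g⁻¹ * v), fun v s => by
    have := ξ.2 (g⁻¹ * v) s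
    rwa [mul_assoc] at this⟩
  one_smul ξ := Subtype.ext (funext fun v => by show ξ.1 (1⁻¹ * v) = _; simp)
  mul_smul g h ξ := Subtype.ext (funext fun v => by
    show ξ.1 ((g * h)⁻¹ * v) = ξ.1 (h⁻¹ * (g⁻¹ * v))
    simp [mul_assoc])

theorem Boundary.smul_val (g : Gp n) (ξ : Boundary n) (v : Gp n) :
    (g • ξ).1 v = ξ.1 (g⁻¹ * v) := rfl

theorem Boundary.continuous_smul (g : Gp n) : Continuous fun ξ : Boundary n => g • ξ := by
  refine Continuous.subtype_mk (continuous_pi fun v => ?_) _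
  exact (continuous_apply (g⁻¹ * v)).comp continuous_subtype_val

/-- Convergence of a sequence of vertices of the tree to an end: seen from each vertex, the
sequence eventually lies in the direction of the end. -/
def ConvergesTo (u : ℕ → Gp n) (ξ : Boundary n) : Prop :=
  ∀ v, ∀ᶠ k in atTop, (v⁻¹ * u k).toWord.head? = some (ξ.1 v)

/-- `ξ` and `η` are the two ends of a line `{g w ^ k}`, `w ∈ W`, of the line pattern. -/
def LineEnds (W : Set (Gp n)) (ξ η : Boundary n) : Prop :=
  ∃ w ∈ W, ∃ g : Gp n,
    ConvergesTo (fun k => g * w ^ k) ξ ∧ ConvergesTo (fun k => g * w⁻¹ ^ k) η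

theorem ConvergesTo.smul {u : ℕ → Gp n} {ξ : Boundary n} (h : ConvergesTo u ξ) (g : Gp n) :
    ConvergesTo (fun k => g * u k) (g • ξ) := by
  intro v
  filter_upwards [h (g⁻¹ * v)] with k hk
  rw [Boundary.smul_val, ← hk]
  simp [mul_assoc]

theorem LineEnds.smul {W : Set (Gp n)} {ξ η : Boundary n} (h : LineEnds W ξ η) (g : Gp n) :
    LineEnds W (g • ξ) (g • η) := by
  obtain ⟨w, hw, g', h1, h2⟩ := h
  refine ⟨w, hw, g * g', ?_, ?_⟩
  · simpa only [mul_assoc] using h1.smul g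
  · simpa only [mul_assoc] using h2.smul g

/-- The decomposition space: the quotient of the boundary that identifies the two ends of each
line. -/
def DecompositionSpace (W : Set (Gp n)) : Type := Quot (LineEnds W)

variable {W : Set (Gp n)}

instance : TopologicalSpace (DecompositionSpace W) := instTopologicalSpaceQuot

/-- The quotient projection. -/
def proj (W : Set (Gp n)) (ξ : Boundary n) : DecompositionSpace W := Quot.mk _ ξ

instance : MulAction (Gp n) (DecompositionSpace W) where
  smul g := Quot.map (g • ·) fun _ _ h => h.smul g
  one_smul := by
    rintro ⟨ξ⟩
    show Quot.mk _ ((1 : Gp n) • ξ) = _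
    rw [one_smul]
  mul_smul g h := by
    rintro ⟨ξ⟩
    show Quot.mk _ ((g * h) • ξ) = Quot.mk _ (g • h • ξ)
    rw [mul_smul]

theorem smul_proj (g : Gp n) (ξ : Boundary n) : g • proj W ξ = proj W (g • ξ) := rfl

theorem DecompositionSpace.continuous_smul (g : Gp n) :
    Continuous fun d : DecompositionSpace W => g • d := by
  refine continuous_quot_lift _ ?_
  exact continuous_quot_mk.comp (Boundary.continuous_smul g)

/-! ### Whitehead graphs and covers -/

/-- The shadow of a vertex `a` adjacent to the subtree `X`: the set of ends `ξ` such that the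
geodesics from `X` to `ξ` contain `a`, that is, leave `X` through `a`. -/
def shadow (X : Set (Gp n)) (a : Gp n) : Set (Boundary n) :=
  {ξ | ∃ x ∈ X, x * letter (ξ.1 x) = a}

/-- The Whitehead graph at `X`, without multiplicities of edges. Its vertices are those in
`whVertices X`, and two of them are adjacent if some line of the line pattern passes through both,
that is, has one end in the shadow of each. -/
def whitehead (W X : Set (Gp n)) : SimpleGraph (Gp n) where
  Adj a b := a ≠ b ∧ a ∈ whVertices X ∧ b ∈ whVertices X ∧
    ∃ ξ η, (LineEnds W ξ η ∨ LineEnds W η ξ) ∧ ξ ∈ shadow X a ∧ η ∈ shadow X b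
  symm := ⟨by
    rintro a b ⟨h, ha, hb, ξ, η, hl, hξ, hη⟩
    exact ⟨h.symm, hb, ha, η, ξ, hl.symm, hη, hξ⟩⟩
  loopless := ⟨fun a h => h.1 rfl⟩

theorem mem_shadow_translate {X : Set (Gp n)} {g a : Gp n} {ξ : Boundary n} :
    ξ ∈ shadow (translateSet X g) a ↔ g • ξ ∈ shadow X (g * a) := by
  constructor
  · rintro ⟨x, hx, rfl⟩
    exact ⟨g * x, hx, by rw [Boundary.smul_val, inv_mul_cancel_left, mul_assoc]⟩
  · rintro ⟨x, hx, h⟩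
    refine ⟨g⁻¹ * x, ?_, ?_⟩
    · show g * (g⁻¹ * x) ∈ X
      rwa [mul_inv_cancel_left]
    · rw [Boundary.smul_val] at h
      rw [mul_assoc, h, inv_mul_cancel_left]

theorem whitehead_translate {X : Set (Gp n)} {g a b : Gp n} :
    (whitehead W (translateSet X g)).Adj a b ↔ (whitehead W X).Adj (g * a) (g * b) := by
  constructor
  · rintro ⟨h, ha, hb, ξ, η, hl, hξ, hη⟩
    exact ⟨fun h' => h (mul_left_cancel h'), mem_whVertices_translate.1 ha,
      mem_whVertices_translate.1 hb, g • ξ, g • η, hl.imp (·.smul g) (·.smul g),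
      mem_shadow_translate.1 hξ, mem_shadow_translate.1 hη⟩
  · rintro ⟨h, ha, hb, ξ, η, hl, hξ, hη⟩
    refine ⟨fun h' => h (h' ▸ rfl), mem_whVertices_translate.2 ha,
      mem_whVertices_translate.2 hb, g⁻¹ • ξ, g⁻¹ • η, hl.imp (·.smul _) (·.smul _),
      mem_shadow_translate.2 ?_, mem_shadow_translate.2 ?_⟩ <;> rwa [smul_inv_smul]

/-- An open cover of the decomposition space associated to a finite subtree `X`: open sets `U a`
in bijection with the vertices `a` of the Whitehead graph at `X`, with the properties below.
To avoid index types that depend on `X`, the family is indexed by all of the vertices of the tree,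
with `U a` empty if `a` is not a vertex of the Whitehead graph. -/
@[ext] structure AssociatedCover (W : Set (Gp n)) where
  X : Set (Gp n)
  U : Gp n → Set (DecompositionSpace W)
  subtree : IsFiniteSubtree X
  isOpen : ∀ a, IsOpen (U a)
  covers : ⋃ a ∈ whVertices X, U a = univ
  eq_empty : ∀ a, a ∉ whVertices X → U a = ∅
  shadow_subset : ∀ a ∈ whVertices X, proj W '' shadow X a ⊆ U a
  inter_nonempty_iff : ∀ a ∈ whVertices X, ∀ b ∈ whVertices X, a ≠ b →
    ((U a ∩ U b).Nonempty ↔ (whitehead W X).Adj a b)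
  no_triple : ∀ a b c, a ≠ b → b ≠ c → a ≠ c → U a ∩ U b ∩ U c = ∅

namespace AssociatedCover

/-- `i ≤ j` if the subtree of `j` contains that of `i` and the cover of `j` refines that of `i`
along the refinement map on vertices. -/
instance : Preorder (AssociatedCover W) where
  le i j := i.X ⊆ j.X ∧ ∀ b ∈ whVertices j.X, j.U b ⊆ i.U (retract i.X b)
  le_refl i := ⟨subset_rfl, fun b hb => by
    rw [retract_eq i.subtree hb (.refl hb.1)]⟩
  le_trans i j k := by
    rintro ⟨hij, hij'⟩ ⟨hjk, hjk'⟩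
    refine ⟨hij.trans hjk, fun c hc => (hjk' c hc).trans ?_⟩
    have hj : j.X.Nonempty := by
      obtain ⟨v⟩ := j.subtree.2.nonempty
      exact ⟨v.1, v.2⟩
    have hi : i.X.Nonempty := by
      obtain ⟨v⟩ := i.subtree.2.nonempty
      exact ⟨v.1, v.2⟩
    obtain ⟨h1, h2⟩ := retract_spec hj (b := c) (fun h => hc.1 (hjk h))
    obtain ⟨h3, h4⟩ := retract_spec hi (b := retract j.X c) (fun h => h1.1 (hij h))
    have := hij' _ h1
    rwa [← retract_eq i.subtree h3 (h4.trans (h2.mono hij))] at this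

/-- The translate `g⁻¹ U` of a cover. -/
def translate (i : AssociatedCover W) (g : Gp n) : AssociatedCover W where
  X := translateSet i.X g
  U a := {d | g • d ∈ i.U (g * a)}
  subtree := i.subtree.translate g
  isOpen a := (i.isOpen _).preimage (DecompositionSpace.continuous_smul g)
  covers := by
    rw [eq_univ_iff_forall]
    intro d
    have := i.covers ▸ mem_univ (g • d)
    simp only [mem_iUnion] at this ⊢
    obtain ⟨a, ha, hd⟩ := this
    refine ⟨g⁻¹ * a, mem_whVertices_translate.2 (by rwa [mul_inv_cancel_left]), ?_⟩
    show g • d ∈ i.U (g * (g⁻¹ * a))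
    rwa [mul_inv_cancel_left]
  eq_empty a ha := by
    rw [mem_whVertices_translate] at ha
    simp [i.eq_empty _ ha]
  shadow_subset a ha := by
    rintro _ ⟨ξ, hξ, rfl⟩
    exact i.shadow_subset _ (mem_whVertices_translate.1 ha)
      ⟨g • ξ, mem_shadow_translate.1 hξ, rfl⟩
  inter_nonempty_iff a ha b hb hab := by
    rw [whitehead_translate, ← i.inter_nonempty_iff _ (mem_whVertices_translate.1 ha) _
      (mem_whVertices_translate.1 hb) (fun h => hab (mul_left_cancel h))]
    constructor
    · rintro ⟨d, h1, h2⟩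
      exact ⟨g • d, h1, h2⟩
    · rintro ⟨d, h1, h2⟩
      exact ⟨g⁻¹ • d, by simpa using h1, by simpa using h2⟩
  no_triple a b c hab hbc hac := by
    rw [eq_empty_iff_forall_notMem]
    rintro d ⟨⟨h1, h2⟩, h3⟩
    have := i.no_triple (g * a) (g * b) (g * c) (fun h => hab (mul_left_cancel h))
      (fun h => hbc (mul_left_cancel h)) (fun h => hac (mul_left_cancel h))
    exact (this ▸ (⟨⟨h1, h2⟩, h3⟩ : g • d ∈ i.U (g * a) ∩ i.U (g * b) ∩ i.U (g * c)) :
      g • d ∈ (∅ : Set _))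

theorem translate_mono {i j : AssociatedCover W} (h : i ≤ j) (g : Gp n) :
    i.translate g ≤ j.translate g := by
  refine ⟨fun v hv => h.1 hv, fun b hb d hd => ?_⟩
  have hb' := mem_whVertices_translate.1 hb
  have := h.2 _ hb' hd
  rw [retract_translate i.subtree g (fun h' => hb'.1 (h.1 h'))] at this
  exact this

theorem translate_one (i : AssociatedCover W) : i.translate 1 = i := by
  ext <;> simp [translate, translateSet]

theorem translate_translate (i : AssociatedCover W) (g h : Gp n) :
    (i.translate g).translate h = i.translate (g * h) := by
  ext <;> simp [translate, translateSet, mul_assoc, mul_smul]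

end AssociatedCover

/-! ### Cochains -/

/-- The group of (alternating) Čech 1-cochains, with integer coefficients, of an indexed
family of sets: an integer `c a b` for each pair with `U a ∩ U b ≠ ∅`, with `c b a = - c a b`
(in particular `c a a = 0`). Such cochains are extended by `0` to all pairs. -/
def cechOneCochains {ι Y : Type*} (U : ι → Set Y) : Submodule ℤ (ι → ι → ℤ) where
  carrier := {c | (∀ a b, c b a = - c a b) ∧ ∀ a b, U a ∩ U b = ∅ → c a b = 0}
  add_mem' := by
    rintro c d ⟨hc, hc'⟩ ⟨hd, hd'⟩
    refine ⟨fun a b => ?_, fun a b h => ?_⟩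
    · simp only [Pi.add_apply, hc a b, hd a b]; ring
    · simp [hc' a b h, hd' a b h]
  zero_mem' := by simp
  smul_mem' := by
    rintro m c ⟨hc, hc'⟩
    refine ⟨fun a b => ?_, fun a b h => ?_⟩
    · simp [hc a b]
    · simp [hc' a b h]

/-- The 1-cochains of a cover. -/
abbrev Cochains (i : AssociatedCover W) : Type := cechOneCochains i.U

open Classical in
/-- The map on 1-cochains induced by a refinement: it pulls a cochain back along the refinement
map on vertices. -/
def refine (i j : AssociatedCover W) (_h : i ≤ j) : Cochains i →ₗ[ℤ] Cochains j where
  toFun c := ⟨fun a b => if (j.U a ∩ j.U b).Nonempty then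
      c.1 (retract i.X a) (retract i.X b) else 0, by
    refine ⟨fun a b => ?_, fun a b h => ?_⟩
    · by_cases h : (j.U a ∩ j.U b).Nonempty
      · simp [h, inter_comm (j.U b), c.2.1 (retract i.X a)]
      · simp [h, inter_comm (j.U b)]
    · simp [h]⟩
  map_add' c d := by
    ext a b
    by_cases h : (j.U a ∩ j.U b).Nonempty <;> simp [h]
  map_smul' m c := by
    ext a b
    by_cases h : (j.U a ∩ j.U b).Nonempty <;> simp [h]

open Classical in
/-- The direct limit of the groups of 1-cochains of the covers associated to finite subtrees. -/
abbrev CochainLimit (W : Set (Gp n)) : Type :=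
  Module.DirectLimit (fun i : AssociatedCover W => Cochains i) refine

open Classical in
/-- The class in the direct limit of a 1-cochain. -/
def toLimit (i : AssociatedCover W) : Cochains i →ₗ[ℤ] CochainLimit W :=
  Module.DirectLimit.of ℤ (AssociatedCover W) (fun i => Cochains i) refine i

/-- The map on 1-cochains induced by `g : g⁻¹ U → U`. -/
def translateCochain (g : Gp n) (i : AssociatedCover W) :
    Cochains i →ₗ[ℤ] Cochains (i.translate g) where
  toFun c := ⟨fun a b => c.1 (g * a) (g * b), by
    refine ⟨fun a b => c.2.1 _ _, fun a b h => c.2.2 _ _ ?_⟩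
    rw [eq_empty_iff_forall_notMem] at h ⊢
    rintro d ⟨h1, h2⟩
    exact h (g⁻¹ • d) ⟨by simpa [AssociatedCover.translate] using h1,
      by simpa [AssociatedCover.translate] using h2⟩⟩
  map_add' _ _ := rfl
  map_smul' _ _ := rfl

theorem toLimit_congr {i j : AssociatedCover W} (h : i = j) (c : Cochains i) (d : Cochains j)
    (hcd : c.1 = d.1) : toLimit i c = toLimit j d := by
  subst h
  rw [Subtype.ext hcd]

theorem translateCochain_refine (g : Gp n) {i j : AssociatedCover W} (h : i ≤ j)
    (c : Cochains i) : translateCochain g j (refine i j h c) =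
      refine (i.translate g) (j.translate g) (AssociatedCover.translate_mono h g)
        (translateCochain g i c) := by
  classical
  have key : ∀ a, (j.translate g).U a ≠ ∅ →
      retract i.X (g * a) = g * retract (i.translate g).X a := by
    intro a ha
    have ha' : a ∈ whVertices (j.translate g).X := by
      by_contra hn
      exact ha ((j.translate g).eq_empty a hn)
    exact retract_translate i.subtree g
      (fun h' => (mem_whVertices_translate.1 ha').1 (h.1 h'))
  have hiff : ∀ a b, ((j.U (g * a) ∩ j.U (g * b)).Nonempty) ↔
      ((j.translate g).U a ∩ (j.translate g).U b).Nonempty := by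
    intro a b
    constructor
    · rintro ⟨d, h1, h2⟩
      exact ⟨g⁻¹ • d, by simpa [AssociatedCover.translate] using h1,
        by simpa [AssociatedCover.translate] using h2⟩
    · rintro ⟨d, h1, h2⟩
      exact ⟨g • d, h1, h2⟩
  ext a b
  show (if (j.U (g * a) ∩ j.U (g * b)).Nonempty then
      c.1 (retract i.X (g * a)) (retract i.X (g * b)) else 0) =
    if ((j.translate g).U a ∩ (j.translate g).U b).Nonempty then
      c.1 (g * retract (i.translate g).X a) (g * retract (i.translate g).X b) else 0
  by_cases hne : ((j.translate g).U a ∩ (j.translate g).U b).Nonempty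
  · rw [if_pos hne, if_pos ((hiff a b).2 hne), key a, key b]
    · rintro h0; rw [h0, inter_empty] at hne; exact not_nonempty_empty hne
    · rintro h0; rw [h0, empty_inter] at hne; exact not_nonempty_empty hne
  · rw [if_neg hne, if_neg (fun h' => hne ((hiff a b).1 h'))]

open Classical in
/-- The map `m ↦ m g` of the direct limit. -/
def translateLimit (W : Set (Gp n)) (g : Gp n) : CochainLimit W →ₗ[ℤ] CochainLimit W :=
  Module.DirectLimit.lift ℤ (AssociatedCover W) (fun i => Cochains i) refine
    (fun i => (toLimit (i.translate g)).comp (translateCochain g i)) fun i j h c => by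
      rw [LinearMap.comp_apply, LinearMap.comp_apply, translateCochain_refine]
      exact Module.DirectLimit.of_f

theorem translateLimit_toLimit (g : Gp n) (i : AssociatedCover W) (c : Cochains i) :
    translateLimit W g (toLimit i c) = toLimit (i.translate g) (translateCochain g i c) := by
  classical
  exact Module.DirectLimit.lift_of _ _ _

theorem limit_ext {f f' : CochainLimit W →ₗ[ℤ] CochainLimit W}
    (h : ∀ i c, f (toLimit i c) = f' (toLimit i c)) : f = f' := by
  classical
  exact Module.DirectLimit.hom_ext fun i => LinearMap.ext fun c => h i c

/-- The right action of the free group on the direct limit. A right action is encoded, as usual in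
Mathlib, as an action of the opposite group. -/
def rightAction (W : Set (Gp n)) : Representation ℤ (Gp n)ᵐᵒᵖ (CochainLimit W) where
  toFun g := translateLimit W g.unop
  map_one' := limit_ext fun i c => by
    rw [translateLimit_toLimit]
    exact toLimit_congr i.translate_one _ _
      (by funext a b; show c.1 (1 * a) (1 * b) = _; simp)
  map_mul' g h := limit_ext fun i c => by
    rw [Module.End.mul_apply, translateLimit_toLimit, translateLimit_toLimit,
      translateLimit_toLimit]
    refine toLimit_congr (by rw [AssociatedCover.translate_translate]; rfl) _ _ ?_
    funext a b
    show c.1 (h.unop * g.unop * a) (h.unop * g.unop * b) =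
      c.1 (h.unop * (g.unop * a)) (h.unop * (g.unop * b))
    simp [mul_assoc]

/-- The integral group ring, with the opposite multiplication: its left modules are the right
modules over the group ring of the free group. -/
abbrev GroupRing (n : ℕ) : Type := MonoidAlgebra ℤ (Gp n)ᵐᵒᵖ

/-- The direct limit of the groups of 1-cochains as a right module over the free group. -/
abbrev CochainModule (W : Set (Gp n)) : Type := (rightAction W).asModule

/-- The element of the module represented by a 1-cochain of a cover. -/
def cochainClass (i : AssociatedCover W) (c : Cochains i) : CochainModule W :=
  (rightAction W).asModuleEquiv.symm (toLimit i c)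

/-- An element of the module is supported on `X` if it is represented by a 1-cochain of a cover
associated to `X`. -/
def SupportedOn (m : CochainModule W) (X : Set (Gp n)) : Prop :=
  ∃ (i : AssociatedCover W) (c : Cochains i), i.X = X ∧ cochainClass i c = m

/-- The ball of radius `r` about the identity in the tree. -/
def ball (n r : ℕ) : Set (Gp n) := {g | g.norm ≤ r}

open Classical in
/-- The 1-cochain that assigns `1` to the edge from `a` to `b` of the Whitehead graph and `0` to
all of the other edges. (It is zero if there is no such edge.) -/
def edgeCochain (i : AssociatedCover W) (a b : Gp n) : Cochains i :=
  ⟨fun x y => if (i.U x ∩ i.U y).Nonempty then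
      (if x = a ∧ y = b then 1 else 0) - (if x = b ∧ y = a then 1 else 0) else 0, by
    refine ⟨fun x y => ?_, fun x y h => ?_⟩
    · by_cases h : (i.U x ∩ i.U y).Nonempty
      · simp [h, inter_comm (i.U y), and_comm]
      · simp [h, inter_comm (i.U y)]
    · simp [h]⟩

/-! ### Finite encodings of the input and the output of the algorithms -/

/-- A word in the letters `x_j ^ ± 1`: the pair `(j, true)` stands for `x_j` and `(j, false)`
for its inverse. -/
abbrev Word : Type := List (ℕ × Bool)

/-- The element of the free group of rank `n` that a word spells; letters `x_j ^ ± 1` with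
`j ≥ n` are ignored. -/
def Word.eval (n : ℕ) (w : Word) : Gp n :=
  FreeGroup.mk (w.filterMap fun s => if h : s.1 < n then some (⟨s.1, h⟩, s.2) else none)

/-- A finite set of words, as a subset of the free group. -/
def wordSet (n : ℕ) (ws : List Word) : Set (Gp n) := {g | ∃ w ∈ ws, w.eval n = g}

/-- The homomorphism of right modules from the free module with basis `e_0, …, e_{k-1}` to the
module that sends `e_j` to the class of the cochain of the `j`-th edge in the list. -/
def presentationMap (i : AssociatedCover W) (edges : List (Word × Word)) :
    (Fin edges.length →₀ GroupRing n) →ₗ[GroupRing n] CochainModule W :=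
  Finsupp.linearCombination (GroupRing n) fun j =>
    cochainClass i (edgeCochain i ((edges.get j).1.eval n) ((edges.get j).2.eval n))

/-- The element of the free right module on `e_0, …, e_{k-1}` that is encoded by a list of triples
`(m, j, g)`: the sum of the terms `m (e_j g)`. (Terms with `j ≥ k` are ignored.) -/
def decodeRelator (n k : ℕ) (l : List (ℤ × ℕ × Word)) : Fin k →₀ GroupRing n :=
  (l.map fun t => if h : t.2.1 < k then
    Finsupp.single ⟨t.2.1, h⟩ (MonoidAlgebra.single (MulOpposite.op (t.2.2.eval n)) t.1)
    else 0).sum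

end LinePattern
end
open LinePattern

noncomputable section
namespace LinePattern
open Filter Topology Set

section
variable {n : ℕ}

/-! ### Reduced words -/

/-! An element of `M` is determined by a finitely supported antisymmetric function on the oriented
lines. On a line, a cochain over `X` takes its value at the pair of vertices through which the two
ends leave `X`. The two ends have the same image in the decomposition space, so the two sets of the
cover meet, and refinement does not change this value (`lineValue_refine`). Covers of balls are
cofinal, and every edge of the Whitehead graph at a ball is crossed by a line, so the resulting map
`value` is injective (`value_injective`). It turns the action of `g` into precomposition with `g`.

Let `ℓ` bound the lengths of the words. Two lines through the identity that share `2ℓ` steps from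
there coincide: they are axes of cyclically reduced elements of length at most `ℓ`, and periodic
words that agree for that long have a common power (`IsLine.eq_of_ray_eq`). Hence, if `2ℓ ≤ r + 1`,
an edge at `B_r` whose vertices lie in different directions from the identity (a central edge) is
crossed by exactly one line `q` up to orientation, and its cochain is the function `delta q`. Every
line has a translate through the identity, so the translates of central edges generate `M`. This
gives part 1 and the surjectivity in part 2.

For the kernel, a line through `v` is represented by `± e_j v⁻¹` with `j` central. Two kinds of
relators suffice (`IsRelatorSet`): for each `j`, one that writes `e_j` in terms of translates of
central generators, and all valid relations `e_j ± e_j' s` with `j`, `j'` central and `s` a letter.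
The latter identify the representatives of a line at adjacent vertices, and so all of its
representatives (`Represents.sub_mem`). Modulo the relators, one representative for each unoriented
line spans the free module over the integers. The images `delta q` of these are independent, so the
kernel contains nothing else (`span_eq_ker`).

It is decidable whether a combination of translated edges vanishes: only lines that cross one of the
translated balls matter, and up to the translations these are among the `g w ^ k` with `|g| ≤ r + ℓ`
(`LineEnds.exists_norm_le`, `vanishes_iff`). So the relators of the second kind can be filtered from
a finite list. Those of the first kind are found by an unbounded search, which halts because the
central edges generate `M` (`exists_expresses`). -/

/-- The inverse letter. -/
def sinv (s : Letter n) : Letter n := (s.1, !s.2)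

@[simp] theorem sinv_sinv (s : Letter n) : sinv (sinv s) = s := by simp [sinv]

theorem letter_sinv (s : Letter n) : letter (sinv s) = (letter s)⁻¹ := by
  simp [letter, sinv, FreeGroup.inv_mk, FreeGroup.invRev]

theorem toWord_letter (s : Letter n) : (letter s).toWord = [s] := by
  simp [letter]

theorem toWord_letter_mul (s : Letter n) (g : Gp n) :
    (letter s * g).toWord =
      if g.toWord.head? = some (sinv s) then g.toWord.tail else s :: g.toWord := by
  rw [FreeGroup.toWord_mul, toWord_letter, List.singleton_append, FreeGroup.reduce.cons,
    FreeGroup.reduce_toWord]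
  cases h : g.toWord with
  | nil => simp
  | cons t L =>
    simp only [List.head?_cons, Option.some.injEq, List.tail_cons, sinv]
    by_cases h1 : s.1 = t.1 ∧ s.2 = !t.2
    · rw [if_pos h1, if_pos]
      ext <;> simp [h1.1, h1.2]
    · rw [if_neg h1, if_neg]
      rintro rfl
      simp at h1

theorem mul_letter_inv (x : Gp n) (s : Letter n) : x * letter s * letter (sinv s) = x := by
  rw [letter_sinv, mul_inv_cancel_right]

theorem toWord_mul_letter (x : Gp n) (s : Letter n) :
    (x * letter s).toWord =
      if x.toWord.getLast? = some (sinv s) then x.toWord.dropLast else x.toWord ++ [s] := by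
  have h1 : x * letter s = (letter (sinv s) * x⁻¹)⁻¹ := by
    rw [mul_inv_rev, inv_inv, letter_sinv, inv_inv]
  rw [h1, FreeGroup.toWord_inv, toWord_letter_mul, FreeGroup.toWord_inv, sinv_sinv]
  have h2 : (FreeGroup.invRev x.toWord).head? = some s ↔ x.toWord.getLast? = some (sinv s) := by
    rw [FreeGroup.invRev, List.head?_reverse, List.getLast?_map]
    cases x.toWord.getLast? with
    | none => simp
    | some t =>
      simp only [Option.map_some, Option.some.injEq, sinv, Prod.ext_iff]
      constructor <;> rintro ⟨h, h'⟩ <;> simp_all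
  by_cases h : x.toWord.getLast? = some (sinv s)
  · rw [if_pos (h2.2 h), if_pos h]
    simp [FreeGroup.invRev, List.map_dropLast, Function.comp_def]
  · rw [if_neg (fun h' => h (h2.1 h')), if_neg h]
    rw [← List.singleton_append, FreeGroup.invRev_append, FreeGroup.invRev_invRev]
    simp [FreeGroup.invRev, sinv]

theorem toWord_of_append {g a : Gp n} {L : List (Letter n)} (h : g.toWord = a.toWord ++ L) :
    (a⁻¹ * g).toWord = L := by
  have h1 : g = a * FreeGroup.mk L := by
    rw [← FreeGroup.mk_toWord (x := g), h, ← FreeGroup.mul_mk, FreeGroup.mk_toWord]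
  rw [h1, inv_mul_cancel_left, FreeGroup.toWord_mk]
  have h2 : FreeGroup.IsReduced g.toWord := FreeGroup.isReduced_toWord
  rw [h] at h2
  exact (h2.infix ⟨a.toWord, [], by simp⟩).reduce_eq

/-- Whether the letter cancels depends only on the first letter of the word, so at most one letter
of a common prefix is lost. -/
theorem take_toWord_letter_mul (s : Letter n) {a b : Gp n} {L : ℕ}
    (h : a.toWord.take (L + 1) = b.toWord.take (L + 1)) :
    (letter s * a).toWord.take L = (letter s * b).toWord.take L := by
  have hh : a.toWord.head? = b.toWord.head? := by
    have := congrArg List.head? h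
    simpa [List.head?_take] using this
  rw [toWord_letter_mul, toWord_letter_mul, hh]
  split_ifs
  · have := congrArg List.tail h
    simpa only [← List.drop_one, List.drop_take, Nat.add_sub_cancel] using this
  · cases L with
    | zero => simp
    | succ L =>
      rw [List.take_succ_cons, List.take_succ_cons]
      have := congrArg (List.take L) h
      simp only [List.take_take] at this
      rw [min_eq_left (by omega)] at this
      rw [this]

/-- Left multiplication by `h` is `h.norm` multiplications by letters, each of which costs at most
one letter of the common prefix. -/
theorem take_toWord_mul (h : Gp n) {a b : Gp n} {L : ℕ}
    (hab : a.toWord.take (L + h.norm) = b.toWord.take (L + h.norm)) :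
    (h * a).toWord.take L = (h * b).toWord.take L := by
  obtain ⟨W, hW⟩ : ∃ W, h.toWord = W := ⟨_, rfl⟩
  have hm : h = FreeGroup.mk W := by rw [← hW, FreeGroup.mk_toWord]
  have hn : h.norm = W.length := by rw [← hW]; rfl
  rw [hn] at hab
  rw [hm]
  clear hW hm hn
  induction W generalizing L with
  | nil =>
    rw [← FreeGroup.one_eq_mk, one_mul, one_mul]; simpa using hab
  | cons s W ih =>
    have h1 : (FreeGroup.mk (s :: W) : Gp n) = letter s * FreeGroup.mk W := by
      rw [letter, FreeGroup.mul_mk]; rfl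
    rw [h1, mul_assoc, mul_assoc]
    apply take_toWord_letter_mul
    apply ih
    simpa [add_assoc, add_comm 1] using hab

/-- The reduced words of the powers of an element. -/
theorem exists_toWord_pow {w : Gp n} (hw : w ≠ 1) :
    ∃ u C : List (Letter n), C ≠ [] ∧ FreeGroup.IsCyclicallyReduced C ∧
      ∀ k, 1 ≤ k → (w ^ k).toWord = u ++ (List.replicate k C).flatten ++ FreeGroup.invRev u := by
  have key : ∀ j, 1 ≤ j → (w ^ j).toWord = FreeGroup.reduceCyclically.conjugator w.toWord ++
      (List.replicate j (FreeGroup.reduceCyclically w.toWord)).flatten ++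
        FreeGroup.invRev (FreeGroup.reduceCyclically.conjugator w.toWord) := by
    intro j hj
    rw [FreeGroup.toWord_pow,
      FreeGroup.reduceCyclically.reduce_flatten_replicate FreeGroup.isReduced_toWord,
      if_neg (by omega)]
  -- The two words are the conjugator `u` and the cyclically reduced core of `w`; an empty core
  -- would give `w = u u⁻¹ = 1`. The exponent `0` is excluded because `u u⁻¹` is in general not a
  -- reduced word.
  refine ⟨_, _, fun h0 => hw ?_,
    FreeGroup.reduceCyclically.isCyclicallyReduced FreeGroup.isReduced_toWord, key⟩
  have := key 1 le_rfl
  rw [h0] at this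
  have h2 := congrArg FreeGroup.mk this
  rw [FreeGroup.mk_toWord] at h2
  simpa [← FreeGroup.mul_mk, ← FreeGroup.inv_mk] using h2

theorem le_length_flatten_replicate {C : List (Letter n)} (hC : C ≠ []) (k : ℕ) :
    k ≤ (List.replicate k C).flatten.length := by
  have : 1 ≤ C.length := List.length_pos_iff.2 hC
  simp
  nlinarith

theorem take_flatten_replicate (A C : List (Letter n)) (hC : C ≠ []) {k m : ℕ} (hkm : k ≤ m)
    (B B' : List (Letter n)) : (A ++ (List.replicate k C).flatten ++ B).take k =
      (A ++ (List.replicate m C).flatten ++ B').take k := by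
  have := le_length_flatten_replicate hC k
  have h2 : ∀ A B D : List (Letter n), k ≤ B.length →
      (A ++ B ++ D).take k = (A ++ B).take k := fun A B D h =>
    List.take_append_of_le_length (by rw [List.length_append]; omega)
  obtain ⟨d, rfl⟩ := Nat.exists_eq_add_of_le hkm
  rw [List.replicate_add, List.flatten_append, ← List.append_assoc A,
    List.append_assoc (_ ++ _), h2 _ _ _ this, h2 _ _ _ this]

/-- The first letters of the powers of an element stabilize. -/
theorem toWord_pow_prefix {w : Gp n} (hw : w ≠ 1) {k m : ℕ} (hkm : k ≤ m) :
    k ≤ (w ^ k).norm ∧ (w ^ k).toWord.take k = (w ^ m).toWord.take k := by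
  rcases Nat.eq_zero_or_pos k with rfl | hk
  · simp
  obtain ⟨u, C, hC, -, key⟩ := exists_toWord_pow hw
  constructor
  · have := le_length_flatten_replicate hC k
    rw [FreeGroup.norm, key k hk, List.length_append, List.length_append]
    omega
  · rw [key k hk, key m (le_trans hk hkm)]
    exact take_flatten_replicate u C hC hkm _ _

theorem norm_le_norm_mul_add (h a : Gp n) : a.norm ≤ (h * a).norm + h.norm := by
  have := FreeGroup.norm_mul_le h⁻¹ (h * a)
  rw [inv_mul_cancel_left, FreeGroup.norm_inv_eq] at this
  omega

/-- From the exponent `h.norm + j` on, the first `h.norm + j` letters of `w ^ m` are constant, and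
multiplication by `h` spoils at most `h.norm` of them. -/
theorem toWord_mul_pow_take {w : Gp n} (hw : w ≠ 1) (h : Gp n) {j m m' : ℕ}
    (hm : h.norm + j ≤ m) (hm' : h.norm + j ≤ m') :
    (h * w ^ m).toWord.take j = (h * w ^ m').toWord.take j := by
  have key : ∀ m, h.norm + j ≤ m → (h * w ^ m).toWord.take j =
      (h * w ^ (h.norm + j)).toWord.take j := fun m hm => by
    apply take_toWord_mul
    rw [add_comm j]
    exact (toWord_pow_prefix hw hm).2.symm
  rw [key m hm, key m' hm']

theorem le_norm_mul_pow {w : Gp n} (hw : w ≠ 1) (h : Gp n) {j m : ℕ} (hm : h.norm + j ≤ m) :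
    j ≤ (h * w ^ m).norm := by
  have h1 := (toWord_pow_prefix hw (le_refl m)).1
  have h2 := norm_le_norm_mul_add h (w ^ m)
  omega

/-! ### Rays -/

/-- The vertices of the geodesic ray from `v` to the end `ξ`. -/
def rayFrom (ξ : Boundary n) (v : Gp n) : ℕ → Gp n
  | 0 => v
  | k + 1 => rayFrom ξ v k * letter (ξ.1 (rayFrom ξ v k))

/-- The vertices of the geodesic ray from the identity to the end `ξ`. -/
abbrev ray (ξ : Boundary n) : ℕ → Gp n := rayFrom ξ 1

theorem rayFrom_add (ξ : Boundary n) (v : Gp n) (a k : ℕ) :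
    rayFrom ξ v (a + k) = rayFrom ξ (rayFrom ξ v a) k := by
  induction k with
  | zero => rfl
  | succ k ih => rw [← add_assoc, rayFrom, ih, rayFrom]

theorem mul_rayFrom (g : Gp n) (ξ : Boundary n) (v : Gp n) (k : ℕ) :
    g * rayFrom ξ v k = rayFrom (g • ξ) (g * v) k := by
  induction k with
  | zero => rfl
  | succ k ih =>
    rw [rayFrom, rayFrom, ← ih, Boundary.smul_val, inv_mul_cancel_left, mul_assoc]

/-- The ray does not backtrack. -/
theorem rayFrom_val_succ (ξ : Boundary n) (v : Gp n) (k : ℕ) :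
    ξ.1 (rayFrom ξ v (k + 1)) ≠ sinv (ξ.1 (rayFrom ξ v k)) := by
  intro h
  exact (ξ.2 (rayFrom ξ v k) _).1 h rfl

theorem toWord_ray_succ (ξ : Boundary n) (k : ℕ) :
    (ray ξ (k + 1)).toWord = (ray ξ k).toWord ++ [ξ.1 (ray ξ k)] := by
  induction k with
  | zero => simp [rayFrom, toWord_letter]
  | succ k ih =>
    rw [ray, rayFrom, toWord_mul_letter, if_neg]
    rw [ih, List.getLast?_concat]
    intro h
    have := rayFrom_val_succ ξ 1 k
    rw [Option.some.inj h, sinv_sinv] at this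
    exact this rfl

theorem norm_ray (ξ : Boundary n) (k : ℕ) : (ray ξ k).norm = k := by
  induction k with
  | zero => simp [rayFrom]
  | succ k ih =>
    rw [FreeGroup.norm] at ih ⊢
    rw [toWord_ray_succ, List.length_append, ih]; rfl

theorem take_ray (ξ : Boundary n) {j k : ℕ} (h : j ≤ k) :
    (ray ξ k).toWord.take j = (ray ξ j).toWord := by
  induction k, h using Nat.le_induction with
  | base => exact List.take_of_length_le (norm_ray ξ j).le
  | succ k hk ih =>
    have := norm_ray ξ k
    rw [FreeGroup.norm] at this
    rw [toWord_ray_succ, List.take_append_of_le_length (by omega), ih]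

theorem ray_eq_of_le {ξ η : Boundary n} {j k : ℕ} (h : j ≤ k) (hk : ray ξ k = ray η k) :
    ray ξ j = ray η j := by
  apply FreeGroup.toWord_injective
  rw [← take_ray ξ h, ← take_ray η h, hk]

theorem head_ray (ξ : Boundary n) {k : ℕ} (h : 1 ≤ k) :
    (ray ξ k).toWord.head? = some (ξ.1 1) := by
  have := take_ray ξ h
  have h2 := congrArg List.head? this
  rw [List.head?_take, if_neg one_ne_zero] at h2
  rw [h2, toWord_ray_succ]
  simp [rayFrom]

/-- A vertex at which an end points away from the identity lies on the ray to this end. -/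
theorem eq_ray_of_getLast? (ξ : Boundary n) (x : Gp n)
    (h : x.toWord.getLast? ≠ some (sinv (ξ.1 x))) : x = ray ξ x.norm := by
  obtain ⟨m, hm⟩ : ∃ m, x.norm = m := ⟨_, rfl⟩
  induction m generalizing x with
  | zero =>
    rw [FreeGroup.norm_eq_zero.1 hm]; simp [rayFrom]
  | succ m ih =>
    rcases List.eq_nil_or_concat' x.toWord with h0 | ⟨L, t, hL⟩
    · rw [FreeGroup.norm, h0] at hm; simp at hm
    have hred : FreeGroup.IsReduced (L ++ [t]) := hL ▸ FreeGroup.isReduced_toWord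
    have hLred : FreeGroup.reduce L = L := (hred.infix ⟨[], [t], by simp⟩).reduce_eq
    set x' : Gp n := FreeGroup.mk L with hx'
    have hxx : x = x' * letter t := by
      rw [hx', letter, FreeGroup.mul_mk, ← hL, FreeGroup.mk_toWord]
    have hw : x'.toWord = L := by rw [hx', FreeGroup.toWord_mk, hLred]
    have hn : x'.norm = m := by
      rw [FreeGroup.norm, hL] at hm
      rw [FreeGroup.norm, hw]
      simpa using hm
    -- Each edge points to the end from exactly one of its endpoints; were it not `x'`, the end
    -- would point from `x` back towards the identity, against `h`.
    have hξ : ξ.1 x' = t := by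
      by_contra hne
      have := (ξ.2 x' t).2 hne
      rw [← hxx] at this
      apply h
      rw [hL, List.getLast?_concat, this]
      simp [sinv]
    have := ih x' (by
      rw [hw, hξ]
      intro h'
      have h3 : (x' * letter t).toWord = L ++ [t] := by rw [← hxx, hL]
      rw [toWord_mul_letter, hw, if_pos h'] at h3
      have := congrArg List.length h3
      simp at this) hn
    rw [hm, ← hn, ray, rayFrom, ← ray, ← this, hξ, ← hxx]

/-- The geodesic rays to an end from any two vertices merge. -/
theorem rayFrom_merge (ξ : Boundary n) (v : Gp n) :
    ∃ a b, rayFrom ξ v a = ray ξ b := by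
  obtain ⟨W, hW⟩ : ∃ W, v = FreeGroup.mk W := ⟨_, FreeGroup.mk_toWord.symm⟩
  induction W using List.reverseRecOn generalizing v with
  | nil => exact ⟨0, 0, by rw [hW]; rfl⟩
  | append_singleton L s ih =>
    obtain ⟨a, b, hab⟩ := ih _ rfl
    set u : Gp n := FreeGroup.mk L
    have hv : v = u * letter s := by rw [hW, letter, FreeGroup.mul_mk]
    -- Either the ray from `u` starts with the step to `v`, or the ray from `v` starts with the step
    -- to `u`; one of the rays is the tail of the other.
    by_cases h : ξ.1 u = s
    · have h1 : rayFrom ξ u 1 = v := by rw [rayFrom, rayFrom, h, hv]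
      refine ⟨a, b + 1, ?_⟩
      rw [ray, rayFrom_add, ← ray, ← hab, ← rayFrom_add, add_comm, rayFrom_add, h1]
    · have h1 := (ξ.2 u s).2 h
      rw [← hv] at h1
      refine ⟨1 + a, b, ?_⟩
      rw [rayFrom_add, ← hab]
      congr 1
      rw [rayFrom, rayFrom, h1, hv]
      exact mul_letter_inv u s

/-- Once the ray from the identity has merged with the ray from `v`, its vertices are seen from `v`
in the direction of the first step of the latter. -/
theorem convergesTo_ray (ξ : Boundary n) : ConvergesTo (ray ξ) ξ := by
  intro v
  obtain ⟨a, b, hab⟩ := rayFrom_merge ξ v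
  filter_upwards [eventually_ge_atTop (b + 1)] with k hk
  obtain ⟨d, rfl⟩ := Nat.exists_eq_add_of_le hk
  rw [ray, add_assoc, rayFrom_add, ← ray, ← hab, ← rayFrom_add, mul_rayFrom, inv_mul_cancel,
    head_ray _ (by omega), Boundary.smul_val, inv_inv, mul_one]

theorem ConvergesTo.unique {u : ℕ → Gp n} {ξ η : Boundary n} (h : ConvergesTo u ξ)
    (h' : ConvergesTo u η) : ξ = η := by
  refine Subtype.ext (funext fun v => ?_)
  obtain ⟨k, h1, h2⟩ := ((h v).and (h' v)).exists
  exact Option.some.inj (h1.symm.trans h2)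

theorem ray_injective {ξ η : Boundary n} (h : ∀ k, ray ξ k = ray η k) : ξ = η :=
  (convergesTo_ray ξ).unique ((funext h : ray ξ = ray η) ▸ convergesTo_ray η)

theorem ConvergesTo.take {u : ℕ → Gp n} {ξ : Boundary n} (h : ConvergesTo u ξ) (j : ℕ) :
    ∀ᶠ k in atTop, (u k).toWord.take j = (ray ξ j).toWord := by
  induction j with
  | zero => simp [rayFrom]
  | succ j ih =>
    filter_upwards [ih, h (ray ξ j)] with k h1 h2
    have h3 : (u k).toWord = (ray ξ j).toWord ++ (u k).toWord.drop j := by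
      rw [← h1, List.take_append_drop]
    have h4 := toWord_of_append h3
    rw [h4] at h2
    rw [toWord_ray_succ, h3]
    have hl : (ray ξ j).toWord.length = j := norm_ray ξ j
    rw [List.take_append, hl, Nat.add_sub_cancel_left, List.take_of_length_le (by omega)]
    congr 1
    revert h2
    cases (u k).toWord.drop j with
    | nil => simp
    | cons t L => simp

/-- The limiting directions form an end automatically: the directions at the two endpoints of an
edge can be compared on one late term of the sequence, where the word seen from `v * letter s`
arises from the word seen from `v` by multiplication by a letter. -/
theorem exists_convergesTo {u : ℕ → Gp n}
    (h : ∀ v, ∃ s, ∀ᶠ k in atTop, (v⁻¹ * u k).toWord.head? = some s) :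
    ∃ ξ, ConvergesTo u ξ := by
  choose f hf using h
  refine ⟨⟨f, fun v s => ?_⟩, hf⟩
  obtain ⟨k, h1, h2⟩ := ((hf v).and (hf (v * letter s))).exists
  have h3 : (v * letter s)⁻¹ * u k = letter (sinv s) * (v⁻¹ * u k) := by
    rw [mul_inv_rev, letter_sinv, mul_assoc]
  rw [h3, toWord_letter_mul, sinv_sinv, h1] at h2
  change f (v * letter s) = sinv s ↔ _
  by_cases hs : f v = s
  · simp only [hs, ne_eq, not_true_eq_false, iff_false, if_true] at h2 ⊢
    intro h4
    have hred : FreeGroup.IsReduced (v⁻¹ * u k).toWord := FreeGroup.isReduced_toWord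
    revert h1 h2 hred
    cases (v⁻¹ * u k).toWord with
    | nil => simp
    | cons a L =>
      cases L with
      | nil => simp
      | cons b L =>
        intro h1 h2 hred
        simp only [List.head?_cons, Option.some.injEq, List.tail_cons] at h1 h2
        have := (List.isChain_cons_cons.1 hred).1
        rw [h1, h2, h4, hs] at this
        have := this rfl
        simp [sinv] at this
  · rw [if_neg (fun h => hs (Option.some.inj h))] at h2
    simp only [List.head?_cons, Option.some.injEq] at h2
    simp [← h2, hs]

theorem exists_convergesTo_pow {w : Gp n} (hw : w ≠ 1) (g : Gp n) :
    ∃ ξ, ConvergesTo (fun k => g * w ^ k) ξ := by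
  apply exists_convergesTo
  intro v
  have h1 := le_norm_mul_pow hw (v⁻¹ * g) (j := 1) le_rfl
  obtain ⟨s, hs⟩ : ∃ s, (v⁻¹ * g * w ^ ((v⁻¹ * g).norm + 1)).toWord.head? = some s := by
    rw [FreeGroup.norm] at h1
    revert h1
    cases (v⁻¹ * g * w ^ ((v⁻¹ * g).norm + 1)).toWord <;> simp
  refine ⟨s, ?_⟩
  filter_upwards [eventually_ge_atTop ((v⁻¹ * g).norm + 1)] with k hk
  have h2 := congrArg List.head? (toWord_mul_pow_take hw (v⁻¹ * g) hk le_rfl)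
  rw [List.head?_take, List.head?_take, if_neg one_ne_zero, if_neg one_ne_zero, hs] at h2
  rw [← h2, mul_assoc]

/-- The vertices of the ray to the end of a line are initial segments of points of the line. -/
theorem ConvergesTo.toWord_ray {w g : Gp n} (hw : w ≠ 1) {ξ : Boundary n}
    (h : ConvergesTo (fun k => g * w ^ k) ξ) {j m : ℕ} (hm : g.norm + j ≤ m) :
    (ray ξ j).toWord = (g * w ^ m).toWord.take j := by
  obtain ⟨k, h1, h2⟩ := ((h.take j).and (eventually_ge_atTop (g.norm + j))).exists
  rw [← h1, toWord_mul_pow_take hw g h2 hm]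

/-- The next vertex of the ray depends only on the coordinate of the end at the current one. -/
theorem isOpen_ray_eq (j : ℕ) (a : Gp n) : IsOpen {ξ : Boundary n | ray ξ j = a} := by
  induction j generalizing a with
  | zero => exact isOpen_const (p := (1 : Gp n) = a)
  | succ j ih =>
    have : {ξ : Boundary n | ray ξ (j + 1) = a} =
        ⋃ x, {ξ : Boundary n | ray ξ j = x} ∩ {ξ : Boundary n | x * letter (ξ.1 x) = a} := by
      ext ξ
      simp [rayFrom]
    rw [this]
    refine isOpen_iUnion fun x => (ih x).inter ?_
    have hc : Continuous fun ξ : Boundary n => ξ.1 x :=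
      (continuous_apply x).comp continuous_subtype_val
    exact (isOpen_discrete {s : Letter n | x * letter s = a}).preimage hc

theorem isOpen_ray_mem (j : ℕ) (S : Set (Gp n)) : IsOpen {ξ : Boundary n | ray ξ j ∈ S} := by
  have : {ξ : Boundary n | ray ξ j ∈ S} = ⋃ a ∈ S, {ξ : Boundary n | ray ξ j = a} := by
    ext ξ; simp
  rw [this]
  exact isOpen_biUnion fun a _ => isOpen_ray_eq j a

instance : T2Space (Boundary n) :=
  inferInstanceAs (T2Space {ξ : Gp n → Letter n // ∀ v s, ξ (v * letter s) = (s.1, !s.2) ↔ ξ v ≠ s})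

end

section
variable {n : ℕ} {W : Set (Gp n)}

/-! ### Lines -/

/-- The geodesics from the identity to `a` and `b` part at once, so nothing cancels in `a⁻¹ b`. -/
theorem norm_inv_mul_of_head_ne {a b : Gp n} (h : a.toWord.head? ≠ b.toWord.head?) :
    (a⁻¹ * b).norm = a.norm + b.norm := by
  have hred : FreeGroup.IsReduced (FreeGroup.invRev a.toWord ++ b.toWord) := by
    rw [← FreeGroup.toWord_inv]
    refine List.isChain_append.2 ⟨FreeGroup.isReduced_toWord, FreeGroup.isReduced_toWord, ?_⟩
    intro s hs t ht hst
    rw [FreeGroup.toWord_inv, FreeGroup.invRev, List.getLast?_reverse, List.head?_map] at hs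
    cases hb : a.toWord.head? with
    | none => rw [hb] at hs; simp at hs
    | some x =>
      rw [hb] at hs h
      simp only [Option.map_some, Option.mem_def, Option.some.injEq] at hs ht
      rw [ht] at h
      subst hs
      by_contra hne
      apply h
      congr 1
      ext
      · exact congrArg Fin.val hst
      · simp only at hne
        revert hne
        cases x.2 <;> cases t.2 <;> simp
  rw [FreeGroup.norm, FreeGroup.toWord_mul, FreeGroup.toWord_inv, hred.reduce_eq,
    List.length_append, FreeGroup.invRev_length]
  rfl

theorem ConvergesTo.norm {u : ℕ → Gp n} {ξ : Boundary n} (h : ConvergesTo u ξ) (v : Gp n) (j : ℕ) :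
    ∀ᶠ k in atTop, j ≤ (v⁻¹ * u k).norm := by
  filter_upwards [h.take (j + v.norm)] with k hk
  have h1 := congrArg List.length hk
  have h2 := norm_ray ξ (j + v.norm)
  rw [FreeGroup.norm] at h2
  rw [h2, List.length_take] at h1
  have h3 := norm_le_norm_mul_add v⁻¹ (u k)
  rw [FreeGroup.norm_inv_eq] at h3
  rw [FreeGroup.norm] at h3
  omega

/-- The two sequences stay at distance `g.norm`, whereas points in different directions from `v` are
as far apart as the sum of their distances to `v`, which tends to infinity. -/
theorem ConvergesTo.mul_right {u : ℕ → Gp n} {ξ : Boundary n} (h : ConvergesTo u ξ) (g : Gp n) :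
    ConvergesTo (fun k => u k * g) ξ := by
  intro v
  filter_upwards [h v, h.norm v (g.norm + 1)] with k h1 h2
  rw [← h1]
  by_contra hne
  have := norm_inv_mul_of_head_ne (Ne.symm hne)
  rw [show (v⁻¹ * u k)⁻¹ * (v⁻¹ * (u k * g)) = g by group] at this
  omega

theorem ConvergesTo.comp {u : ℕ → Gp n} {ξ : Boundary n} (h : ConvergesTo u ξ) {f : ℕ → ℕ}
    (hf : Tendsto f atTop atTop) : ConvergesTo (fun k => u (f k)) ξ := fun v =>
  hf.eventually (h v)

/-- `ξ` and `η` are the ends of a line of the line pattern, in one of the two orders. -/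
def IsLine (W : Set (Gp n)) (ξ η : Boundary n) : Prop := LineEnds W ξ η ∨ LineEnds W η ξ

theorem IsLine.symm {ξ η : Boundary n} (h : IsLine W ξ η) : IsLine W η ξ := Or.symm h

theorem IsLine.smul {ξ η : Boundary n} (h : IsLine W ξ η) (g : Gp n) :
    IsLine W (g • ξ) (g • η) := h.imp (·.smul g) (·.smul g)

theorem IsLine.exists {ξ η : Boundary n} (h : IsLine W ξ η) :
    ∃ w g : Gp n, (w ∈ W ∨ w⁻¹ ∈ W) ∧ w ≠ 1 ∧ ConvergesTo (fun k => g * w ^ k) ξ ∧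
      ConvergesTo (fun k => g * w⁻¹ ^ k) η := by
  have h1 : ∀ {w g : Gp n} {ξ : Boundary n}, ConvergesTo (fun k => g * w ^ k) ξ → w ≠ 1 := by
    rintro w g ξ h rfl
    obtain ⟨k, hk⟩ := (h g).exists
    simp at hk
  rcases h with ⟨w, hw, g, h, h'⟩ | ⟨w, hw, g, h, h'⟩
  · exact ⟨w, g, .inl hw, h1 h, h, h'⟩
  · exact ⟨w⁻¹, g, .inr (by rwa [inv_inv]), h1 h', h', by rwa [inv_inv]⟩

/-- Write `w = u C u⁻¹` with `C` cyclically reduced. Seen from `g u`, one end lies in the direction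
of the first letter of `C` and the other in that of the inverse of its last letter, and these
differ. -/
theorem IsLine.ne {ξ η : Boundary n} (h : IsLine W ξ η) : ξ ≠ η := by
  obtain ⟨w, g, -, hw, h1, h2⟩ := h.exists
  obtain ⟨u, C, hC, hcyc, key⟩ := exists_toWord_pow hw
  rintro rfl
  obtain ⟨k, ⟨hk1, hk2⟩, hk⟩ := (((h1 (g * FreeGroup.mk u)).and
    (h2 (g * FreeGroup.mk u))).and (eventually_ge_atTop 1)).exists
  have hu : (FreeGroup.mk u : Gp n).toWord = u := by
    have hr : FreeGroup.IsReduced (w ^ k).toWord := FreeGroup.isReduced_toWord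
    rw [key k hk] at hr
    rw [FreeGroup.toWord_mk]
    exact (hr.infix ⟨[], (List.replicate k C).flatten ++ FreeGroup.invRev u, by simp⟩).reduce_eq
  have e1 : ((FreeGroup.mk u : Gp n)⁻¹ * w ^ k).toWord =
      (List.replicate k C).flatten ++ FreeGroup.invRev u :=
    toWord_of_append (by rw [hu, key k hk, List.append_assoc])
  have e2 : ((FreeGroup.mk u : Gp n)⁻¹ * w⁻¹ ^ k).toWord =
      FreeGroup.invRev (List.replicate k C).flatten ++ FreeGroup.invRev u :=
    toWord_of_append (by
      rw [hu, inv_pow, FreeGroup.toWord_inv, key k hk]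
      simp only [FreeGroup.invRev_append, FreeGroup.invRev_invRev, List.append_assoc])
  rw [mul_inv_rev, mul_assoc, inv_mul_cancel_left] at hk1 hk2
  rw [e1] at hk1
  rw [e2, ← hk1] at hk2
  obtain ⟨a, L, rfl⟩ := List.exists_cons_of_ne_nil hC
  have hh : ((List.replicate k (a :: L)).flatten).head? = some a := by
    rw [List.head?_flatten_replicate (by omega)]; rfl
  have hl := List.getLast?_flatten_replicate (l := a :: L) (n := k) (by omega)
  obtain ⟨b, hb⟩ : ∃ b, (a :: L).getLast? = some b := by simp [List.getLast?_cons]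
  have hc := hcyc.2 b hb a rfl
  rw [FreeGroup.invRev, List.head?_append, List.head?_reverse, List.getLast?_map, hl, hb,
    List.head?_append, hh] at hk2
  simp only [Option.map_some, Option.some_or, Option.some.injEq] at hk2
  have h3 := hc ((Prod.ext_iff.1 hk2).1)
  have h4 := (Prod.ext_iff.1 hk2).2
  simp only at h4
  rw [h3] at h4
  simp at h4

/-- A line through the identity is the axis of a cyclically reduced element. -/
theorem IsLine.exists_cyclic {ℓ : ℕ} (hW : ∀ w ∈ W, w.norm ≤ ℓ) {ξ η : Boundary n}
    (h : IsLine W ξ η) (h1 : ξ.1 1 ≠ η.1 1) :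
    ∃ c : Gp n, c ≠ 1 ∧ c.norm ≤ ℓ ∧ (∀ k, (c ^ k).toWord = (List.replicate k c.toWord).flatten) ∧
      ConvergesTo (fun k => c ^ k) ξ ∧ ConvergesTo (fun k => c⁻¹ ^ k) η := by
  obtain ⟨w, g, hwW, hw, hξ, hη⟩ := h.exists
  have hwℓ : w.norm ≤ ℓ := by
    rcases hwW with h | h
    · exact hW w h
    · rw [← FreeGroup.norm_inv_eq]; exact hW _ h
  -- The powers of `c` stay at distance at most `|g|` from the points `g w ^ k`, so they converge to
  -- the same ends.
  set c := g * w * g⁻¹ with hc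
  have hc1 : c ≠ 1 := by
    intro h0
    apply hw
    rw [hc, mul_inv_eq_one] at h0
    simpa using h0
  have hpow : ∀ k : ℕ, c ^ k = g * w ^ k * g⁻¹ := fun k => by rw [hc, conj_pow]
  have hpow' : ∀ k : ℕ, c⁻¹ ^ k = g * w⁻¹ ^ k * g⁻¹ := fun k => by
    rw [inv_pow, hpow, inv_pow]; group
  have cξ : ConvergesTo (fun k => c ^ k) ξ := by
    simp only [hpow]; exact hξ.mul_right _
  have cη : ConvergesTo (fun k => c⁻¹ ^ k) η := by
    simp only [hpow']; exact hη.mul_right _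
  obtain ⟨u, C, hC, hcyc, key⟩ := exists_toWord_pow hc1
  -- A nonempty conjugator would be a common prefix of all positive powers of `c` and of `c⁻¹`, so
  -- both ends would lie in one direction from the identity.
  have hu : u = [] := by
    rcases u with - | ⟨s, u⟩
    · rfl
    exfalso
    obtain ⟨k, ⟨hk1, hk2⟩, hk⟩ := (((cξ 1).and (cη 1)).and (eventually_ge_atTop 1)).exists
    rw [inv_one, one_mul, key k hk] at hk1
    change (1⁻¹ * c⁻¹ ^ k).toWord.head? = _ at hk2
    rw [inv_one, one_mul, inv_pow, FreeGroup.toWord_inv, key k hk, FreeGroup.invRev_append,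
      FreeGroup.invRev_append, FreeGroup.invRev_invRev] at hk2
    simp at hk1 hk2
    exact h1 (hk1.symm.trans hk2)
  subst hu
  have hCc : c.toWord = C := by simpa using key 1 le_rfl
  have hk' : ∀ k, (c ^ k).toWord = (List.replicate k c.toWord).flatten := by
    intro k
    rcases Nat.eq_zero_or_pos k with rfl | hk
    · simp
    · rw [key k hk, hCc]; simp
  refine ⟨c, hc1, ?_, hk', cξ, cη⟩
  -- Here `|c ^ k| = k |c|`, while `|g w ^ k g⁻¹| ≤ k |w| + 2 |g|`; the exponent `k = 2 |g| + 1`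
  -- then rules out `|w| < |c|`.
  by_contra hlt
  have e1 : ∀ k : ℕ, (c ^ k).norm = k * c.norm := fun k => by
    rw [FreeGroup.norm, hk']; simp [FreeGroup.norm]
  have e2 : ∀ k : ℕ, (w ^ k).norm ≤ k * w.norm := fun k => by
    induction k with
    | zero => simp
    | succ k ih =>
      rw [pow_succ]
      have := FreeGroup.norm_mul_le (w ^ k) w
      nlinarith
  have e3 := FreeGroup.norm_mul_le (g * w ^ (2 * g.norm + 1)) g⁻¹
  have e4 := FreeGroup.norm_mul_le g (w ^ (2 * g.norm + 1))
  rw [← hpow, e1, FreeGroup.norm_inv_eq] at e3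
  have e5 := e2 (2 * g.norm + 1)
  have e6 : (2 * g.norm + 1) * (w.norm + 1) ≤ (2 * g.norm + 1) * c.norm :=
    Nat.mul_le_mul_left _ (by omega)
  nlinarith

theorem append_flatten_replicate_comm {C D : List (Letter n)} (h : C ++ D = D ++ C) (k : ℕ) :
    (List.replicate k C).flatten ++ D = D ++ (List.replicate k C).flatten := by
  induction k with
  | zero => simp
  | succ k ih =>
    rw [List.replicate_succ, List.flatten_cons, List.append_assoc, ih, ← List.append_assoc, h,
      List.append_assoc]

theorem take_flatten_replicate_of_ge {C : List (Letter n)} (hC : C ≠ []) {j k m : ℕ} (hk : j ≤ k)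
    (hm : j ≤ m) : ((List.replicate k C).flatten).take j = ((List.replicate m C).flatten).take j := by
  have h1 := take_flatten_replicate [] C hC hk [] []
  have h2 := take_flatten_replicate [] C hC hm [] []
  simp only [List.nil_append, List.append_nil] at h1 h2
  rw [← h1, h2]

/-- Two periodic words that agree for long enough commute. -/
theorem append_comm_of_take {C D : List (Letter n)} (hC : C ≠ []) (hD : D ≠ []) {k : ℕ}
    (hk : C.length + D.length ≤ k)
    (h : ((List.replicate k C).flatten).take (C.length + D.length) =
      ((List.replicate k D).flatten).take (C.length + D.length)) : C ++ D = D ++ C := by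
  -- A weak form of the theorem of Fine and Wilf. After its first `C`, the word `C C C ⋯` starts
  -- again, and by the agreement its first `|D|` letters spell `D`. Thus the common prefix is `C D`,
  -- and by symmetry it is `D C`.
  have key : ∀ {C D : List (Letter n)}, C ≠ [] → D ≠ [] → C.length + D.length ≤ k →
      ((List.replicate k C).flatten).take (C.length + D.length) =
      ((List.replicate k D).flatten).take (C.length + D.length) →
      ((List.replicate k C).flatten).take (C.length + D.length) = C ++ D := by
    intro C D hC hD hk h
    have c1 : 1 ≤ C.length := List.length_pos_iff.2 hC
    have d1 : 1 ≤ D.length := List.length_pos_iff.2 hD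
    obtain ⟨m, rfl⟩ : ∃ m, k = m + 1 := ⟨k - 1, by omega⟩
    have h2 := congrArg (List.take D.length) h
    rw [List.take_take, List.take_take, min_eq_left (by omega),
      take_flatten_replicate_of_ge hC (by omega) (show D.length ≤ m by omega),
      List.replicate_succ, List.flatten_cons, List.take_left] at h2
    rw [List.replicate_succ, List.flatten_cons, List.take_length_add_append, h2]
  rw [← key hC hD hk h, h, add_comm C.length, key hD hC (by omega) (by rw [add_comm, h])]

/-- Two lines through the identity that run together for long enough coincide. -/
theorem IsLine.eq_of_ray_eq {ℓ : ℕ} (hW : ∀ w ∈ W, w.norm ≤ ℓ) {ξ η ξ' η' : Boundary n}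
    (h : IsLine W ξ η) (h' : IsLine W ξ' η') (h1 : ξ.1 1 ≠ η.1 1) (h1' : ξ'.1 1 ≠ η'.1 1)
    {L : ℕ} (hL : 2 * ℓ ≤ L) (hr : ray ξ L = ray ξ' L) : ξ = ξ' ∧ η = η' := by
  obtain ⟨c, hc, hcℓ, hcp, hξ, hη⟩ := h.exists_cyclic hW h1
  obtain ⟨d, hd, hdℓ, hdp, hξ', hη'⟩ := h'.exists_cyclic hW h1'
  have hC : c.toWord ≠ [] := by simpa using hc
  have hD : d.toWord ≠ [] := by simpa using hd
  rw [FreeGroup.norm] at hcℓ hdℓ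
  have e1 := ConvergesTo.toWord_ray hc (g := 1) (by simpa using hξ) (j := L) (m := L) (by simp)
  have e2 := ConvergesTo.toWord_ray hd (g := 1) (by simpa using hξ') (j := L) (m := L) (by simp)
  rw [hr, e2, one_mul, one_mul, hcp, hdp] at e1
  have e3 := congrArg (List.take (c.toWord.length + d.toWord.length)) e1
  rw [List.take_take, List.take_take, min_eq_left (by omega)] at e3
  have comm := append_comm_of_take hC hD (by omega) e3.symm
  -- The words `C ^ |D|` and `D ^ |C|` commute and have the same length, so they are equal. Hence
  -- `c` and `d` have a common positive power, and so the same ends.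
  have e4 := append_flatten_replicate_comm (append_flatten_replicate_comm comm
    d.toWord.length).symm c.toWord.length
  have e5 := (List.append_inj e4 (by simp [mul_comm])).1
  rw [← hcp, ← hdp, FreeGroup.toWord_inj] at e5
  have c1 : 0 < c.toWord.length := List.length_pos_iff.2 hC
  have d1 : 0 < d.toWord.length := List.length_pos_iff.2 hD
  have t1 : Tendsto (fun k => d.toWord.length * k) atTop atTop :=
    tendsto_id.const_mul_atTop' d1
  have t2 : Tendsto (fun k => c.toWord.length * k) atTop atTop :=
    tendsto_id.const_mul_atTop' c1
  have a1 := hξ.comp t1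
  have a2 := hξ'.comp t2
  have b1 := hη.comp t1
  have b2 := hη'.comp t2
  simp only [pow_mul, inv_pow, e5] at a1 a2 b1 b2
  exact ⟨a1.unique a2, b1.unique b2⟩

/-- If both ends pointed the same way at `ray ξ k`, then `η` would point away from the identity
there, so this vertex would lie on both rays (`eq_ray_of_getLast?`). -/
theorem val_ne_of_ray_ne {ξ η : Boundary n} {j k : ℕ} (h : ray ξ j ≠ ray η j) (hk : j ≤ k) :
    ξ.1 (ray ξ k) ≠ η.1 (ray ξ k) := by
  intro heq
  apply h
  have h1 : (ray ξ k).toWord.getLast? ≠ some (sinv (η.1 (ray ξ k))) := by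
    rw [← heq]
    cases k with
    | zero => simp [rayFrom]
    | succ k =>
      rw [toWord_ray_succ, List.getLast?_concat]
      intro h2
      have := rayFrom_val_succ ξ 1 k
      rw [Option.some.inj h2, sinv_sinv] at this
      exact this rfl
  have h2 := eq_ray_of_getLast? η _ h1
  rw [norm_ray] at h2
  exact ray_eq_of_le hk h2

theorem ray_inv_smul (ξ : Boundary n) (j k : ℕ) :
    ray ((ray ξ j)⁻¹ • ξ) k = (ray ξ j)⁻¹ * ray ξ (j + k) := by
  rw [ray, ray, rayFrom_add, mul_rayFrom, inv_mul_cancel]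

/-- The vertex `ray ξ j = ray ξ' j` lies on both lines, because in each of them the rays to the two
ends have parted by then. Translating this vertex to the identity reduces to `IsLine.eq_of_ray_eq`.
-/
theorem IsLine.eq_of_ray_eq_add {ℓ : ℕ} (hW : ∀ w ∈ W, w.norm ≤ ℓ) {ξ η ξ' η' : Boundary n}
    (h : IsLine W ξ η) (h' : IsLine W ξ' η') {j L : ℕ} (h1 : ray ξ j ≠ ray η j)
    (h1' : ray ξ' j ≠ ray η' j) (hL : 2 * ℓ ≤ L) (hr : ray ξ (j + L) = ray ξ' (j + L)) :
    ξ = ξ' ∧ η = η' := by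
  have hj : ray ξ j = ray ξ' j := ray_eq_of_le (Nat.le_add_right j L) hr
  have := (h.smul (ray ξ j)⁻¹).eq_of_ray_eq hW (h'.smul (ray ξ j)⁻¹) (L := L) ?_ ?_ hL ?_
  · exact ⟨smul_left_cancel _ this.1, smul_left_cancel _ this.2⟩
  · simpa [Boundary.smul_val] using val_ne_of_ray_ne h1 le_rfl
  · rw [hj]
    simpa [Boundary.smul_val] using val_ne_of_ray_ne h1' le_rfl
  · rw [ray_inv_smul, hj, ray_inv_smul, ← hj, hr]

theorem exists_ray_ne {ξ η : Boundary n} (h : ξ ≠ η) : ∃ j, ∀ k, j ≤ k → ray ξ k ≠ ray η k := by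
  by_contra! hc
  refine h (ray_injective fun j => ?_)
  obtain ⟨k, hk, he⟩ := hc j
  exact ray_eq_of_le hk he

/-- Two lines with a common end coincide. -/
theorem IsLine.eq_right {ℓ : ℕ} (hW : ∀ w ∈ W, w.norm ≤ ℓ) {ξ η η' : Boundary n}
    (h : IsLine W ξ η) (h' : IsLine W ξ η') : η = η' := by
  obtain ⟨j, hj⟩ := exists_ray_ne h.ne
  obtain ⟨j', hj'⟩ := exists_ray_ne h'.ne
  exact (h.eq_of_ray_eq_add hW h' (j := max j j') (hj _ (le_max_left _ _))
    (hj' _ (le_max_right _ _)) le_rfl rfl).2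

/-- Lines with a common end coincide, so the equivalence relation generated by the lines has no
chains longer than one line. -/
theorem proj_eq_proj_iff {ℓ : ℕ} (hW : ∀ w ∈ W, w.norm ≤ ℓ) {ξ η : Boundary n} :
    proj W ξ = proj W η ↔ ξ = η ∨ IsLine W ξ η := by
  constructor
  · intro h
    have := Quot.eqvGen_exact h
    clear h
    induction this with
    | rel _ _ h => exact .inr (.inl h)
    | refl => exact .inl rfl
    | symm _ _ _ ih =>
      exact ih.imp Eq.symm IsLine.symm
    | trans x y z h1 h2 ih1 ih2 =>
      rcases ih1 with rfl | a1
      · exact ih2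
      rcases ih2 with rfl | a2
      · exact .inr a1
      · exact .inl (a1.symm.eq_right hW a2)
  · rintro (rfl | h | h)
    · rfl
    · exact Quot.sound h
    · exact (Quot.sound h).symm

theorem finite_ball (n r : ℕ) : (ball n r).Finite := by
  have : (FreeGroup.toWord '' (ball n r)).Finite :=
    (List.finite_length_le (Letter n) r).subset (by rintro _ ⟨g, hg, rfl⟩; exact hg)
  exact this.of_finite_image FreeGroup.toWord_injective.injOn

theorem ray_mem_ball (ξ : Boundary n) {k r : ℕ} (h : k ≤ r) : ray ξ k ∈ ball n r := by
  rw [ball, mem_ofPred_eq, norm_ray]; exact h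

/-- Finitely many lines pass through a ball. -/
theorem finite_lines {ℓ : ℕ} (hW : ∀ w ∈ W, w.norm ≤ ℓ) (j : ℕ) :
    {p : Boundary n × Boundary n | IsLine W p.1 p.2 ∧ ray p.1 j ≠ ray p.2 j}.Finite := by
  -- By `IsLine.eq_of_ray_eq_add`, such a line is determined by the vertex of its first ray at level
  -- `j + 2ℓ`.
  refine Set.Finite.of_finite_image (f := fun p => ray p.1 (j + 2 * ℓ))
    ((finite_ball n (j + 2 * ℓ)).subset ?_) ?_
  · rintro _ ⟨p, -, rfl⟩
    exact ray_mem_ball _ le_rfl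
  · rintro ⟨ξ, η⟩ ⟨h1, h2⟩ ⟨ξ', η'⟩ ⟨h1', h2'⟩ h
    obtain ⟨rfl, rfl⟩ := h1.eq_of_ray_eq_add hW h1' h2 h2' le_rfl h
    rfl

end

section
variable {n : ℕ} {W : Set (Gp n)}

/-! ### Exits from subtrees -/

theorem SameBranch.retract_eq {X : Set (Gp n)} (hX : IsFiniteSubtree X) {a b : Gp n}
    (h : SameBranch X a b) : retract X a = retract X b := by
  have ha : a ∉ X := h.choose_spec _ (SimpleGraph.Walk.start_mem_support _)
  obtain ⟨v⟩ := hX.2.nonempty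
  obtain ⟨h1, h2⟩ := retract_spec ⟨v.1, v.2⟩ ha
  exact (LinePattern.retract_eq hX h1 (h2.trans h)).symm

theorem sameBranch_rayFrom {X : Set (Gp n)} {ξ : Boundary n} {v : Gp n} {j k : ℕ} (hjk : j ≤ k)
    (h : ∀ i, j ≤ i → rayFrom ξ v i ∉ X) : SameBranch X (rayFrom ξ v j) (rayFrom ξ v k) := by
  induction k, hjk using Nat.le_induction with
  | base => exact .refl (h j le_rfl)
  | succ k hk ih =>
    have hadj : (tree n).Adj (rayFrom ξ v k) (rayFrom ξ v (k + 1)) := tree_adj.2 ⟨_, rfl⟩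
    refine ih.trans ⟨.cons hadj .nil, ?_⟩
    simp [h k hk, h (k + 1) (by omega)]

theorem sameBranch_ray {X : Set (Gp n)} {r : ℕ} (hr : X ⊆ ball n r) (ξ : Boundary n) {j k : ℕ}
    (hj : r + 1 ≤ j) (hjk : j ≤ k) : SameBranch X (ray ξ j) (ray ξ k) :=
  sameBranch_rayFrom hjk fun i hi h => by
    have := hr h
    rw [ball, mem_ofPred_eq, norm_ray] at this
    omega

/-- The largest distance of an element of `X` from the identity. -/
def radius (X : Set (Gp n)) : ℕ := sSup (FreeGroup.norm '' X)

theorem subset_ball_radius {X : Set (Gp n)} (hX : X.Finite) : X ⊆ ball n (radius X) := fun _ hx =>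
  le_csSup (hX.image FreeGroup.norm).bddAbove (mem_image_of_mem _ hx)

/-- The vertex of the Whitehead graph at `X` through which the geodesics from `X` to the end `ξ`
leave `X`. -/
def exitVertex (X : Set (Gp n)) (ξ : Boundary n) : Gp n := retract X (ray ξ (radius X + 1))

theorem exitVertex_eq {X : Set (Gp n)} (hX : IsFiniteSubtree X) {r : ℕ} (hr : X ⊆ ball n r)
    (ξ : Boundary n) {k : ℕ} (hk : r + 1 ≤ k) : exitVertex X ξ = retract X (ray ξ k) := by
  have h1 := sameBranch_ray (subset_ball_radius hX.1) ξ le_rfl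
    (Nat.le_add_right (radius X + 1) k)
  have h2 := sameBranch_ray hr ξ hk (Nat.le_add_left k (radius X + 1))
  exact (h1.trans h2.symm).retract_eq hX

theorem ray_notMem {X : Set (Gp n)} {r k : ℕ} (hr : X ⊆ ball n r) (hk : r < k) (ξ : Boundary n) :
    ray ξ k ∉ X := by
  intro h
  have := hr h
  rw [ball, mem_ofPred_eq, norm_ray] at this
  omega

theorem IsFiniteSubtree.nonempty {X : Set (Gp n)} (hX : IsFiniteSubtree X) : X.Nonempty := by
  obtain ⟨v⟩ := hX.2.nonempty
  exact ⟨v.1, v.2⟩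

theorem exitVertex_spec {X : Set (Gp n)} (hX : IsFiniteSubtree X) (ξ : Boundary n) {r k : ℕ}
    (hr : X ⊆ ball n r) (hk : r < k) :
    exitVertex X ξ ∈ whVertices X ∧ SameBranch X (exitVertex X ξ) (ray ξ k) := by
  rw [exitVertex_eq hX hr ξ hk]
  exact retract_spec hX.nonempty (ray_notMem hr hk ξ)

theorem exitVertex_mem {X : Set (Gp n)} (hX : IsFiniteSubtree X) (ξ : Boundary n) :
    exitVertex X ξ ∈ whVertices X :=
  (exitVertex_spec hX ξ (subset_ball_radius hX.1) (Nat.lt_succ_self _)).1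

theorem exitVertex_eq_of_sameBranch {X : Set (Gp n)} (hX : IsFiniteSubtree X) {ξ : Boundary n}
    {a : Gp n} (ha : a ∈ whVertices X) (h : ∀ r, ∃ k, r < k ∧ SameBranch X a (ray ξ k)) :
    exitVertex X ξ = a := by
  obtain ⟨k, hk, hb⟩ := h (radius X)
  rw [exitVertex_eq hX (subset_ball_radius hX.1) ξ hk]
  exact retract_eq hX ha hb

/-- The vertex of `X` next to the exit vertex sees it in the same direction as the late vertices of
the ray, since they are joined outside of `X`. -/
theorem mem_shadow_exitVertex {X : Set (Gp n)} (hX : IsFiniteSubtree X) (ξ : Boundary n) :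
    ξ ∈ shadow X (exitVertex X ξ) := by
  obtain ⟨-, x, hx, hxa⟩ := exitVertex_mem hX ξ
  obtain ⟨k, hk, hk'⟩ := ((convergesTo_ray ξ x).and (eventually_gt_atTop (radius X))).exists
  obtain ⟨p, hp⟩ := (exitVertex_spec hX ξ (subset_ball_radius hX.1) hk').2
  have h1 := head_walk x p fun h => hp x h hx
  obtain ⟨s, hs⟩ := tree_adj.1 hxa
  rw [hk] at h1
  refine ⟨x, hx, ?_⟩
  rw [hs, inv_mul_cancel_left, head_letter] at h1
  rw [hs, Option.some.inj h1]

theorem retract_exitVertex {X Y : Set (Gp n)} (hX : IsFiniteSubtree X) (hY : IsFiniteSubtree Y)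
    (hXY : X ⊆ Y) (ξ : Boundary n) : retract X (exitVertex Y ξ) = exitVertex X ξ := by
  have hr := subset_ball_radius hY.1
  rw [exitVertex_eq hX (hXY.trans hr) ξ le_rfl]
  exact ((exitVertex_spec hY ξ hr (Nat.lt_succ_self _)).2.mono hXY).retract_eq hX

/-- The definition uses the ray from the identity, which `g` moves to a ray from `g`. This one
merges with the ray from the identity to `g • ξ`, and the exit vertex depends only on late vertices.
-/
theorem exitVertex_translate {X : Set (Gp n)} (hX : IsFiniteSubtree X) (g : Gp n)
    (ξ : Boundary n) : g * exitVertex (translateSet X g) ξ = exitVertex X (g • ξ) := by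
  symm
  have hX' := hX.translate g
  refine exitVertex_eq_of_sameBranch hX (mem_whVertices_translate.1 (exitVertex_mem hX' ξ)) ?_
  intro r
  obtain ⟨a, b, hab⟩ := rayFrom_merge (g • ξ) g
  set m := radius (translateSet X g) + r + 1 with hm
  refine ⟨b + m, by omega, ?_⟩
  have h1 := (exitVertex_spec hX' ξ (subset_ball_radius hX'.1)
    (show radius (translateSet X g) < a + m by omega)).2.translate
  rwa [mul_rayFrom, mul_one, rayFrom_add, hab, ← rayFrom_add] at h1

/-! ### Balls -/

theorem isFiniteSubtree_ball (n r : ℕ) : IsFiniteSubtree (ball n r) := by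
  refine ⟨finite_ball n r, ?_⟩
  have h1 : (1 : Gp n) ∈ ball n r := by simp [ball]
  have key : ∀ (L : List (Letter n)) (hL : FreeGroup.IsReduced L) (hr : L.length ≤ r)
      (hm : (FreeGroup.mk L : Gp n) ∈ ball n r),
      ((tree n).induce (ball n r)).Reachable ⟨1, h1⟩ ⟨FreeGroup.mk L, hm⟩ := by
    intro L
    induction L using List.reverseRecOn with
    | nil => intro _ _ _; exact .refl _
    | append_singleton L s ih =>
      intro hL hr hm
      rw [List.length_append] at hr
      have hm' : (FreeGroup.mk L : Gp n) ∈ ball n r := le_trans FreeGroup.norm_mk_le (by omega)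
      refine (ih (hL.infix ⟨[], [s], by simp⟩) (by omega) hm').trans (SimpleGraph.Adj.reachable ?_)
      show (tree n).Adj (FreeGroup.mk L) (FreeGroup.mk (L ++ [s]))
      exact tree_adj.2 ⟨s, by rw [letter, FreeGroup.mul_mk]⟩
  rw [SimpleGraph.connected_iff_exists_forall_reachable]
  refine ⟨⟨1, h1⟩, ?_⟩
  rintro ⟨g, hg⟩
  have := key g.toWord FreeGroup.isReduced_toWord hg (by rwa [FreeGroup.mk_toWord])
  simpa only [FreeGroup.mk_toWord] using this

theorem norm_mul_letter (x : Gp n) (s : Letter n) : (x * letter s).norm =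
    if x.toWord.getLast? = some (sinv s) then x.norm - 1 else x.norm + 1 := by
  rw [FreeGroup.norm, toWord_mul_letter]
  split_ifs <;> simp [FreeGroup.norm]

theorem mem_whVertices_ball {r : ℕ} {a : Gp n} : a ∈ whVertices (ball n r) ↔ a.norm = r + 1 := by
  constructor
  · rintro ⟨h, x, hx, hxa⟩
    obtain ⟨s, rfl⟩ := tree_adj.1 hxa
    simp only [ball, mem_ofPred_eq] at h hx
    rw [norm_mul_letter] at h ⊢
    split_ifs at h ⊢ <;> omega
  · intro h
    refine ⟨by simp [ball, h], ?_⟩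
    rcases List.eq_nil_or_concat' a.toWord with h0 | ⟨L, t, hL⟩
    · rw [FreeGroup.norm, h0] at h; simp at h
    refine ⟨FreeGroup.mk L, ?_, tree_adj.2 ⟨t, ?_⟩⟩
    · rw [FreeGroup.norm, hL, List.length_append] at h
      simp only [ball, mem_ofPred_eq]
      exact FreeGroup.norm_mk_le.trans (by simp at h; omega)
    · rw [letter, FreeGroup.mul_mk, ← hL, FreeGroup.mk_toWord]

theorem exitVertex_ball (r : ℕ) (ξ : Boundary n) : exitVertex (ball n r) ξ = ray ξ (r + 1) := by
  rw [exitVertex_eq (isFiniteSubtree_ball n r) subset_rfl ξ le_rfl]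
  have h1 : ray ξ (r + 1) ∈ whVertices (ball n r) := mem_whVertices_ball.2 (norm_ray ξ _)
  exact retract_eq (isFiniteSubtree_ball n r) h1 (.refl h1.1)

theorem mem_shadow_ball {r : ℕ} {a : Gp n} (ha : a.norm = r + 1) {ξ : Boundary n} :
    ξ ∈ shadow (ball n r) a ↔ ray ξ (r + 1) = a := by
  constructor
  · rintro ⟨x, hx, rfl⟩
    simp only [ball, mem_ofPred_eq] at hx
    rw [norm_mul_letter] at ha
    split_ifs at ha with h
    · omega
    · have h2 := eq_ray_of_getLast? ξ x h
      have h3 : x.norm = r := by omega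
      rw [h3] at h2
      rw [ray, rayFrom, ← ray, ← h2]
  · rintro rfl
    rw [← exitVertex_ball]
    exact mem_shadow_exitVertex (isFiniteSubtree_ball n r) ξ

theorem whitehead_ball_adj {r : ℕ} {a b : Gp n} : (whitehead W (ball n r)).Adj a b ↔
    a ≠ b ∧ ∃ ξ η, IsLine W ξ η ∧ ray ξ (r + 1) = a ∧ ray η (r + 1) = b := by
  constructor
  · rintro ⟨h, ha, hb, ξ, η, hl, hξ, hη⟩
    exact ⟨h, ξ, η, hl, (mem_shadow_ball (mem_whVertices_ball.1 ha)).1 hξ,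
      (mem_shadow_ball (mem_whVertices_ball.1 hb)).1 hη⟩
  · rintro ⟨h, ξ, η, hl, rfl, rfl⟩
    exact ⟨h, mem_whVertices_ball.2 (norm_ray _ _), mem_whVertices_ball.2 (norm_ray _ _), ξ, η, hl,
      (mem_shadow_ball (norm_ray _ _)).2 rfl, (mem_shadow_ball (norm_ray _ _)).2 rfl⟩

/-! ### Existence of covers -/

/-- The vertices at distance `m` from the identity whose shadow contains an end that is identified
in the decomposition space with an end in the shadow of `a`, where `a` is at distance `r + 1`. -/
def touching (W : Set (Gp n)) (r m : ℕ) (a : Gp n) : Set (Gp n) :=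
  {b | ∃ ξ η, (ξ = η ∨ IsLine W ξ η) ∧ ray ξ m = b ∧ ray η (r + 1) = a}

/-- The points of the decomposition space none of whose preimages lies in a shadow, at distance
`m` from the identity, that is disjoint from the shadow of `a` in the decomposition space. -/
def starSet (W : Set (Gp n)) (r m : ℕ) (a : Gp n) : Set (DecompositionSpace W) :=
  {d | ∀ ξ, proj W ξ = d → ray ξ m ∈ touching W r m a}

/-- The preimage in the boundary is an open set minus the ends of the lines that have one end inside
and the other outside. Such lines are separated at level `m`, so there are finitely many of them,
and a finite set of ends is closed. -/
theorem isOpen_starSet {ℓ : ℕ} (hW : ∀ w ∈ W, w.norm ≤ ℓ) (r m : ℕ) (a : Gp n) :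
    IsOpen (starSet W r m a) := by
  have hq : IsQuotientMap (proj W) := isQuotientMap_quot_mk
  rw [← hq.isOpen_preimage]
  have h1 : proj W ⁻¹' starSet W r m a = {η | ray η m ∈ touching W r m a} \
      {η | ray η m ∈ touching W r m a ∧ ∃ ξ, IsLine W ξ η ∧ ray ξ m ∉ touching W r m a} := by
    ext η
    simp only [starSet, mem_preimage, mem_ofPred_eq, Set.mem_sdiff, not_and, not_exists, not_not]
    constructor
    · intro h
      exact ⟨h η rfl, fun _ ξ hξ => h ξ ((proj_eq_proj_iff hW).2 (.inr hξ))⟩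
    · rintro ⟨h, h'⟩ ξ hξ
      rcases (proj_eq_proj_iff hW).1 hξ with rfl | hl
      · exact h
      · exact h' h ξ hl
  rw [h1]
  refine (isOpen_ray_mem m _).sdiff (Set.Finite.isClosed ?_)
  refine ((finite_lines hW m).image Prod.snd).subset ?_
  rintro η ⟨h, ξ, hl, hξ⟩
  exact ⟨(ξ, η), ⟨hl, fun he => hξ (by rw [he]; exact h)⟩, rfl⟩

/-- The two stars that contain a point of the decomposition space are determined by its preimage
unless the ends of a line lie in both. -/
theorem eq_of_touching {ℓ : ℕ} (hW : ∀ w ∈ W, w.norm ≤ ℓ) {r : ℕ} {a b c : Gp n}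
    (ha : c ∈ touching W r (r + 1 + 2 * ℓ) a) (hb : c ∈ touching W r (r + 1 + 2 * ℓ) b)
    (hca : ∀ ξ : Boundary n, ray ξ (r + 1 + 2 * ℓ) = c → ray ξ (r + 1) ≠ a)
    (hcb : ∀ ξ : Boundary n, ray ξ (r + 1 + 2 * ℓ) = c → ray ξ (r + 1) ≠ b) : a = b := by
  obtain ⟨ξ, η, h, h1, h2⟩ := ha
  obtain ⟨ξ', η', h', h1', h2'⟩ := hb
  rcases h with rfl | h
  · exact absurd h2 (hca _ h1)
  rcases h' with rfl | h'
  · exact absurd h2' (hcb _ h1')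
  -- Both lines have their ends separated at level `r + 1` and run together up to `c`, which is `2ℓ`
  -- levels further, so they coincide.
  have := (h.eq_of_ray_eq_add hW h' (h2 ▸ hca _ h1) (h2' ▸ hcb _ h1') le_rfl (h1.trans h1'.symm)).2
  rw [← h2, ← h2', this]

theorem ray_add_eq {ξ η : Boundary n} {r m : ℕ} (h : ray ξ (r + m) = ray η (r + m)) :
    ray ξ r = ray η r := ray_eq_of_le (Nat.le_add_right r m) h

theorem adj_of_touching {r m : ℕ} {a b : Gp n} (hab : a ≠ b) {ξ : Boundary n}
    (hξ : ray ξ (r + 1) = a) (hb : ray ξ (r + 1 + m) ∈ touching W r (r + 1 + m) b) :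
    (whitehead W (ball n r)).Adj a b := by
  obtain ⟨ξ', η, h, h1, h2⟩ := hb
  have h3 := ray_add_eq h1
  rcases h with rfl | h
  · exact absurd (hξ.symm.trans (h3.symm.trans h2)) hab
  · exact whitehead_ball_adj.2 ⟨hab, ξ', η, h, h3.trans hξ, h2⟩

/-- Covers associated to balls exist. -/
theorem exists_cover_ball {ℓ : ℕ} (hW : ∀ w ∈ W, w.norm ≤ ℓ) (r : ℕ) :
    ∃ i : AssociatedCover W, i.X = ball n r := by
  have hself : ∀ (ξ : Boundary n), proj W ξ ∈ starSet W r (r + 1 + 2 * ℓ) (ray ξ (r + 1)) := by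
    intro ξ η hη
    exact ⟨η, ξ, (proj_eq_proj_iff hW).1 hη, rfl, rfl⟩
  -- The stars are taken at level `r + 1 + 2ℓ` for this reason: an end whose image lies in the stars
  -- of two vertices lies in the shadow of one of them. This excludes triple intersections and
  -- unwanted double ones.
  have hadj : ∀ (ξ : Boundary n) (a b : Gp n), a ≠ b →
      proj W ξ ∈ starSet W r (r + 1 + 2 * ℓ) a → proj W ξ ∈ starSet W r (r + 1 + 2 * ℓ) b →
      ray ξ (r + 1) = a ∨ ray ξ (r + 1) = b := by
    intro ξ a b hab ha hb
    by_contra! hne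
    refine hab (eq_of_touching hW (ha ξ rfl) (hb ξ rfl) ?_ ?_)
    · intro η hη; rw [ray_add_eq hη]; exact hne.1
    · intro η hη; rw [ray_add_eq hη]; exact hne.2
  refine ⟨⟨ball n r, starSet W r (r + 1 + 2 * ℓ), isFiniteSubtree_ball n r,
    isOpen_starSet hW _ _, ?_, ?_, ?_, ?_, ?_⟩, rfl⟩
  · rw [eq_univ_iff_forall]
    rintro ⟨ξ⟩
    exact mem_iUnion₂.2 ⟨ray ξ (r + 1), mem_whVertices_ball.2 (norm_ray _ _), hself ξ⟩
  · intro a ha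
    rw [eq_empty_iff_forall_notMem]
    rintro ⟨ξ⟩ hξ
    obtain ⟨-, η, -, -, rfl⟩ := hξ ξ rfl
    exact ha (mem_whVertices_ball.2 (norm_ray _ _))
  · rintro a ha _ ⟨ξ, hξ, rfl⟩
    rw [mem_shadow_ball (mem_whVertices_ball.1 ha)] at hξ
    rw [← hξ]
    exact hself ξ
  · intro a ha b hb hab
    constructor
    · rintro ⟨⟨ξ⟩, h1, h2⟩
      rcases hadj ξ a b hab h1 h2 with h | h
      · exact adj_of_touching hab h (h2 ξ rfl)
      · exact (adj_of_touching hab.symm h (h1 ξ rfl)).symm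
    · intro h
      obtain ⟨-, ξ, η, hl, rfl, rfl⟩ := whitehead_ball_adj.1 h
      refine ⟨proj W ξ, hself ξ, ?_⟩
      rw [(proj_eq_proj_iff hW).2 (.inr hl)]
      exact hself η
  · intro a b c hab hbc hac
    rw [eq_empty_iff_forall_notMem]
    rintro ⟨ξ⟩ ⟨⟨h1, h2⟩, h3⟩
    rcases hadj ξ a b hab h1 h2 with h | h
    · rcases hadj ξ b c hbc h2 h3 with h' | h'
      · exact hab (h.symm.trans h')
      · exact hac (h.symm.trans h')
    · rcases hadj ξ a c hac h1 h3 with h' | h'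
      · exact hab (h'.symm.trans h)
      · exact hbc (h.symm.trans h')

/-! ### Refinement and directedness of the covers. -/

namespace AssociatedCover

theorem proj_mem (i : AssociatedCover W) (ξ : Boundary n) :
    proj W ξ ∈ i.U (exitVertex i.X ξ) :=
  i.shadow_subset _ (exitVertex_mem i.subtree ξ) ⟨ξ, mem_shadow_exitVertex i.subtree ξ, rfl⟩

theorem inter_nonempty_of_line (i : AssociatedCover W) {ξ η : Boundary n} (h : IsLine W ξ η) :
    (i.U (exitVertex i.X ξ) ∩ i.U (exitVertex i.X η)).Nonempty := by
  have : proj W ξ = proj W η := by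
    rcases h with h | h
    · exact Quot.sound h
    · exact (Quot.sound h).symm
  exact ⟨proj W ξ, i.proj_mem ξ, this ▸ i.proj_mem η⟩

/-- A cover of a ball can be refined so that it refines a given cover of a subtree of this ball. -/
theorem exists_common_refinement (i j : AssociatedCover W) {r : ℕ} (hj : j.X = ball n r)
    (hij : i.X ⊆ j.X) : ∃ k : AssociatedCover W, i ≤ k ∧ j ≤ k ∧ k.X = ball n r := by
  have hmem : ∀ ξ : Boundary n, proj W ξ ∈ j.U (ray ξ (r + 1)) ∩ i.U (retract i.X (ray ξ (r + 1))) := by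
    intro ξ
    have h1 := j.proj_mem ξ
    have h2 := i.proj_mem ξ
    rw [← retract_exitVertex i.subtree j.subtree hij] at h2
    rw [hj, exitVertex_ball] at h1 h2
    exact ⟨h1, h2⟩
  -- Shrinking the sets of `j` in this way forces refinement of `i`. It keeps shadows and edges,
  -- because the image of each end lies in both of the sets that are intersected (`hmem`).
  refine ⟨⟨ball n r, fun b => j.U b ∩ i.U (retract i.X b), isFiniteSubtree_ball n r,
    fun a => (j.isOpen a).inter (i.isOpen _), ?_, ?_, ?_, ?_, ?_⟩, ?_, ?_, rfl⟩
  · rw [eq_univ_iff_forall]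
    rintro ⟨ξ⟩
    exact mem_iUnion₂.2 ⟨ray ξ (r + 1), mem_whVertices_ball.2 (norm_ray _ _), hmem ξ⟩
  · intro a ha
    rw [j.eq_empty a (by rwa [hj]), empty_inter]
  · rintro a ha _ ⟨ξ, hξ, rfl⟩
    rw [mem_shadow_ball (mem_whVertices_ball.1 ha)] at hξ
    rw [← hξ]
    exact hmem ξ
  · intro a ha b hb hab
    rw [← hj, ← j.inter_nonempty_iff a (by rwa [hj]) b (by rwa [hj]) hab]
    constructor
    · rintro ⟨d, h1, h2⟩
      exact ⟨d, h1.1, h2.1⟩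
    · intro h
      rw [j.inter_nonempty_iff a (by rwa [hj]) b (by rwa [hj]) hab, hj] at h
      obtain ⟨-, ξ, η, hl, rfl, rfl⟩ := whitehead_ball_adj.1 h
      refine ⟨proj W ξ, hmem ξ, ?_⟩
      have : proj W ξ = proj W η := by
        rcases hl with h | h
        · exact Quot.sound h
        · exact (Quot.sound h).symm
      rw [this]
      exact hmem η
  · intro a b c hab hbc hac
    rw [eq_empty_iff_forall_notMem]
    rintro d ⟨⟨h1, h2⟩, h3⟩
    have : d ∈ j.U a ∩ j.U b ∩ j.U c := ⟨⟨h1.1, h2.1⟩, h3.1⟩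
    rw [j.no_triple a b c hab hbc hac] at this
    exact this
  · exact ⟨hij.trans hj.subset, fun b _ => inter_subset_right⟩
  · refine ⟨hj.subset, fun b hb => ?_⟩
    rw [retract_eq j.subtree (by rwa [hj]) (.refl (by rw [hj]; exact hb.1))]
    exact inter_subset_left

theorem exists_ge_ball {ℓ : ℕ} (hW : ∀ w ∈ W, w.norm ≤ ℓ) (i : AssociatedCover W) {r : ℕ}
    (hi : i.X ⊆ ball n r) : ∃ j, i ≤ j ∧ j.X = ball n r := by
  obtain ⟨j, hj⟩ := exists_cover_ball hW r
  obtain ⟨k, h1, -, h2⟩ := i.exists_common_refinement j hj (hj ▸ hi)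
  exact ⟨k, h1, h2⟩

theorem directed {ℓ : ℕ} (hW : ∀ w ∈ W, w.norm ≤ ℓ) :
    IsDirectedOrder (AssociatedCover W) where
  directed i j := by
    have hm : ∀ {a b : ℕ}, a ≤ b → ball n a ⊆ ball n b := fun h _ hx => le_trans hx h
    obtain ⟨k, hk, hkX⟩ := i.exists_ge_ball hW (r := max (radius i.X) (radius j.X))
      ((subset_ball_radius i.subtree.1).trans (hm (le_max_left _ _)))
    obtain ⟨k', h1, h2, -⟩ := j.exists_common_refinement k hkX
      (by rw [hkX]; exact (subset_ball_radius j.subtree.1).trans (hm (le_max_right _ _)))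
    exact ⟨k', _root_.le_trans hk h2, h1⟩

end AssociatedCover

end

section
variable {n : ℕ} {W : Set (Gp n)}

/-! ### Elements of the module as functions on lines -/

/-- The oriented lines of the line pattern, as pairs of ends. -/
def Lines (W : Set (Gp n)) : Type := {p : Boundary n × Boundary n // IsLine W p.1 p.2}

namespace Lines

/-- The line with the opposite orientation. -/
def swap (p : Lines W) : Lines W := ⟨p.1.swap, p.2.symm⟩

theorem swap_swap (p : Lines W) : p.swap.swap = p := rfl

theorem swap_ne (p : Lines W) : p.swap ≠ p := fun h =>
  p.2.ne (congrArg (fun q : Lines W => q.1.2) h)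

instance : MulAction (Gp n) (Lines W) where
  smul g p := ⟨(g • p.1.1, g • p.1.2), p.2.smul g⟩
  one_smul _ := Subtype.ext (Prod.ext (one_smul _ _) (one_smul _ _))
  mul_smul _ _ _ := Subtype.ext (Prod.ext (mul_smul _ _ _) (mul_smul _ _ _))

theorem smul_fst (g : Gp n) (p : Lines W) : (g • p).1.1 = g • p.1.1 := rfl

theorem smul_snd (g : Gp n) (p : Lines W) : (g • p).1.2 = g • p.1.2 := rfl

theorem swap_smul (g : Gp n) (p : Lines W) : (g • p).swap = g • p.swap := rfl

end Lines

/-- The value of a cochain on a line. -/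
def lineValue (i : AssociatedCover W) : Cochains i →ₗ[ℤ] (Lines W → ℤ) where
  toFun c p := c.1 (exitVertex i.X p.1.1) (exitVertex i.X p.1.2)
  map_add' _ _ := rfl
  map_smul' _ _ := rfl

/-- The sets at the two exit vertices of a line meet, so the case in which `refine` takes the value
`0` does not occur; and the refinement map sends exit vertices to exit vertices. -/
theorem lineValue_refine {i j : AssociatedCover W} (h : i ≤ j) (c : Cochains i) :
    lineValue j (refine i j h c) = lineValue i c := by
  classical
  funext p
  show (if (j.U (exitVertex j.X p.1.1) ∩ j.U (exitVertex j.X p.1.2)).Nonempty then _ else _) = _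
  rw [if_pos (j.inter_nonempty_of_line p.2), retract_exitVertex i.subtree j.subtree h.1,
    retract_exitVertex i.subtree j.subtree h.1]
  rfl

open Classical in
/-- The value of an element of the direct limit on the lines. -/
def limitValue (W : Set (Gp n)) : CochainLimit W →ₗ[ℤ] (Lines W → ℤ) :=
  Module.DirectLimit.lift ℤ (AssociatedCover W) (fun i => Cochains i) refine lineValue
    fun _ _ h c => lineValue_refine h c

theorem limitValue_toLimit (i : AssociatedCover W) (c : Cochains i) :
    limitValue W (toLimit i c) = lineValue i c := by
  classical
  exact Module.DirectLimit.lift_of _ _ _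

theorem toLimit_refine {i j : AssociatedCover W} (h : i ≤ j) (c : Cochains i) :
    toLimit j (refine i j h c) = toLimit i c := by
  classical
  exact Module.DirectLimit.of_f

/-- Each edge of the Whitehead graph is crossed by a line, and the coefficient of the edge is the
value on this line. -/
theorem lineValue_injective_of_ball {i : AssociatedCover W} {r : ℕ} (hi : i.X = ball n r)
    {c : Cochains i} (hc : lineValue i c = 0) : c = 0 := by
  ext a b
  show c.1 a b = 0
  by_cases hne : i.U a ∩ i.U b = ∅
  · exact c.2.2 a b hne
  rw [← ne_eq, ← nonempty_iff_ne_empty] at hne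
  by_cases hab : a = b
  · subst hab
    have := c.2.1 a a
    omega
  have ha : a ∈ whVertices i.X := by
    by_contra h
    rw [i.eq_empty a h, empty_inter] at hne
    exact not_nonempty_empty hne
  have hb : b ∈ whVertices i.X := by
    by_contra h
    rw [i.eq_empty b h, inter_empty] at hne
    exact not_nonempty_empty hne
  rw [i.inter_nonempty_iff a ha b hb hab, hi, whitehead_ball_adj] at hne
  obtain ⟨-, ξ, η, hl, rfl, rfl⟩ := hne
  have h1 := congrFun hc ⟨(ξ, η), hl⟩
  change c.1 (exitVertex i.X ξ) (exitVertex i.X η) = 0 at h1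
  rwa [hi, exitVertex_ball, exitVertex_ball] at h1

theorem exists_toLimit_ball {ℓ : ℕ} (hW : ∀ w ∈ W, w.norm ≤ ℓ) (x : CochainLimit W) :
    ∃ (i : AssociatedCover W) (r : ℕ) (c : Cochains i), i.X = ball n r ∧ toLimit i c = x := by
  classical
  have hd := AssociatedCover.directed hW
  have hne : Nonempty (AssociatedCover W) := (exists_cover_ball hW 0).nonempty
  obtain ⟨i, c, rfl⟩ := Module.DirectLimit.exists_of x
  obtain ⟨j, hij, hj⟩ := i.exists_ge_ball hW (subset_ball_radius i.subtree.1)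
  exact ⟨j, _, refine i j hij c, hj, toLimit_refine hij c⟩

theorem limitValue_injective {ℓ : ℕ} (hW : ∀ w ∈ W, w.norm ≤ ℓ) :
    Function.Injective (limitValue W) := by
  rw [injective_iff_map_eq_zero]
  intro x hx
  obtain ⟨i, r, c, hi, rfl⟩ := exists_toLimit_ball hW x
  rw [limitValue_toLimit] at hx
  rw [lineValue_injective_of_ball hi hx, map_zero]

theorem limitValue_translateLimit (g : Gp n) (x : CochainLimit W) (p : Lines W) :
    limitValue W (translateLimit W g x) p = limitValue W x (g • p) := by
  classical
  have key : (limitValue W).comp (translateLimit W g) =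
      (LinearMap.funLeft ℤ ℤ (fun p : Lines W => g • p)).comp (limitValue W) := by
    refine Module.DirectLimit.hom_ext fun i => LinearMap.ext fun c => ?_
    funext p
    show limitValue W (translateLimit W g (toLimit i c)) p = limitValue W (toLimit i c) (g • p)
    rw [translateLimit_toLimit, limitValue_toLimit, limitValue_toLimit]
    show c.1 (g * exitVertex (translateSet i.X g) p.1.1)
      (g * exitVertex (translateSet i.X g) p.1.2) = _
    rw [exitVertex_translate i.subtree, exitVertex_translate i.subtree]
    rfl
  exact congrFun (LinearMap.congr_fun key x) p

/-- The value of an element of the module on the lines. -/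
def value (W : Set (Gp n)) : CochainModule W →+ (Lines W → ℤ) :=
  (limitValue W).toAddMonoidHom.comp (rightAction W).asModuleEquiv.toAddMonoidHom

theorem value_injective {ℓ : ℕ} (hW : ∀ w ∈ W, w.norm ≤ ℓ) : Function.Injective (value W) :=
  (limitValue_injective hW).comp (rightAction W).asModuleEquiv.injective

theorem value_cochainClass (i : AssociatedCover W) (c : Cochains i) :
    value W (cochainClass i c) = lineValue i c := by
  rw [← limitValue_toLimit]; rfl

theorem value_single_smul (g : Gp n) (m : ℤ) (x : CochainModule W) (p : Lines W) :
    value W ((MonoidAlgebra.single (MulOpposite.op g) m : GroupRing n) • x) p =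
      m * value W x (g • p) := by
  show limitValue W ((rightAction W).asModuleEquiv (_ • x)) p = _
  rw [Representation.asModuleEquiv_map_smul, Representation.asAlgebraHom_single,
    LinearMap.smul_apply, map_smul, Pi.smul_apply, smul_eq_mul]
  congr 1
  exact limitValue_translateLimit g _ p

theorem value_swap (x : CochainModule W) (p : Lines W) : value W x p.swap = - value W x p := by
  classical
  obtain ⟨y, rfl⟩ := (rightAction W).asModuleEquiv.symm.surjective x
  show limitValue W ((rightAction W).asModuleEquiv ((rightAction W).asModuleEquiv.symm y)) p.swap =
    - limitValue W ((rightAction W).asModuleEquiv ((rightAction W).asModuleEquiv.symm y)) p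
  rw [LinearEquiv.apply_symm_apply]
  have key : (LinearMap.funLeft ℤ ℤ (Lines.swap (W := W))).comp (limitValue W) =
      - limitValue W := by
    refine Module.DirectLimit.hom_ext fun i => LinearMap.ext fun c => ?_
    funext p
    show limitValue W (toLimit i c) p.swap = - limitValue W (toLimit i c) p
    rw [limitValue_toLimit]
    exact c.2.1 _ _
  exact congrFun (LinearMap.congr_fun key y) p

/-- A cochain over a ball vanishes on the lines both of whose ends leave the ball through the same
vertex, by antisymmetry, and only finitely many lines remain. -/
theorem finite_support_value {ℓ : ℕ} (hW : ∀ w ∈ W, w.norm ≤ ℓ) (x : CochainModule W) :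
    (Function.support (value W x)).Finite := by
  obtain ⟨y, rfl⟩ := (rightAction W).asModuleEquiv.symm.surjective x
  obtain ⟨i, r, c, hi, rfl⟩ := exists_toLimit_ball hW y
  change (Function.support (value W (cochainClass i c))).Finite
  rw [value_cochainClass]
  refine Set.Finite.of_finite_image (f := Subtype.val) ((finite_lines hW (r + 1)).subset ?_)
    Subtype.val_injective.injOn
  rintro _ ⟨p, hp, rfl⟩
  refine ⟨p.2, fun h => hp ?_⟩
  show c.1 (exitVertex i.X p.1.1) (exitVertex i.X p.1.2) = 0
  rw [hi, exitVertex_ball, exitVertex_ball, h]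
  have := c.2.1 (ray p.1.2 (r + 1)) (ray p.1.2 (r + 1))
  omega

open Classical in
/-- The function on lines that counts the passages from `a` to `b`. -/
def edgeValue (r : ℕ) (a b : Gp n) (p : Lines W) : ℤ :=
  (if ray p.1.1 (r + 1) = a ∧ ray p.1.2 (r + 1) = b then 1 else 0) -
    (if ray p.1.1 (r + 1) = b ∧ ray p.1.2 (r + 1) = a then 1 else 0)

theorem value_edgeCochain {i : AssociatedCover W} {r : ℕ} (hi : i.X = ball n r) (a b : Gp n) :
    value W (cochainClass i (edgeCochain i a b)) = edgeValue r a b := by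
  classical
  rw [value_cochainClass]
  funext p
  show (if (i.U (exitVertex i.X p.1.1) ∩ i.U (exitVertex i.X p.1.2)).Nonempty then _ else _) = _
  rw [if_pos (i.inter_nonempty_of_line p.2), hi, exitVertex_ball, exitVertex_ball]
  rfl

open Classical in
/-- The antisymmetric function that takes the value `1` on the line `q`. -/
def delta (q p : Lines W) : ℤ := (if p = q then 1 else 0) - (if p = q.swap then 1 else 0)

theorem delta_self (q : Lines W) : delta q q = 1 := by
  rw [delta, if_pos rfl, if_neg q.swap_ne.symm, sub_zero]

theorem delta_eq_zero {q p : Lines W} (h : p ≠ q) (h' : p ≠ q.swap) : delta q p = 0 := by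
  rw [delta, if_neg h, if_neg h', sub_zero]

theorem delta_swap_left (q p : Lines W) : delta q.swap p = - delta q p := by
  rw [delta, delta, Lines.swap_swap]; ring

theorem delta_smul (g : Gp n) (q p : Lines W) : delta (g • q) (g • p) = delta q p := by
  classical
  have h : ∀ a b : Lines W, g • a = g • b ↔ a = b := fun a b => (MulAction.injective g).eq_iff
  rw [delta, delta, Lines.swap_smul]
  exact congrArg₂ _ (if_congr (h _ _) rfl rfl) (if_congr (h _ _) rfl rfl)

/-- A subgroup that contains the classes of all of the individual lines is everything. -/
theorem eq_top_of_delta {ℓ : ℕ} (hW : ∀ w ∈ W, w.norm ≤ ℓ) (S : AddSubgroup (CochainModule W))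
    (hS : ∀ q : Lines W, ∃ x ∈ S, value W x = delta q) : S = ⊤ := by
  rw [eq_top_iff]
  rintro x -
  obtain ⟨k, hk⟩ : ∃ k, (Function.support (value W x)).ncard = k := ⟨_, rfl⟩
  induction k using Nat.strong_induction_on generalizing x with
  | _ k ih =>
    by_cases h0 : value W x = 0
    · rw [value_injective hW (h0.trans (map_zero _).symm)]
      exact S.zero_mem
    obtain ⟨q, hq⟩ := Function.ne_iff.1 h0
    obtain ⟨y, hy, hyq⟩ := hS q
    have hv : ∀ p, value W (x - (value W x q) • y) p = value W x p - value W x q * delta q p := by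
      intro p
      rw [map_sub, map_zsmul, hyq]
      rfl
    -- Subtracting the multiple of `delta q` clears the value at `q` and enlarges the support
    -- nowhere, since `q` and `q.swap` were both in it.
    have hss : Function.support (value W (x - (value W x q) • y)) ⊂
        Function.support (value W x) := by
      refine (ssubset_iff_of_subset ?_).2 ⟨q, hq, ?_⟩
      · intro p hp hp0
        apply hp
        have hpq : p ≠ q := fun h => hq (h ▸ hp0)
        have hpq' : p ≠ q.swap := fun h => hq (by
          rw [h, value_swap] at hp0
          simpa using hp0)
        rw [hv, hp0, delta_eq_zero hpq hpq']; simp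
      · rw [Function.mem_support, not_not, hv, delta_self, mul_one, sub_self]
    have := ih _ (hk ▸ ncard_lt_ncard hss (finite_support_value hW x)) rfl
    have h2 := S.add_mem this (S.zsmul_mem hy (value W x q))
    rwa [sub_add_cancel] at h2

end

section
variable {n : ℕ} {W : Set (Gp n)}

/-! ### Generators and relators -/

namespace Lines

/-- The vertex `v` lies on the line `p`. -/
def Through (p : Lines W) (v : Gp n) : Prop := p.1.1.1 v ≠ p.1.2.1 v

theorem exists_through (p : Lines W) : ∃ v, p.Through v := by
  obtain ⟨j, hj⟩ := exists_ray_ne p.2.ne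
  exact ⟨_, val_ne_of_ray_ne (hj j le_rfl) le_rfl⟩

theorem through_smul {p : Lines W} {g v : Gp n} : (g • p).Through v ↔ p.Through (g⁻¹ * v) :=
  Iff.rfl

theorem Through.swap {p : Lines W} {v : Gp n} (h : p.Through v) : p.swap.Through v := Ne.symm h

theorem Through.rayFrom {p : Lines W} {v : Gp n} (h : p.Through v) (k : ℕ) :
    p.Through (rayFrom p.1.1 v k) := by
  induction k with
  | zero => exact h
  | succ k ih =>
    intro heq
    have h1 := (p.1.2.2 (LinePattern.rayFrom p.1.1 v k) (p.1.1.1 (LinePattern.rayFrom p.1.1 v k))).2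
      (fun h => ih h.symm)
    exact rayFrom_val_succ p.1.1 v k (heq.trans h1)

end Lines

theorem through_one_of_head_ne {ξ η : Boundary n} {r : ℕ}
    (h : (ray ξ (r + 1)).toWord.head? ≠ (ray η (r + 1)).toWord.head?) : ξ.1 1 ≠ η.1 1 := by
  rw [head_ray ξ (by omega), head_ray η (by omega)] at h
  exact fun h' => h (congrArg some h')

theorem edgeValue_swap (r : ℕ) (a b : Gp n) (p : Lines W) :
    edgeValue r b a p = - edgeValue r a b p := by
  rw [edgeValue, edgeValue]; ring

/-- A line between the two exit vertices of `q` also passes through the identity, because these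
vertices lie in different directions from it. It then shares `r + 1 ≥ 2ℓ` steps with `q`, so it is
`q`. -/
theorem edgeValue_eq_delta {ℓ : ℕ} (hW : ∀ w ∈ W, w.norm ≤ ℓ) {r : ℕ} (hr : 2 * ℓ ≤ r + 1)
    {q : Lines W} (hq : q.Through 1) :
    edgeValue r (ray q.1.1 (r + 1)) (ray q.1.2 (r + 1)) = delta q := by
  classical
  have hne : (ray q.1.1 (r + 1)).toWord.head? ≠ (ray q.1.2 (r + 1)).toWord.head? := by
    rw [head_ray _ (by omega), head_ray _ (by omega)]
    exact fun h => hq (Option.some.inj h)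
  have key : ∀ p : Lines W, (ray p.1.1 (r + 1) = ray q.1.1 (r + 1) ∧
      ray p.1.2 (r + 1) = ray q.1.2 (r + 1)) ↔ p = q := by
    intro p
    constructor
    · rintro ⟨h1, h2⟩
      have hp : p.1.1.1 1 ≠ p.1.2.1 1 := through_one_of_head_ne (r := r) (by rwa [h1, h2])
      have := p.2.eq_of_ray_eq hW q.2 hp hq hr h1
      exact Subtype.ext (Prod.ext this.1 this.2)
    · rintro rfl
      exact ⟨rfl, rfl⟩
  funext p
  rw [edgeValue, delta]
  refine congrArg₂ _ (if_congr (key p) rfl rfl) (if_congr ?_ rfl rfl)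
  rw [and_comm]
  exact (key p.swap).trans ⟨fun h => by rw [← h]; rfl, fun h => by rw [h]; rfl⟩

/-- The element of the module that is represented by a translate of an edge. -/
theorem value_translate_edge {ℓ : ℕ} (hW : ∀ w ∈ W, w.norm ≤ ℓ) {r : ℕ} (hr : 2 * ℓ ≤ r + 1)
    {i : AssociatedCover W} (hi : i.X = ball n r) (q : Lines W) :
    ∃ v : Gp n, ∃ c : Cochains i,
      value W ((MonoidAlgebra.single (MulOpposite.op v) 1 : GroupRing n) • cochainClass i c) =
        delta q := by
  obtain ⟨v, hv⟩ := q.exists_through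
  have hv1 : (v⁻¹ • q).Through 1 := by rw [Lines.through_smul, inv_inv, mul_one]; exact hv
  refine ⟨v⁻¹, edgeCochain i (ray (v⁻¹ • q).1.1 (r + 1)) (ray (v⁻¹ • q).1.2 (r + 1)), ?_⟩
  funext p
  rw [value_single_smul, value_edgeCochain hi, edgeValue_eq_delta hW hr hv1, one_mul, delta_smul]

theorem single_smul_cochainClass (g : Gp n) (i : AssociatedCover W) (c : Cochains i) :
    (MonoidAlgebra.single (MulOpposite.op g) 1 : GroupRing n) • cochainClass i c =
      cochainClass (i.translate g) (translateCochain g i c) := by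
  apply (rightAction W).asModuleEquiv.injective
  rw [Representation.asModuleEquiv_map_smul, Representation.asAlgebraHom_single, one_smul]
  exact translateLimit_toLimit g i c

/-- The module is generated by the elements supported on the translates of a large ball. -/
theorem closure_supportedOn {ℓ : ℕ} (hW : ∀ w ∈ W, w.norm ≤ ℓ) {r : ℕ} (hr : 2 * ℓ ≤ r + 1)
    {N : ℕ} (hN : (ball n r).ncard < N) :
    AddSubgroup.closure {m : CochainModule W |
      ∃ X : Set (Gp n), IsFiniteSubtree X ∧ X.ncard < N ∧ SupportedOn m X} = ⊤ := by
  obtain ⟨i, hi⟩ := exists_cover_ball hW r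
  refine eq_top_of_delta hW _ fun q => ?_
  obtain ⟨v, c, hc⟩ := value_translate_edge hW hr hi q
  rw [single_smul_cochainClass] at hc
  refine ⟨_, AddSubgroup.subset_closure ⟨_, (i.translate v).subtree, ?_, i.translate v, _, rfl, rfl⟩,
    hc⟩
  have h1 : (i.translate v).X = (fun x => v * x) ⁻¹' ball n r := by rw [← hi]; rfl
  rw [h1, ncard_preimage_of_injective_subset_range (mul_right_injective v)
    (fun x _ => ⟨v⁻¹ * x, by simp⟩)]
  exact hN

/-! ### The free module and the kernel of the presentation. -/

section Presentation

variable {k : ℕ}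

/-- The element `m (e_j g)` of the free right module. -/
def gen (j : Fin k) (g : Gp n) (m : ℤ) : Fin k →₀ GroupRing n :=
  Finsupp.single j (MonoidAlgebra.single (MulOpposite.op g) m)

theorem zsmul_gen (j : Fin k) (g : Gp n) (m c : ℤ) : c • gen j g m = gen j g (c * m) := by
  rw [gen, Finsupp.smul_single, MonoidAlgebra.smul_single, smul_eq_mul]; rfl

theorem neg_gen (j : Fin k) (g : Gp n) (m : ℤ) : -gen j g m = gen j g (-m) := by
  rw [← neg_one_zsmul, zsmul_gen, neg_one_mul]

theorem single_smul_gen (j : Fin k) (g h : Gp n) (m c : ℤ) :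
    (MonoidAlgebra.single (MulOpposite.op h) c : GroupRing n) • gen j g m =
      gen j (g * h) (c * m) := by
  rw [gen, Finsupp.smul_single, smul_eq_mul, MonoidAlgebra.single_mul_single, ← MulOpposite.op_mul]
  rfl

/-- An additive subgroup that contains the elements `e_j g` is everything. -/
theorem eq_top_of_gen {S : AddSubgroup (Fin k →₀ GroupRing n)}
    (h : ∀ j g, gen j g 1 ∈ S) : S = ⊤ := by
  rw [eq_top_iff]
  rintro x -
  induction x using Finsupp.induction_linear with
  | zero => exact S.zero_mem
  | add x y hx hy => exact S.add_mem hx hy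
  | single j y =>
    induction y using MonoidAlgebra.induction_linear with
    | zero => rw [Finsupp.single_zero]; exact S.zero_mem
    | add x y hx hy => rw [Finsupp.single_add]; exact S.add_mem hx hy
    | single g m =>
      have := S.zsmul_mem (h j g.unop) m
      rw [zsmul_gen, mul_one] at this
      exact this

/-- The homomorphism that sends `e_j` to the class of the edge from `a j` to `b j`. -/
def edgeMap (i : AssociatedCover W) (a b : Fin k → Gp n) :
    (Fin k →₀ GroupRing n) →ₗ[GroupRing n] CochainModule W :=
  Finsupp.linearCombination (GroupRing n) fun j => cochainClass i (edgeCochain i (a j) (b j))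

variable {i : AssociatedCover W} {r : ℕ} {a b : Fin k → Gp n}

theorem value_edgeMap_gen (hi : i.X = ball n r) (j : Fin k) (g : Gp n) (m : ℤ) (p : Lines W) :
    value W (edgeMap i a b (gen j g m)) p = m * edgeValue r (a j) (b j) (g • p) := by
  rw [edgeMap, gen, Finsupp.linearCombination_single, value_single_smul, value_edgeCochain hi]

/-- The edge from `a j` to `b j` comes from lines through the identity. -/
def Central (a b : Fin k → Gp n) (j : Fin k) : Prop := (a j).toWord.head? ≠ (b j).toWord.head?

/-- The edges are the edges of the Whitehead graph at the ball. -/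
structure EnumeratesEdges (W : Set (Gp n)) (r : ℕ) (a b : Fin k → Gp n) : Prop where
  adj : ∀ j, (whitehead W (ball n r)).Adj (a j) (b j)
  exists_index : ∀ x y, (whitehead W (ball n r)).Adj x y →
    ∃ j, (a j = x ∧ b j = y) ∨ (a j = y ∧ b j = x)

variable {ℓ : ℕ}

theorem Central.exists_line (hW : ∀ w ∈ W, w.norm ≤ ℓ) (hr : 2 * ℓ ≤ r + 1)
    (hE : EnumeratesEdges W r a b) {j : Fin k} (hj : Central a b j) :
    ∃ q : Lines W, q.Through 1 ∧ edgeValue r (a j) (b j) = delta q := by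
  obtain ⟨-, ξ, η, hl, hξ, hη⟩ := whitehead_ball_adj.1 (hE.adj j)
  have h1 : ξ.1 1 ≠ η.1 1 := through_one_of_head_ne (r := r) (by rw [hξ, hη]; exact hj)
  refine ⟨⟨(ξ, η), hl⟩, h1, ?_⟩
  rw [← hξ, ← hη]
  exact edgeValue_eq_delta hW hr (q := ⟨(ξ, η), hl⟩) h1

/-- `ε e_j g` represents the line `q`, which passes through `g⁻¹`. -/
structure Represents (r : ℕ) (a b : Fin k → Gp n) (q : Lines W) (j : Fin k) (ε : ℤ) (g : Gp n) :
    Prop where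
  sign : ε = 1 ∨ ε = -1
  central : Central a b j
  eq_delta : ∀ p : Lines W, ε * edgeValue r (a j) (b j) p = delta (g • q) p

theorem Represents.swap {q : Lines W} {j : Fin k} {ε : ℤ} {g : Gp n}
    (h : Represents r a b q j ε g) : Represents r a b q.swap j (-ε) g where
  sign := by rcases h.sign with rfl | rfl <;> simp
  central := h.central
  eq_delta p := by rw [neg_mul, h.eq_delta, ← Lines.swap_smul, delta_swap_left]

/-- The translate of the line that moves `v` to the identity crosses a central edge of the list; `ε`
records whether it does so in the listed orientation. -/
theorem exists_represents (hW : ∀ w ∈ W, w.norm ≤ ℓ) (hr : 2 * ℓ ≤ r + 1)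
    (hE : EnumeratesEdges W r a b) {q : Lines W} {v : Gp n} (hv : q.Through v) :
    ∃ j ε, Represents r a b q j ε v⁻¹ := by
  have hv1 : (v⁻¹ • q).Through 1 := by rw [Lines.through_smul, inv_inv, mul_one]; exact hv
  have hd := edgeValue_eq_delta hW hr hv1
  have hne : (ray (v⁻¹ • q).1.1 (r + 1)).toWord.head? ≠
      (ray (v⁻¹ • q).1.2 (r + 1)).toWord.head? := by
    rw [head_ray _ (by omega), head_ray _ (by omega)]
    exact fun h => hv1 (Option.some.inj h)
  obtain ⟨j, hj⟩ := hE.exists_index (ray (v⁻¹ • q).1.1 (r + 1)) (ray (v⁻¹ • q).1.2 (r + 1))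
    (whitehead_ball_adj.2 ⟨fun h => hne (by rw [h]), _, _, (v⁻¹ • q).2, rfl, rfl⟩)
  rcases hj with ⟨h1, h2⟩ | ⟨h1, h2⟩
  · refine ⟨j, 1, .inl rfl, ?_, fun p => ?_⟩
    · rw [Central, h1, h2]; exact hne
    · rw [one_mul, h1, h2, hd]
  · refine ⟨j, -1, .inr rfl, ?_, fun p => ?_⟩
    · rw [Central, h1, h2]; exact hne.symm
    · rw [h1, h2, edgeValue_swap, hd]; ring

theorem Represents.value_eq (hi : i.X = ball n r) {q : Lines W} {j : Fin k} {ε : ℤ} {g : Gp n}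
    (h : Represents r a b q j ε g) : value W (edgeMap i a b (gen j g ε)) = delta q := by
  funext p
  rw [value_edgeMap_gen hi, h.eq_delta, delta_smul]

/-- The edges that come from lines through the identity generate the module. -/
theorem closure_central (hW : ∀ w ∈ W, w.norm ≤ ℓ) (hr : 2 * ℓ ≤ r + 1) (hi : i.X = ball n r)
    (hE : EnumeratesEdges W r a b) :
    (AddSubgroup.closure {x | ∃ j g, Central a b j ∧ gen j g 1 = x}).map
      (edgeMap i a b).toAddMonoidHom = ⊤ := by
  refine eq_top_of_delta hW _ fun q => ?_
  obtain ⟨v, hv⟩ := q.exists_through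
  obtain ⟨j, ε, h⟩ := exists_represents hW hr hE hv
  refine ⟨_, ⟨gen j v⁻¹ ε, ?_, rfl⟩, h.value_eq hi⟩
  have hmem : gen j v⁻¹ 1 ∈ AddSubgroup.closure {x | ∃ j g, Central a b j ∧ gen j g 1 = x} :=
    AddSubgroup.subset_closure ⟨j, v⁻¹, h.central, rfl⟩
  have := AddSubgroup.zsmul_mem _ hmem ε
  rwa [zsmul_gen, mul_one] at this

theorem edgeMap_surjective (hW : ∀ w ∈ W, w.norm ≤ ℓ) (hr : 2 * ℓ ≤ r + 1) (hi : i.X = ball n r)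
    (hE : EnumeratesEdges W r a b) : Function.Surjective (edgeMap i a b) := by
  intro m
  have : m ∈ (AddSubgroup.closure {x | ∃ j g, Central a b j ∧ gen j g 1 = x}).map
      (edgeMap i a b).toAddMonoidHom := by rw [closure_central hW hr hi hE]; trivial
  obtain ⟨x, -, hx⟩ := this
  exact ⟨x, hx⟩

/-- Sufficient conditions for a set to generate the kernel. -/
structure IsRelatorSet (i : AssociatedCover W) (a b : Fin k → Gp n)
    (R : Set (Fin k →₀ GroupRing n)) : Prop where
  map_eq_zero : ∀ x ∈ R, edgeMap i a b x = 0
  exists_central : ∀ j, ∃ x ∈ R,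
    x - gen j 1 1 ∈ AddSubgroup.closure {x | ∃ j g, Central a b j ∧ gen j g 1 = x}
  mem_of_letter : ∀ j j', Central a b j → Central a b j' → ∀ (s : Letter n) (m : ℤ),
    (m = 1 ∨ m = -1) → edgeMap i a b (gen j 1 1 + gen j' (letter s) m) = 0 →
      gen j 1 1 + gen j' (letter s) m ∈ R

variable {R : Set (Fin k →₀ GroupRing n)}

/-- As `ε ^ 2 = 1`, the difference is a multiple of `e_j - ε ε' e_j' s⁻¹`. This element is in the
kernel because both terms represent the same line, so it is one of the relators that involve a
single letter. -/
theorem Represents.sub_mem_of_step (hW : ∀ w ∈ W, w.norm ≤ ℓ) (hi : i.X = ball n r)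
    (hR : IsRelatorSet i a b R)
    {q : Lines W} {v : Gp n} {s : Letter n} {j j' : Fin k} {ε ε' : ℤ}
    (h : Represents r a b q j ε v⁻¹) (h' : Represents r a b q j' ε' (v * letter s)⁻¹) :
    gen j v⁻¹ ε - gen j' (v * letter s)⁻¹ ε' ∈ Submodule.span (GroupRing n) R := by
  have hsq : ε * ε = 1 := by rcases h.sign with rfl | rfl <;> norm_num
  have hv' : (v * letter s)⁻¹ = letter (sinv s) * v⁻¹ := by rw [mul_inv_rev, letter_sinv]
  have e1 : gen j v⁻¹ ε - gen j' (v * letter s)⁻¹ ε' =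
      (MonoidAlgebra.single (MulOpposite.op v⁻¹) ε : GroupRing n) •
        (gen j 1 1 + gen j' (letter (sinv s)) (-(ε * ε'))) := by
    rw [smul_add, single_smul_gen, single_smul_gen, one_mul, mul_one, hv', sub_eq_add_neg, neg_gen]
    congr 2
    rw [mul_neg, ← mul_assoc, hsq, one_mul]
  rw [e1]
  refine Submodule.smul_mem _ _ (Submodule.subset_span
    (hR.mem_of_letter j j' h.central h'.central _ _ ?_ ?_))
  · rcases h.sign with rfl | rfl <;> rcases h'.sign with rfl | rfl <;> simp
  · apply value_injective hW
    funext p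
    rw [map_add, map_add, map_zero, Pi.add_apply, value_edgeMap_gen hi, value_edgeMap_gen hi,
      one_smul, one_mul]
    have h1 := h.eq_delta p
    have h2 := h'.eq_delta (letter (sinv s) • p)
    rw [hv', mul_smul, delta_smul, ← h1] at h2
    show _ = (0 : ℤ)
    have h3 : edgeValue r (a j) (b j) p = ε * (ε * edgeValue r (a j) (b j) p) := by
      rw [← mul_assoc, hsq, one_mul]
    rw [h3, ← h2]
    ring

/-- All vertices of the ray from `v` to an end of the line lie on the line, so they have
representatives, and the differences for single steps telescope. -/
theorem Represents.sub_mem_of_rayFrom (hW : ∀ w ∈ W, w.norm ≤ ℓ) (hr : 2 * ℓ ≤ r + 1)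
    (hE : EnumeratesEdges W r a b) (hi : i.X = ball n r) (hR : IsRelatorSet i a b R)
    {q : Lines W} {v : Gp n} (hv : q.Through v) (m : ℕ) {j j' : Fin k} {ε ε' : ℤ}
    (h : Represents r a b q j ε v⁻¹) (h' : Represents r a b q j' ε' (rayFrom q.1.1 v (m + 1))⁻¹) :
    gen j v⁻¹ ε - gen j' (rayFrom q.1.1 v (m + 1))⁻¹ ε' ∈ Submodule.span (GroupRing n) R := by
  induction m generalizing j' ε' with
  | zero => exact h.sub_mem_of_step hW hi hR h'
  | succ m ih =>
    obtain ⟨j₁, ε₁, h₁⟩ := exists_represents hW hr hE (hv.rayFrom (m + 1))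
    have := Submodule.add_mem _ (ih h₁) (h₁.sub_mem_of_step hW hi hR h')
    rwa [sub_add_sub_cancel] at this

/-- Modulo the relators, the representatives of a line agree. -/
theorem Represents.sub_mem (hW : ∀ w ∈ W, w.norm ≤ ℓ) (hr : 2 * ℓ ≤ r + 1)
    (hE : EnumeratesEdges W r a b) (hi : i.X = ball n r) (hR : IsRelatorSet i a b R)
    {q : Lines W} {v v' : Gp n} (hv : q.Through v) (hv' : q.Through v') {j j' : Fin k} {ε ε' : ℤ}
    (h : Represents r a b q j ε v⁻¹) (h' : Represents r a b q j' ε' v'⁻¹) :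
    gen j v⁻¹ ε - gen j' v'⁻¹ ε' ∈ Submodule.span (GroupRing n) R := by
  obtain ⟨c, d, hcd⟩ := rayFrom_merge q.1.1 v
  obtain ⟨c', d', hcd'⟩ := rayFrom_merge q.1.1 v'
  -- Both vertices are the one at level `d + d' + 1` on the ray from the identity. The additional
  -- `1` makes the number of steps positive, as `sub_mem_of_rayFrom` requires.
  have he : rayFrom q.1.1 v (c + d' + 1) = rayFrom q.1.1 v' (c' + d + 1) := by
    rw [add_assoc, add_assoc, rayFrom_add, hcd, rayFrom_add _ v', hcd', ← rayFrom_add,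
      ← rayFrom_add]
    congr 1
    omega
  obtain ⟨j₁, ε₁, h₁⟩ := exists_represents hW hr hE (hv.rayFrom (c + d' + 1))
  have h2 := h.sub_mem_of_rayFrom hW hr hE hi hR hv _ h₁
  rw [he] at h₁ h2
  have h3 := h'.sub_mem_of_rayFrom hW hr hE hi hR hv' _ h₁
  have := Submodule.sub_mem _ h2 h3
  rwa [sub_sub_sub_cancel_right] at this

/-- A set of lines that contains each line with exactly one of its two orientations. -/
theorem exists_orientation (W : Set (Gp n)) :
    ∃ O : Set (Lines W), ∀ p, p.swap ∈ O ↔ p ∉ O := by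
  classical
  -- Of the two orientations of a line, the smaller one in some well-ordering is chosen.
  refine ⟨{p | WellOrderingRel p p.swap}, fun p => ?_⟩
  simp only [mem_ofPred_eq, Lines.swap_swap]
  rcases trichotomous_of (r := WellOrderingRel) p p.swap with h | h | h
  · exact iff_of_false (asymm_of _ h) (not_not.2 h)
  · exact absurd h.symm p.swap_ne
  · exact iff_of_true h (asymm_of _ h)

/-- Modulo the relators, the free module is spanned over the integers by one representative `Y q`
for each `q ∈ O`. Their images `delta q` are linearly independent, so the part of a kernel element
that they contribute is zero. -/
theorem span_eq_ker (hW : ∀ w ∈ W, w.norm ≤ ℓ) (hr : 2 * ℓ ≤ r + 1)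
    (hE : EnumeratesEdges W r a b) (hi : i.X = ball n r) (hR : IsRelatorSet i a b R) :
    Submodule.span (GroupRing n) R = LinearMap.ker (edgeMap i a b) := by
  refine le_antisymm (Submodule.span_le.2 fun x hx => hR.map_eq_zero x hx) fun x hx => ?_
  obtain ⟨O, hO⟩ := exists_orientation W
  choose v hv using fun q : Lines W => q.exists_through
  choose J ε hJ using fun q : Lines W => exists_represents hW hr hE (hv q)
  set Y : Lines W → (Fin k →₀ GroupRing n) := fun q => gen (J q) (v q)⁻¹ (ε q) with hY
  set T : Submodule ℤ (Fin k →₀ GroupRing n) :=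
    (Submodule.span (GroupRing n) R).restrictScalars ℤ ⊔ Submodule.span ℤ (Y '' O) with hT
  have hYT : ∀ q ∈ O, Y q ∈ T := fun q hq =>
    Submodule.mem_sup_right (Submodule.subset_span (mem_image_of_mem _ hq))
  have hKT : ∀ x ∈ Submodule.span (GroupRing n) R, x ∈ T := fun x hx => Submodule.mem_sup_left hx
  -- A translate of a central generator represents some line. Modulo the relators it is the chosen
  -- representative of this line or, if `O` contains the opposite orientation, the negative of that
  -- one.
  have hC : ∀ j g, Central a b j → gen j g 1 ∈ T := by
    intro j g hj
    obtain ⟨q', hq', hd⟩ := hj.exists_line hW hr hE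
    have hth : (g⁻¹ • q').Through g⁻¹ := by
      rw [Lines.through_smul, inv_inv, mul_inv_cancel]; exact hq'
    have hrep : Represents r a b (g⁻¹ • q') j 1 g⁻¹⁻¹ :=
      ⟨.inl rfl, hj, fun p => by rw [one_mul, hd, inv_inv, smul_inv_smul]⟩
    by_cases hq : g⁻¹ • q' ∈ O
    · have := hKT _ (hrep.sub_mem hW hr hE hi hR hth (hv _) (hJ _))
      rw [inv_inv] at this
      have h2 := T.add_mem this (hYT _ hq)
      rwa [sub_add_cancel] at h2
    · have := hKT _ (hrep.swap.sub_mem hW hr hE hi hR hth.swap (hv _) (hJ _))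
      rw [inv_inv] at this
      have h2 := T.neg_mem (T.add_mem this (hYT _ ((hO _).2 hq)))
      rwa [sub_add_cancel, neg_gen, neg_neg] at h2
  have hcl : ∀ x ∈ AddSubgroup.closure {x | ∃ j g, Central a b j ∧ gen j g 1 = x},
      ∀ g : Gp n, (MonoidAlgebra.single (MulOpposite.op g) 1 : GroupRing n) • x ∈ T := by
    intro x hx g
    induction hx using AddSubgroup.closure_induction with
    | mem x hx =>
      obtain ⟨j, h, hj, rfl⟩ := hx
      rw [single_smul_gen, one_mul]
      exact hC _ _ hj
    | zero => rw [smul_zero]; exact T.zero_mem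
    | add x y _ _ hx hy => rw [smul_add]; exact T.add_mem hx hy
    | neg x _ hx => rw [smul_neg]; exact T.neg_mem hx
  -- The relators of the first kind, multiplied by `g`, reduce any `e_j g` to translates of central
  -- generators.
  have htop : T.toAddSubgroup = ⊤ := by
    refine eq_top_of_gen fun j g => ?_
    obtain ⟨y, hy, hyc⟩ := hR.exists_central j
    have h1 := hcl _ hyc g
    rw [smul_sub, single_smul_gen, one_mul, one_mul] at h1
    have h2 := T.sub_mem (hKT _ (Submodule.smul_mem _
      (MonoidAlgebra.single (MulOpposite.op g) 1 : GroupRing n) (Submodule.subset_span hy))) h1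
    rwa [sub_sub_cancel] at h2
  have hxT : x ∈ T := by
    have : x ∈ T.toAddSubgroup := by rw [htop]; trivial
    exact this
  obtain ⟨y, hy, z, hz, rfl⟩ := Submodule.mem_sup.1 hxT
  obtain ⟨f, hf, rfl⟩ := (Finsupp.mem_span_image_iff_linearCombination ℤ).1 hz
  have hyker : edgeMap i a b y = 0 := by
    have : Submodule.span (GroupRing n) R ≤ LinearMap.ker (edgeMap i a b) :=
      Submodule.span_le.2 fun x hx => hR.map_eq_zero x hx
    exact this hy
  have hxker : edgeMap i a b (y + Finsupp.linearCombination ℤ Y f) = 0 := hx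
  rw [map_add, hyker, zero_add] at hxker
  have hsum : ∀ p, value W (edgeMap i a b (Finsupp.linearCombination ℤ Y f)) p =
      f.sum fun q m => m * delta q p := by
    intro p
    rw [Finsupp.linearCombination_apply, Finsupp.sum, Finsupp.sum, map_sum, map_sum,
      Finset.sum_apply]
    refine Finset.sum_congr rfl fun q _ => ?_
    rw [map_zsmul, map_zsmul, (hJ q).value_eq hi]
    rfl
  -- For `p ∈ O` the value at `p` is the coefficient `f p`, because `O` contains no other line that
  -- equals `p` or `p.swap`.
  have hf0 : f = 0 := by
    ext p
    by_cases hp : p ∈ O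
    · have h1 := hsum p
      rw [hxker, map_zero] at h1
      have h2 : f.sum (fun q m => m * delta q p) = f p := by
        rw [Finsupp.sum, Finset.sum_eq_single p]
        · rw [delta_self, mul_one]
        · intro q hq hqp
          have hqO : q ∈ O := hf hq
          rw [delta_eq_zero hqp.symm, mul_zero]
          rintro rfl
          exact (hO q).1 hp hqO
        · intro h
          rw [Finsupp.notMem_support_iff.1 h, zero_mul]
      rw [← h2, ← h1]; rfl
    · by_contra h
      exact hp (hf (Finsupp.mem_support_iff.2 h))
  rw [hf0, map_zero, add_zero]
  exact hy

end Presentation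

end

section
variable {n : ℕ} {W : Set (Gp n)}

/-! ### Words -/

/-- The reduced word that represents an element of the free group. -/
def toW (g : Gp n) : Word := g.toWord.map fun s => (s.1.val, s.2)

/-- The reduced form of a word without its letters that are not in the free group of rank `n`. -/
def nf (n : ℕ) (w : Word) : Word := FreeGroup.reduce (w.filter fun s => s.1 < n)

theorem reduce_map_val (L : List (Letter n)) :
    FreeGroup.reduce (L.map fun s => (s.1.val, s.2)) =
      (FreeGroup.reduce L).map fun s => (s.1.val, s.2) := by
  induction L with
  | nil => rfl
  | cons s L ih =>
    rw [List.map_cons, FreeGroup.reduce.cons, ih, FreeGroup.reduce.cons]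
    cases FreeGroup.reduce L with
    | nil => rfl
    | cons t M =>
      simp only [List.map_cons]
      by_cases h : s.1 = t.1 ∧ s.2 = !t.2
      · rw [if_pos h, if_pos ⟨congrArg Fin.val h.1, h.2⟩]
      · rw [if_neg h, if_neg fun h' => h ⟨Fin.ext h'.1, h'.2⟩]
        rfl

/-- Reduction commutes with the inclusion of the letters of rank `n` into those indexed by all
natural numbers. So the algorithms can compute in one type of words for all ranks. -/
theorem nf_eq (n : ℕ) (w : Word) : nf n w = toW (w.eval n) := by
  rw [nf, toW, Word.eval, FreeGroup.toWord_mk, ← reduce_map_val]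
  congr 1
  induction w with
  | nil => rfl
  | cons s w ih =>
    rw [List.filter_cons, List.filterMap_cons]
    by_cases h : s.1 < n
    · simp [h, ih]
    · simp [h, ih]

theorem eval_map_val (L : List (Letter n)) :
    Word.eval n (L.map fun s => (s.1.val, s.2)) = FreeGroup.mk L := by
  rw [Word.eval, List.filterMap_map]
  congr 1
  convert List.filterMap_some with s
  simp

theorem eval_toW (g : Gp n) : (toW g).eval n = g := by
  rw [toW, eval_map_val, FreeGroup.mk_toWord]

theorem toW_injective : Function.Injective (toW : Gp n → Word) := fun g h hgh => by
  rw [← eval_toW g, hgh, eval_toW]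

theorem length_toW (g : Gp n) : (toW g).length = g.norm := by
  rw [toW, List.length_map]; rfl

theorem head_toW (g : Gp n) : (toW g).head? = g.toWord.head?.map fun s => (s.1.val, s.2) := by
  rw [toW, List.head?_map]

theorem head_toW_eq {g h : Gp n} : (toW g).head? = (toW h).head? ↔
    g.toWord.head? = h.toWord.head? := by
  rw [head_toW, head_toW]
  refine (Option.map_injective ?_).eq_iff
  rintro ⟨i, b⟩ ⟨j, c⟩ h
  simpa [Fin.ext_iff] using h

theorem eval_append (n : ℕ) (v w : Word) : Word.eval n (v ++ w) = v.eval n * w.eval n := by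
  rw [Word.eval, List.filterMap_append, ← FreeGroup.mul_mk]; rfl

theorem eval_cons (n : ℕ) (s : ℕ × Bool) (w : Word) :
    Word.eval n (s :: w) = Word.eval n [s] * w.eval n := eval_append n [s] w

theorem eval_invRev (n : ℕ) (w : Word) : Word.eval n (FreeGroup.invRev w) = (w.eval n)⁻¹ := by
  induction w with
  | nil => simp [FreeGroup.invRev, Word.eval, ← FreeGroup.one_eq_mk]
  | cons s w ih =>
    have h1 : FreeGroup.invRev (s :: w) = FreeGroup.invRev w ++ FreeGroup.invRev [s] := by
      rw [← FreeGroup.invRev_append]; rfl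
    have h2 : Word.eval n (FreeGroup.invRev [s]) = (Word.eval n [s])⁻¹ := by
      by_cases h : s.1 < n
      · simp [Word.eval, FreeGroup.invRev, h]
      · simp [Word.eval, FreeGroup.invRev, h, ← FreeGroup.one_eq_mk]
    rw [h1, eval_append, ih, eval_cons, mul_inv_rev, h2]

theorem norm_eval_le (n : ℕ) (w : Word) : (w.eval n).norm ≤ w.length :=
  FreeGroup.norm_mk_le.trans (List.length_filterMap_le _ _)

/-- The `m`-th power of a word. -/
def wordPow (m : ℕ) (w : Word) : Word := (List.range m).flatMap fun _ => w

theorem eval_wordPow (n m : ℕ) (w : Word) : (wordPow m w).eval n = w.eval n ^ m := by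
  induction m with
  | zero => rfl
  | succ m ih =>
    have : wordPow (m + 1) w = wordPow m w ++ w := by
      rw [wordPow, List.range_succ, List.flatMap_append]; simp [wordPow]
    rw [this, eval_append, ih, pow_succ]

/-- The letters of the free group of rank `n`. -/
def letters (n : ℕ) : List (ℕ × Bool) := (List.range n).flatMap fun j => [(j, true), (j, false)]

theorem mem_letters {n : ℕ} {s : ℕ × Bool} : s ∈ letters n ↔ s.1 < n := by
  obtain ⟨j, b⟩ := s
  cases b <;> simp [letters]

/-- The words of length at most `r` in the letters of the free group of rank `n`. -/
def wordsUpTo (n : ℕ) (r : ℕ) : List Word :=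
  r.rec [[]] fun _ l => [] :: l.flatMap fun w => (letters n).map fun s => s :: w

theorem mem_wordsUpTo {n r : ℕ} {w : Word} (hr : w.length ≤ r) (hw : ∀ s ∈ w, s.1 < n) :
    w ∈ wordsUpTo n r := by
  induction r generalizing w with
  | zero =>
    have : w = [] := List.length_eq_zero_iff.1 (by omega)
    rw [this]
    exact List.mem_singleton.2 rfl
  | succ r ih =>
    show w ∈ [] :: (wordsUpTo n r).flatMap _
    cases w with
    | nil => exact List.mem_cons_self
    | cons s w =>
      refine List.mem_cons_of_mem _ (List.mem_flatMap.2 ⟨w, ih ?_ ?_, ?_⟩)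
      · simpa using hr
      · exact fun t ht => hw t (List.mem_cons_of_mem _ ht)
      · exact List.mem_map.2 ⟨s, mem_letters.2 (hw s List.mem_cons_self), rfl⟩

theorem toW_mem_wordsUpTo {r : ℕ} {g : Gp n} (h : g.norm ≤ r) : toW g ∈ wordsUpTo n r := by
  refine mem_wordsUpTo (by rwa [length_toW]) ?_
  intro s hs
  obtain ⟨t, -, rfl⟩ := List.mem_map.1 hs
  exact t.1.2

theorem ncard_ball_le (n r : ℕ) : (ball n r).ncard ≤ (wordsUpTo n r).length := by
  classical
  have h : ball n r ⊆ (((wordsUpTo n r).map (Word.eval n)).toFinset : Set (Gp n)) := by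
    intro g hg
    simp only [List.coe_toFinset, mem_ofPred_eq, List.mem_map]
    exact ⟨toW g, toW_mem_wordsUpTo hg, eval_toW g⟩
  refine (ncard_le_ncard h (Finset.finite_toSet _)).trans ?_
  rw [ncard_coe_finset]
  exact (List.toFinset_card_le _).trans (by rw [List.length_map])

/-- A bound for the lengths of the words in a list. -/
def lengthBound (ws : List Word) : ℕ := ws.flatten.length

theorem norm_le_lengthBound {n : ℕ} {ws : List Word} :
    ∀ w ∈ wordSet n ws, w.norm ≤ lengthBound ws := by
  rintro _ ⟨w, hw, rfl⟩
  refine (norm_eval_le n w).trans ?_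
  rw [lengthBound, List.length_flatten]
  exact List.le_sum_of_mem (List.mem_map_of_mem hw)

/-! ### Enumeration of the lines that pass through a ball -/

/-- Consecutive points `h w ^ i` are at distance `|w|` from each other and at distance at least
`|h|` from the identity. If `|w| < 2 |h|`, they lie in the same direction from the identity. Then
all of the points do, and so do both ends. -/
theorem two_mul_norm_le {w h : Gp n} (hmin : ∀ i : ℤ, h.norm ≤ (h * w ^ i).norm)
    {ξ η : Boundary n} (hξ : ConvergesTo (fun k => h * w ^ k) ξ)
    (hη : ConvergesTo (fun k => h * w⁻¹ ^ k) η) (h1 : ξ.1 1 ≠ η.1 1) : 2 * h.norm ≤ w.norm := by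
  by_contra! hlt
  have step : ∀ i : ℤ, (h * w ^ i).toWord.head? = (h * w ^ (i + 1)).toWord.head? := by
    intro i
    by_contra hne
    have := norm_inv_mul_of_head_ne hne
    rw [show (h * w ^ i)⁻¹ * (h * w ^ (i + 1)) = w by rw [zpow_add_one]; group] at this
    have h2 := hmin i
    have h3 := hmin (i + 1)
    omega
  have key : ∀ i : ℤ, (h * w ^ i).toWord.head? = h.toWord.head? := by
    intro i
    induction i using Int.induction_on with
    | zero => simp
    | succ i ih => rw [← step, ih]
    | pred i ih => rw [step, sub_add_cancel, ih]
  obtain ⟨k, hk, hk'⟩ := ((hξ 1).and (hη 1)).exists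
  rw [inv_one, one_mul] at hk hk'
  have e1 := key k
  have e2 := key (-k)
  rw [zpow_natCast] at e1
  rw [zpow_neg, zpow_natCast, ← inv_pow] at e2
  exact h1 (Option.some.inj (hk.symm.trans (e1.trans (e2.symm.trans hk'))))

/-- It is the last common vertex of the two rays from the identity. -/
theorem exists_branch_vertex {ξ η : Boundary n} {r : ℕ} (h : ray ξ (r + 1) ≠ ray η (r + 1)) :
    ∃ x ∈ ball n r, ξ.1 x ≠ η.1 x := by
  induction r with
  | zero =>
    refine ⟨1, by simp [ball], fun h' => h ?_⟩
    simp [rayFrom, h']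
  | succ r ih =>
    by_cases h2 : ray ξ (r + 1) = ray η (r + 1)
    · refine ⟨ray ξ (r + 1), ray_mem_ball _ le_rfl, fun h' => h ?_⟩
      show ray ξ (r + 1) * letter (ξ.1 (ray ξ (r + 1))) =
        ray η (r + 1) * letter (η.1 (ray η (r + 1)))
      rw [← h2, h']
    · obtain ⟨x, hx, hx'⟩ := ih h2
      exact ⟨x, le_trans hx (Nat.le_succ r), hx'⟩

/-- The base point `g` may be replaced by any `g w ^ i`. The one nearest to a vertex `x` of the ball
that lies on the line is within `|w| / 2` of `x`, by `two_mul_norm_le`. This bounds the enumeration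
of the lines that cross the ball. -/
theorem LineEnds.exists_norm_le {ℓ : ℕ} (hW : ∀ w ∈ W, w.norm ≤ ℓ) {ξ η : Boundary n}
    (h : LineEnds W ξ η) {r : ℕ} (hr : ray ξ (r + 1) ≠ ray η (r + 1)) :
    ∃ w ∈ W, ∃ g : Gp n, g.norm ≤ r + ℓ ∧
      ConvergesTo (fun k => g * w ^ k) ξ ∧ ConvergesTo (fun k => g * w⁻¹ ^ k) η := by
  obtain ⟨x, hx, hne⟩ := exists_branch_vertex hr
  obtain ⟨w, hw, g, hξ, hη⟩ := h
  let f : ℤ → ℕ := fun i => (x⁻¹ * g * w ^ i).norm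
  obtain ⟨i, hi⟩ : ∃ i, ∀ i', f i ≤ f i' := ⟨Function.argmin f, fun i' => Function.argmin_le f i'⟩
  have hξ' : ConvergesTo (fun k => g * w ^ i * w ^ k) ξ := by
    have := hξ.mul_right (w ^ i)
    simpa only [mul_assoc, ← zpow_natCast, zpow_mul_comm w i] using this
  have hη' : ConvergesTo (fun k => g * w ^ i * w⁻¹ ^ k) η := by
    have := hη.mul_right (w ^ i)
    simpa only [mul_assoc, ← zpow_natCast, inv_zpow', zpow_mul_comm w i] using this
  have h2 := two_mul_norm_le (w := w) (h := x⁻¹ * g * w ^ i)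
    (fun i' => by
      have := hi (i + i')
      simp only [f, zpow_add, ← mul_assoc] at this
      exact this)
    (by simpa only [mul_assoc] using hξ'.smul x⁻¹) (by simpa only [mul_assoc] using hη'.smul x⁻¹)
    (by simpa [Boundary.smul_val] using hne)
  refine ⟨w, hw, g * w ^ i, ?_, hξ', hη'⟩
  have h3 := FreeGroup.norm_mul_le x (x⁻¹ * g * w ^ i)
  rw [mul_assoc x⁻¹, mul_inv_cancel_left, ← mul_assoc] at h3
  have h4 := hW w hw
  have h5 : x.norm ≤ r := hx
  omega

/-! ### The algorithms -/

/-- The input of the algorithms: the rank, the words and the radius of the ball. -/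
abbrev Input : Type := (ℕ × List Word) × ℕ

/-- The word that represents the vertex through which the geodesics from the ball of radius `r`
to the limit of the sequence `g w ^ k` leave this ball. -/
def exitWord (n r : ℕ) (g w : Word) : Word :=
  (nf n (g ++ wordPow (g.length + (r + 1)) w)).take (r + 1)

/-- The exponent in `exitWord` is large enough for the first `r + 1` letters of `g w ^ k` to have
become those of the limit. -/
theorem exitWord_eq {g w : Word} (hw : w.eval n ≠ 1) {ξ : Boundary n}
    (h : ConvergesTo (fun k => g.eval n * w.eval n ^ k) ξ) (r : ℕ) :
    exitWord n r g w = toW (ray ξ (r + 1)) := by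
  rw [toW, h.toWord_ray hw (m := g.length + (r + 1)) (by have := norm_eval_le n g; omega),
    exitWord, nf_eq, eval_append, eval_wordPow, toW, List.map_take]

/-- A word or its inverse. -/
def signedWord (b : Bool) (w : Word) : Word := if b then w else FreeGroup.invRev w

/-- The vertices through which a line leaves a ball. -/
def passage (n r : ℕ) (b : Bool) (g w : Word) : Word × Word :=
  (exitWord n r g (signedWord b w), exitWord n r g (signedWord (!b) w))

/-- Representatives of the lines that pass through the ball of radius `r`. -/
def lineWords (c : Input) : List (Word × Word) :=
  (wordsUpTo c.1.1 (c.2 + lengthBound c.1.2)).flatMap fun g => c.1.2.map fun w => (g, w)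

/-- Removes the repetitions of unordered pairs from a list. -/
def dedupPairs (l : List (Word × Word)) : List (Word × Word) :=
  l.foldr (fun e acc => if e ∈ acc ∨ e.swap ∈ acc then acc else e :: acc) []

/-- The list of the edges of the Whitehead graph at a ball. -/
def edgeList (c : Input) : List (Word × Word) :=
  dedupPairs (((lineWords c).map fun p => passage c.1.1 c.2 true p.1 p.2).filter
    fun e => e.1 ≠ e.2)

theorem mem_of_mem_dedupPairs {l : List (Word × Word)} {e : Word × Word} (h : e ∈ dedupPairs l) :
    e ∈ l := by
  induction l with
  | nil => exact h
  | cons e' l ih =>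
    rw [dedupPairs, List.foldr_cons, ← dedupPairs] at h
    split_ifs at h
    · exact List.mem_cons_of_mem _ (ih h)
    · rcases List.mem_cons.1 h with rfl | h
      · exact List.mem_cons_self
      · exact List.mem_cons_of_mem _ (ih h)

theorem mem_dedupPairs_of_mem {l : List (Word × Word)} {e : Word × Word} (h : e ∈ l) :
    e ∈ dedupPairs l ∨ e.swap ∈ dedupPairs l := by
  induction l with
  | nil => simp at h
  | cons e' l ih =>
    rw [dedupPairs, List.foldr_cons, ← dedupPairs]
    rcases List.mem_cons.1 h with rfl | h
    · split_ifs with h'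
      · exact h'
      · exact .inl List.mem_cons_self
    · split_ifs
      · exact ih h
      · exact (ih h).imp (List.mem_cons_of_mem _) (List.mem_cons_of_mem _)

theorem pairwise_dedupPairs (l : List (Word × Word)) :
    (dedupPairs l).Pairwise fun e e' => e ≠ e' ∧ e.swap ≠ e' := by
  induction l with
  | nil => exact .nil
  | cons e l ih =>
    rw [dedupPairs, List.foldr_cons, ← dedupPairs]
    split_ifs with h
    · exact ih
    · refine List.pairwise_cons.2 ⟨fun e' he' => ⟨?_, ?_⟩, ih⟩
      · rintro rfl; exact h (.inl he')
      · rintro rfl; exact h (.inr he')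

theorem mem_lineWords {c : Input} {g w : Word} :
    (g, w) ∈ lineWords c ↔ g ∈ wordsUpTo c.1.1 (c.2 + lengthBound c.1.2) ∧ w ∈ c.1.2 := by
  simp [lineWords]

theorem eval_signedWord (n : ℕ) (b : Bool) (w : Word) :
    (signedWord b w).eval n = if b then w.eval n else (w.eval n)⁻¹ := by
  cases b
  · exact eval_invRev n w
  · rfl

theorem exitWord_congr {n r : ℕ} {g w w' : Word} (h : w.eval n = w'.eval n) :
    exitWord n r g w = exitWord n r g w' := by
  rw [exitWord, exitWord, nf_eq, nf_eq, eval_append, eval_append, eval_wordPow, eval_wordPow, h]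

/-- Words that spell the identity define no line. Their passages are symmetric, so they yield no
edges and contribute equally to both sides of the test for relators. -/
theorem passage_of_eval_eq_one {n r : ℕ} {b b' : Bool} {g w : Word} (h : w.eval n = 1) :
    passage n r b g w = passage n r b' g w := by
  have : ∀ b b', exitWord n r g (signedWord b w) = exitWord n r g (signedWord b' w) :=
    fun b b' => exitWord_congr (by rw [eval_signedWord, eval_signedWord, h]; simp)
  exact Prod.ext (this _ _) (this _ _)

theorem passage_true_eq {g w : Word} (hw : w.eval n ≠ 1) {ξ η : Boundary n}
    (hξ : ConvergesTo (fun k => g.eval n * w.eval n ^ k) ξ)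
    (hη : ConvergesTo (fun k => g.eval n * (w.eval n)⁻¹ ^ k) η) (r : ℕ) :
    passage n r true g w = (toW (ray ξ (r + 1)), toW (ray η (r + 1))) := by
  refine Prod.ext (exitWord_eq hw hξ r) (exitWord_eq ?_ ?_ r)
  · rw [eval_signedWord]; simpa using hw
  · rw [eval_signedWord]; exact hη

theorem passage_false_eq (n r : ℕ) (g w : Word) :
    passage n r false g w = (passage n r true g w).swap := rfl

theorem exists_of_mem_edgeList {ws : List Word} {r : ℕ} {e : Word × Word}
    (he : e ∈ edgeList ((n, ws), r)) : ∃ ξ η, IsLine (wordSet n ws) ξ η ∧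
      e.1 = toW (ray ξ (r + 1)) ∧ e.2 = toW (ray η (r + 1)) ∧ ray ξ (r + 1) ≠ ray η (r + 1) := by
  obtain ⟨h1, h2⟩ := List.mem_filter.1 (mem_of_mem_dedupPairs he)
  obtain ⟨⟨g, w⟩, hgw, rfl⟩ := List.mem_map.1 h1
  simp only [ne_eq, decide_not, Bool.not_eq_true', decide_eq_false_iff_not] at h2
  have hw : w.eval n ≠ 1 := fun h => h2 (congrArg Prod.fst (passage_of_eval_eq_one (b := true)
    (b' := false) (r := r) (g := g) h))
  obtain ⟨ξ, hξ⟩ := exists_convergesTo_pow hw (g.eval n)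
  obtain ⟨η, hη⟩ := exists_convergesTo_pow (inv_ne_one.2 hw) (g.eval n)
  have hp := passage_true_eq hw hξ hη r
  refine ⟨ξ, η, .inl ⟨w.eval n, ⟨w, (mem_lineWords.1 hgw).2, rfl⟩, g.eval n, hξ, hη⟩,
    congrArg Prod.fst hp, congrArg Prod.snd hp, fun h => h2 ?_⟩
  show (passage n r true g w).1 = (passage n r true g w).2
  rw [hp, h]

theorem mem_edgeList_of_line {ws : List Word} {r : ℕ} {ξ η : Boundary n}
    (h : IsLine (wordSet n ws) ξ η) (hne : ray ξ (r + 1) ≠ ray η (r + 1)) :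
    (toW (ray ξ (r + 1)), toW (ray η (r + 1))) ∈ edgeList ((n, ws), r) ∨
      (toW (ray η (r + 1)), toW (ray ξ (r + 1))) ∈ edgeList ((n, ws), r) := by
  have key : ∀ {ξ η : Boundary n}, LineEnds (wordSet n ws) ξ η →
      ray ξ (r + 1) ≠ ray η (r + 1) →
      (toW (ray ξ (r + 1)), toW (ray η (r + 1))) ∈ edgeList ((n, ws), r) ∨
      (toW (ray η (r + 1)), toW (ray ξ (r + 1))) ∈ edgeList ((n, ws), r) := by
    intro ξ η h hne
    obtain ⟨_, ⟨w, hw, rfl⟩, g, hg, hξ, hη⟩ := h.exists_norm_le norm_le_lengthBound hne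
    have hw1 : w.eval n ≠ 1 := by
      intro h0
      rw [h0] at hξ
      obtain ⟨k, hk⟩ := (hξ g).exists
      simp at hk
    rw [← eval_toW g] at hξ hη
    have hp := passage_true_eq hw1 hξ hη r
    refine mem_dedupPairs_of_mem (List.mem_filter.2 ⟨List.mem_map.2 ⟨(toW g, w),
      mem_lineWords.2 ⟨toW_mem_wordsUpTo hg, hw⟩, hp⟩, ?_⟩)
    simp only [ne_eq, decide_not, Bool.not_eq_true', decide_eq_false_iff_not]
    exact fun h => hne (toW_injective h)
  rcases h with h | h
  · exact key h hne
  · exact (key h hne.symm).symm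

/-- The listed words are reduced, so vertices can be compared by comparing words. -/
theorem eval_edgeList {ws : List Word} {r : ℕ} {e : Word × Word}
    (he : e ∈ edgeList ((n, ws), r)) :
    toW (e.1.eval n) = e.1 ∧ toW (e.2.eval n) = e.2 := by
  obtain ⟨ξ, η, -, h1, h2, -⟩ := exists_of_mem_edgeList he
  rw [h1, h2, eval_toW, eval_toW]
  exact ⟨rfl, rfl⟩

theorem adj_of_mem_edgeList {ws : List Word} {r : ℕ} {e : Word × Word}
    (he : e ∈ edgeList ((n, ws), r)) :
    (whitehead (wordSet n ws) (ball n r)).Adj (e.1.eval n) (e.2.eval n) := by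
  obtain ⟨ξ, η, hl, h1, h2, hne⟩ := exists_of_mem_edgeList he
  rw [h1, h2, eval_toW, eval_toW]
  exact whitehead_ball_adj.2 ⟨hne, ξ, η, hl, rfl, rfl⟩

theorem mem_edgeList_of_adj {ws : List Word} {r : ℕ} {x y : Gp n}
    (h : (whitehead (wordSet n ws) (ball n r)).Adj x y) :
    (toW x, toW y) ∈ edgeList ((n, ws), r) ∨ (toW y, toW x) ∈ edgeList ((n, ws), r) := by
  obtain ⟨hne, ξ, η, hl, rfl, rfl⟩ := whitehead_ball_adj.1 h
  exact mem_edgeList_of_line hl hne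

theorem nodup_edgeList (ws : List Word) (r : ℕ) :
    ((edgeList ((n, ws), r)).map fun e => s(e.1.eval n, e.2.eval n)).Nodup := by
  rw [List.Nodup, List.pairwise_map]
  refine (pairwise_dedupPairs _).imp_of_mem ?_
  intro e e' he he' hne heq
  have h1 := eval_edgeList he
  have h2 := eval_edgeList he'
  rcases Sym2.eq_iff.1 heq with ⟨h3, h4⟩ | ⟨h3, h4⟩
  · exact hne.1 (Prod.ext (by rw [← h1.1, h3, h2.1]) (by rw [← h1.2, h4, h2.2]))
  · exact hne.2 (Prod.ext (by rw [Prod.fst_swap, ← h1.2, h4, h2.1])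
      (by rw [Prod.snd_swap, ← h1.1, h3, h2.2]))

theorem mem_map_edgeList_iff (ws : List Word) (r : ℕ) (e : Sym2 (Gp n)) :
    e ∈ (edgeList ((n, ws), r)).map (fun e => s(e.1.eval n, e.2.eval n)) ↔
      e ∈ (whitehead (wordSet n ws) (ball n r)).edgeSet := by
  induction e using Sym2.ind with
  | _ x y =>
    rw [List.mem_map, SimpleGraph.mem_edgeSet]
    constructor
    · rintro ⟨e, he, heq⟩
      have := adj_of_mem_edgeList he
      rcases Sym2.eq_iff.1 heq with ⟨h3, h4⟩ | ⟨h3, h4⟩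
      · rwa [h3, h4] at this
      · rw [h3, h4] at this; exact this.symm
    · intro h
      rcases mem_edgeList_of_adj h with h | h
      · exact ⟨_, h, by rw [eval_toW, eval_toW]⟩
      · exact ⟨_, h, by rw [eval_toW, eval_toW]; exact Sym2.eq_swap⟩

end

section
variable {n : ℕ}

/-! ### The test for relators -/

/-- A signed translate of a generator: `(b, j, g)` stands for `± e_j g`. -/
abbrev Term : Type := Bool × ℕ × Word

/-- The line given by `g` and `w` passes from the first to the second vertex of the edge that
belongs to the term, or the other way round if the sign `b` is negative. -/
def Hits (c : Input) (b : Bool) (g w : Word) (t : Term) : Prop :=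
  (edgeList c)[t.2.1]? = some (passage c.1.1 c.2 (t.1 == b) (t.2.2 ++ g) w)

instance (c : Input) (b : Bool) (g w : Word) : DecidablePred (Hits c b g w) :=
  fun _ => inferInstanceAs (Decidable (_ = _))

/-- The number of terms that the line given by `g` and `w` hits. -/
def hitCount (c : Input) (l : List Term) (b : Bool) (g w : Word) : ℕ :=
  (l.filter fun t => Hits c b g w t).length

/-- The value of the combination of generators that is encoded by `l` vanishes on all lines. -/
def Vanishes (c : Input) (l : List Term) : Prop :=
  ∀ t ∈ l, ∀ p ∈ lineWords c,
    hitCount c l true (FreeGroup.invRev t.2.2 ++ p.1) p.2 =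
      hitCount c l false (FreeGroup.invRev t.2.2 ++ p.1) p.2

/-- The encoding of a term as it is used in the output of the algorithm. -/
def Term.encode (t : Term) : ℤ × ℕ × Word := (if t.1 then 1 else -1, t.2)

section

variable {ws : List Word} {r : ℕ}

/-- The first vertex of the `j`-th edge. -/
def source (c : Input) (j : Fin (edgeList c).length) : Gp c.1.1 :=
  ((edgeList c).get j).1.eval c.1.1

/-- The second vertex of the `j`-th edge. -/
def target (c : Input) (j : Fin (edgeList c).length) : Gp c.1.1 :=
  ((edgeList c).get j).2.eval c.1.1

theorem enumeratesEdges (n : ℕ) (ws : List Word) (r : ℕ) :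
    EnumeratesEdges (wordSet n ws) r (source ((n, ws), r)) (target ((n, ws), r)) where
  adj j := adj_of_mem_edgeList (List.get_mem _ j)
  exists_index x y h := by
    rcases mem_edgeList_of_adj h with h | h
    · obtain ⟨j, hj⟩ := List.get_of_mem h
      exact ⟨j, .inl ⟨by simp only [source, hj, eval_toW], by simp only [target, hj, eval_toW]⟩⟩
    · obtain ⟨j, hj⟩ := List.get_of_mem h
      exact ⟨j, .inr ⟨by simp only [source, hj, eval_toW], by simp only [target, hj, eval_toW]⟩⟩

/-- The element of the free module that is encoded by a list of terms. -/
def decode (c : Input) (l : List Term) :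
    Fin (edgeList c).length →₀ GroupRing c.1.1 :=
  decodeRelator c.1.1 (edgeList c).length (l.map Term.encode)

theorem decode_nil (c : Input) : decode c [] = 0 := rfl

theorem decode_cons (c : Input) (t : Term) (l : List Term) :
    decode c (t :: l) = decode c [t] + decode c l := by
  simp [decode, decodeRelator]

theorem decode_append (c : Input) (l l' : List Term) :
    decode c (l ++ l') = decode c l + decode c l' := by
  simp [decode, decodeRelator]

theorem decode_singleton (c : Input) (t : Term) :
    decode c [t] = if h : t.2.1 < (edgeList c).length then
      gen ⟨t.2.1, h⟩ (t.2.2.eval c.1.1) (if t.1 then 1 else -1) else 0 := by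
  simp [decode, decodeRelator, Term.encode, gen]

theorem hitCount_cons (c : Input) (t : Term) (l : List Term) (b : Bool)
    (g w : Word) : hitCount c (t :: l) b g w = (if Hits c b g w t then 1 else 0) +
      hitCount c l b g w := by
  rw [hitCount, List.filter_cons]
  by_cases h : Hits c b g w t
  · simp [h, hitCount, add_comm]
  · simp [h, hitCount]

/-- The term `± e_j h` takes on `p` the value of the edge on `h • p`, which is given by the word `h
++ g`. A negative sign exchanges the two orientations, whence the comparison of `t.1` with `b` in
`Hits`. -/
theorem value_decode_singleton {i : AssociatedCover (wordSet n ws)} (hi : i.X = ball n r)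
    (p : Lines (wordSet n ws)) {g w : Word} (hw : w.eval n ≠ 1)
    (hξ : ConvergesTo (fun k => g.eval n * w.eval n ^ k) p.1.1)
    (hη : ConvergesTo (fun k => g.eval n * (w.eval n)⁻¹ ^ k) p.1.2) (t : Term) :
    value _ (edgeMap i (source ((n, ws), r)) (target ((n, ws), r)) (decode ((n, ws), r) [t])) p =
      (if Hits ((n, ws), r) true g w t then 1 else 0) -
        (if Hits ((n, ws), r) false g w t then 1 else 0) := by
  classical
  obtain ⟨b, j, h⟩ := t
  rw [decode_singleton]
  by_cases hj : j < (edgeList ((n, ws), r)).length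
  · rw [dif_pos hj, value_edgeMap_gen hi]
    have hp : passage n r true (h ++ g) w = (toW (ray ((h.eval n) • p).1.1 (r + 1)),
        toW (ray ((h.eval n) • p).1.2 (r + 1))) := by
      refine passage_true_eq hw ?_ ?_ r
      · rw [Lines.smul_fst]
        simpa only [eval_append, mul_assoc] using hξ.smul (h.eval n)
      · rw [Lines.smul_snd]
        simpa only [eval_append, mul_assoc] using hη.smul (h.eval n)
    have he := eval_edgeList (List.get_mem (edgeList ((n, ws), r)) ⟨j, hj⟩)
    have hit : ∀ b', Hits ((n, ws), r) b' g w (b, j, h) ↔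
        (edgeList ((n, ws), r)).get ⟨j, hj⟩ = passage n r (b == b') (h ++ g) w := by
      intro b'
      rw [Hits, List.getElem?_eq_getElem hj]
      exact Option.some_inj
    have h1 : (edgeList ((n, ws), r)).get ⟨j, hj⟩ = passage n r true (h ++ g) w ↔
        ray ((h.eval n) • p).1.1 (r + 1) = source ((n, ws), r) ⟨j, hj⟩ ∧
        ray ((h.eval n) • p).1.2 (r + 1) = target ((n, ws), r) ⟨j, hj⟩ := by
      rw [hp, source, target, Prod.ext_iff]
      constructor
      · rintro ⟨h1, h2⟩
        simp only at h1 h2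
        rw [h1, h2, eval_toW, eval_toW]
        exact ⟨rfl, rfl⟩
      · rintro ⟨h1, h2⟩
        rw [h1, h2]
        exact ⟨he.1.symm, he.2.symm⟩
    have h2 : (edgeList ((n, ws), r)).get ⟨j, hj⟩ = passage n r false (h ++ g) w ↔
        ray ((h.eval n) • p).1.1 (r + 1) = target ((n, ws), r) ⟨j, hj⟩ ∧
        ray ((h.eval n) • p).1.2 (r + 1) = source ((n, ws), r) ⟨j, hj⟩ := by
      rw [passage_false_eq, hp, source, target, Prod.ext_iff]
      constructor
      · rintro ⟨h1, h2⟩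
        simp only [Prod.fst_swap, Prod.snd_swap] at h1 h2
        rw [h1, h2, eval_toW, eval_toW]
        exact ⟨rfl, rfl⟩
      · rintro ⟨h1, h2⟩
        rw [h1, h2]
        exact ⟨he.1.symm, he.2.symm⟩
    have h3 : edgeValue r (source ((n, ws), r) ⟨j, hj⟩) (target ((n, ws), r) ⟨j, hj⟩)
        ((h.eval n) • p) =
        (if (edgeList ((n, ws), r)).get ⟨j, hj⟩ = passage n r true (h ++ g) w then 1 else 0) -
        (if (edgeList ((n, ws), r)).get ⟨j, hj⟩ = passage n r false (h ++ g) w then 1 else 0) := by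
      rw [edgeValue]
      exact congrArg₂ _ (if_congr h1.symm rfl rfl) (if_congr h2.symm rfl rfl)
    show _ * edgeValue r _ _ ((h.eval n) • p) = _
    rw [h3, if_congr (hit true) rfl rfl, if_congr (hit false) rfl rfl]
    cases b
    · show (if false = true then (1 : ℤ) else -1) * _ = _
      rw [if_neg (by decide), neg_one_mul, neg_sub]
      rfl
    · show (if true = true then (1 : ℤ) else -1) * _ = _
      rw [if_pos rfl, one_mul]
      rfl
  · rw [dif_neg hj, map_zero, map_zero]
    have : ∀ b', ¬ Hits ((n, ws), r) b' g w (b, j, h) := by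
      intro b' h
      rw [Hits, List.getElem?_eq_none (by simpa using hj)] at h
      simp at h
    rw [if_neg (this _), if_neg (this _)]
    rfl

theorem value_decode {i : AssociatedCover (wordSet n ws)} (hi : i.X = ball n r)
    (p : Lines (wordSet n ws)) {g w : Word} (hw : w.eval n ≠ 1)
    (hξ : ConvergesTo (fun k => g.eval n * w.eval n ^ k) p.1.1)
    (hη : ConvergesTo (fun k => g.eval n * (w.eval n)⁻¹ ^ k) p.1.2) (l : List Term) :
    value _ (edgeMap i (source ((n, ws), r)) (target ((n, ws), r)) (decode ((n, ws), r) l)) p =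
      (hitCount ((n, ws), r) l true g w : ℤ) - hitCount ((n, ws), r) l false g w := by
  induction l with
  | nil => rw [decode_nil, map_zero, map_zero]; rfl
  | cons t l ih =>
    rw [decode_cons, map_add, map_add, Pi.add_apply, ih, value_decode_singleton hi p hw hξ hη,
      hitCount_cons, hitCount_cons]
    push_cast
    ring

theorem ray_ne_of_edgeValue_ne {W : Set (Gp n)} {a b : Gp n} {p : Lines W}
    (h : edgeValue r a b p ≠ 0) : ray p.1.1 (r + 1) ≠ ray p.1.2 (r + 1) := by
  intro heq
  apply h
  rw [edgeValue, heq, sub_eq_zero]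
  exact if_congr and_comm rfl rfl

/-- The test for relators is correct. -/
theorem vanishes_iff {i : AssociatedCover (wordSet n ws)} (hi : i.X = ball n r) (l : List Term) :
    Vanishes ((n, ws), r) l ↔
      edgeMap i (source ((n, ws), r)) (target ((n, ws), r)) (decode ((n, ws), r) l) = 0 := by
  constructor
  · intro h
    apply value_injective norm_le_lengthBound
    rw [map_zero]
    have key : ∀ p : Lines (wordSet n ws), LineEnds (wordSet n ws) p.1.1 p.1.2 →
        value _ (edgeMap i (source ((n, ws), r)) (target ((n, ws), r))
          (decode ((n, ws), r) l)) p = 0 := by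
      intro p hp
      -- If no single term sees the line, the sum vanishes on it. Otherwise some `t = ± e_j h` does,
      -- so `h • p` crosses the ball and is in the enumeration; then `p` is given by `h⁻¹ g`, which
      -- is among the tested pairs.
      by_cases hall : ∀ t ∈ l, value _ (edgeMap i (source ((n, ws), r)) (target ((n, ws), r))
          (decode ((n, ws), r) [t])) p = 0
      · clear h
        induction l with
        | nil => rw [decode_nil, map_zero, map_zero]; rfl
        | cons t l ih =>
          rw [decode_cons, map_add, map_add, Pi.add_apply, hall t List.mem_cons_self,
            ih fun t ht => hall t (List.mem_cons_of_mem _ ht)]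
          rfl
      push Not at hall
      obtain ⟨t, ht, hne⟩ := hall
      have hcross : ray (t.2.2.eval n • p).1.1 (r + 1) ≠ ray (t.2.2.eval n • p).1.2 (r + 1) := by
        rw [decode_singleton] at hne
        split_ifs at hne with hj
        · rw [value_edgeMap_gen hi] at hne
          exact ray_ne_of_edgeValue_ne (right_ne_zero_of_mul hne)
        · rw [value_edgeMap_gen hi] at hne
          exact ray_ne_of_edgeValue_ne (right_ne_zero_of_mul hne)
        · rw [map_zero, map_zero] at hne
          exact absurd rfl hne
      obtain ⟨_, ⟨w, hw, rfl⟩, g, hg, hξ, hη⟩ :=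
        (hp.smul (t.2.2.eval n)).exists_norm_le norm_le_lengthBound hcross
      have hw1 : w.eval n ≠ 1 := by
        intro h0
        rw [h0] at hξ
        obtain ⟨k, hk⟩ := (hξ g).exists
        simp at hk
      have hξ' := hξ.smul (t.2.2.eval n)⁻¹
      have hη' := hη.smul (t.2.2.eval n)⁻¹
      rw [inv_smul_smul] at hξ' hη'
      have he : Word.eval n (FreeGroup.invRev t.2.2 ++ toW g) = (t.2.2.eval n)⁻¹ * g := by
        rw [eval_append, eval_invRev, eval_toW]
      have h1 := value_decode hi p (g := FreeGroup.invRev t.2.2 ++ toW g) hw1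
        (by simpa only [he, mul_assoc] using hξ') (by simpa only [he, mul_assoc] using hη') l
      rw [h1, h t ht (toW g, w) (mem_lineWords.2 ⟨toW_mem_wordsUpTo hg, hw⟩), sub_self]
    funext p
    rcases p.2 with hp | hp
    · exact key p hp
    · have := key p.swap hp
      rw [value_swap] at this
      simpa using this
  · rintro h t ht ⟨g, w⟩ hgw
    -- The enumeration also contains words that spell the identity; for these the two counts agree
    -- by symmetry.
    by_cases hw : w.eval n = 1
    · have : ∀ b g t, Hits ((n, ws), r) b g w t ↔ Hits ((n, ws), r) true g w t := by
        intro b g t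
        rw [Hits, Hits, passage_of_eval_eq_one hw]
      simp only [hitCount, this false]
    · set g' : Word := FreeGroup.invRev t.2.2 ++ g
      obtain ⟨ξ, hξ⟩ := exists_convergesTo_pow hw (g'.eval n)
      obtain ⟨η, hη⟩ := exists_convergesTo_pow (inv_ne_one.2 hw) (g'.eval n)
      have hl : IsLine (wordSet n ws) ξ η :=
        .inl ⟨w.eval n, ⟨w, (mem_lineWords.1 hgw).2, rfl⟩, g'.eval n, hξ, hη⟩
      have := value_decode hi ⟨(ξ, η), hl⟩ hw hξ hη l
      rw [h, map_zero] at this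
      have h2 : (0 : ℤ) = _ := this
      have h3 := sub_eq_zero.1 h2.symm
      exact_mod_cast h3

/-! ### The relators -/

/-- The `j`-th edge in the list comes from lines through the identity. -/
def CentralIndex (c : Input) (j : ℕ) : Prop :=
  ((edgeList c).getD j ([], [])).1.head? ≠ ((edgeList c).getD j ([], [])).2.head?

/-- The default pair `([], [])` has equal heads, so an index out of range is never central. -/
theorem centralIndex_iff {j : ℕ} : CentralIndex ((n, ws), r) j ↔
    ∃ h : j < (edgeList ((n, ws), r)).length,
      Central (source ((n, ws), r)) (target ((n, ws), r)) ⟨j, h⟩ := by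
  rw [CentralIndex]
  by_cases h : j < (edgeList ((n, ws), r)).length
  · have he := eval_edgeList (List.get_mem (edgeList ((n, ws), r)) ⟨j, h⟩)
    have hc : Central (source ((n, ws), r)) (target ((n, ws), r)) ⟨j, h⟩ ↔
        ((edgeList ((n, ws), r))[j]).1.head? ≠ ((edgeList ((n, ws), r))[j]).2.head? := by
      rw [Central, ne_eq, ← head_toW_eq, source, target, he.1, he.2]
      rfl
    rw [List.getD_eq_getElem _ _ h, ← hc]
    exact ⟨fun h' => ⟨h, h'⟩, fun h' => h'.2⟩
  · rw [List.getD_eq_default _ _ (by simpa using h)]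
    simp [h]

/-- The relators in `L` express all generators by those that come from lines through the
identity. -/
def Expresses (c : Input) (L : List (List Term)) : Prop :=
  (∀ l ∈ L, Vanishes c l) ∧ ∀ j < (edgeList c).length,
    ∃ l ∈ L, l.head? = some (true, j, []) ∧ ∀ t ∈ l.tail, CentralIndex c t.2.1

/-- The candidates for relators that involve two generators. -/
def pairCandidates (c : Input) : List (List Term) :=
  (List.range (edgeList c).length).flatMap fun j =>
    (List.range (edgeList c).length).flatMap fun j' =>
      (letters c.1.1).flatMap fun s => [[(true, j, []), (true, j', [s])],
        [(true, j, []), (false, j', [s])]]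

theorem decode_mem_closure {l : List Term} (hl : ∀ t ∈ l, CentralIndex ((n, ws), r) t.2.1) :
    decode ((n, ws), r) l ∈ AddSubgroup.closure
      {x | ∃ j g, Central (source ((n, ws), r)) (target ((n, ws), r)) j ∧ gen j g 1 = x} := by
  induction l with
  | nil => rw [decode_nil]; exact AddSubgroup.zero_mem _
  | cons t l ih =>
    rw [decode_cons]
    refine AddSubgroup.add_mem _ ?_ (ih fun t ht => hl t (List.mem_cons_of_mem _ ht))
    obtain ⟨h, hc⟩ := centralIndex_iff.1 (hl t List.mem_cons_self)
    rw [decode_singleton, dif_pos h]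
    have h1 := AddSubgroup.zsmul_mem _ (AddSubgroup.subset_closure
      (show gen ⟨t.2.1, h⟩ (t.2.2.eval n) 1 ∈ {x | ∃ j g, Central (source ((n, ws), r))
        (target ((n, ws), r)) j ∧ gen j g 1 = x} from ⟨_, _, hc, rfl⟩)) (if t.1 then 1 else -1)
    rwa [zsmul_gen, mul_one] at h1

theorem exists_decode_eq {x : Fin (edgeList ((n, ws), r)).length →₀ GroupRing n}
    (hx : x ∈ AddSubgroup.closure
      {x | ∃ j g, Central (source ((n, ws), r)) (target ((n, ws), r)) j ∧ gen j g 1 = x}) :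
    ∃ l : List Term, (∀ t ∈ l, CentralIndex ((n, ws), r) t.2.1) ∧
      decode ((n, ws), r) l = x := by
  induction hx using AddSubgroup.closure_induction with
  | mem x hx =>
    obtain ⟨j, g, hj, rfl⟩ := hx
    refine ⟨[(true, j.1, toW g)], ?_, ?_⟩
    · simp only [List.mem_singleton, forall_eq]
      exact centralIndex_iff.2 ⟨j.2, hj⟩
    · rw [decode_singleton, dif_pos j.2]
      simp only [eval_toW]
      rfl
  | zero => exact ⟨[], by simp, rfl⟩
  | add x y _ _ hx hy =>
    obtain ⟨l, hl, rfl⟩ := hx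
    obtain ⟨l', hl', rfl⟩ := hy
    exact ⟨l ++ l', fun t ht => (List.mem_append.1 ht).elim (hl t) (hl' t), decode_append _ _ _⟩
  | neg x hx0 hx =>
    obtain ⟨l, hl, rfl⟩ := hx
    clear hx0
    refine ⟨l.map fun t => (!t.1, t.2), ?_, ?_⟩
    · intro t ht
      obtain ⟨t', ht', rfl⟩ := List.mem_map.1 ht
      exact hl t' ht'
    · clear hl
      induction l with
      | nil => simp [decode_nil]
      | cons t l ih =>
        rw [List.map_cons, decode_cons, ih, decode_cons _ t, neg_add]
        congr 1
        rw [decode_singleton, decode_singleton]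
        dsimp only
        split_ifs with h1 h2 h3 <;> simp_all [neg_gen]

/-- The search for the relators of the first kind halts: central edges generate `M`, so the negative
of the class of each `e_j` is a combination of their translates, and `e_j` followed by this
combination vanishes. -/
theorem exists_expresses (n : ℕ) (ws : List Word) (r : ℕ) (hr : 2 * lengthBound ws ≤ r + 1) :
    ∃ L, Expresses ((n, ws), r) L := by
  obtain ⟨i, hi⟩ := exists_cover_ball (norm_le_lengthBound (n := n) (ws := ws)) r
  have key : ∀ j : Fin (edgeList ((n, ws), r)).length, ∃ l : List Term, Vanishes ((n, ws), r) l ∧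
      l.head? = some (true, j.1, []) ∧ ∀ t ∈ l.tail, CentralIndex ((n, ws), r) t.2.1 := by
    intro j
    have h1 : -edgeMap i (source ((n, ws), r)) (target ((n, ws), r)) (gen j 1 1) ∈
        (AddSubgroup.closure {x | ∃ j g, Central (source ((n, ws), r))
          (target ((n, ws), r)) j ∧ gen j g 1 = x}).map
          (edgeMap i (source ((n, ws), r)) (target ((n, ws), r))).toAddMonoidHom := by
      rw [closure_central norm_le_lengthBound hr hi (enumeratesEdges n ws r)]
      trivial
    obtain ⟨x, hx, hxe⟩ := h1
    obtain ⟨l, hl, rfl⟩ := exists_decode_eq hx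
    refine ⟨(true, j.1, []) :: l, ?_, rfl, hl⟩
    rw [vanishes_iff hi, decode_cons, map_add, decode_singleton, dif_pos j.2]
    change _ = -_ at hxe
    change edgeMap i (source ((n, ws), r)) (target ((n, ws), r)) (gen j 1 1) +
      edgeMap i (source ((n, ws), r)) (target ((n, ws), r)) _ = 0
    exact add_eq_zero_iff_neg_eq.2 hxe.symm
  choose f hf using key
  refine ⟨List.ofFn f, ?_, ?_⟩
  · intro l hl
    obtain ⟨j, rfl⟩ := List.mem_ofFn.1 hl
    exact (hf j).1
  · intro j hj
    exact ⟨f ⟨j, hj⟩, List.mem_ofFn.2 ⟨_, rfl⟩, (hf ⟨j, hj⟩).2⟩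

theorem isRelatorSet {i : AssociatedCover (wordSet n ws)} (hi : i.X = ball n r)
    {L L' : List (List Term)} (hL : Expresses ((n, ws), r) L)
    (hL' : ∀ l, l ∈ L' ↔ l ∈ pairCandidates ((n, ws), r) ∧ Vanishes ((n, ws), r) l) :
    IsRelatorSet i (source ((n, ws), r)) (target ((n, ws), r))
      {x | ∃ l ∈ L ++ L', x = decode ((n, ws), r) l} where
  map_eq_zero := by
    rintro _ ⟨l, hl, rfl⟩
    rw [← vanishes_iff hi]
    rcases List.mem_append.1 hl with h | h
    · exact hL.1 l h
    · exact ((hL' l).1 h).2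
  exists_central j := by
    obtain ⟨l, hl, hh, ht⟩ := hL.2 j.1 j.2
    refine ⟨_, ⟨l, List.mem_append_left _ hl, rfl⟩, ?_⟩
    cases l with
    | nil => simp at hh
    | cons t l =>
      have hh' : t = (true, j.1, []) := by simpa using hh
      subst hh'
      rw [decode_cons, decode_singleton, dif_pos j.2]
      change gen j 1 1 + _ - gen j 1 1 ∈ _
      rw [add_sub_cancel_left]
      exact decode_mem_closure ht
  mem_of_letter j j' _ _ s m hm h := by
    obtain ⟨b, hb⟩ : ∃ b : Bool, m = if b then 1 else -1 := by
      rcases hm with rfl | rfl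
      · exact ⟨true, rfl⟩
      · exact ⟨false, rfl⟩
    have hs : Word.eval n [(s.1.val, s.2)] = letter s := eval_map_val [s]
    have hd : gen j 1 1 + gen j' (letter s) m =
        decode ((n, ws), r) [(true, j.1, []), (b, j'.1, [(s.1.val, s.2)])] := by
      rw [decode_cons, decode_singleton, decode_singleton, dif_pos j.2, dif_pos j'.2, hb]
      dsimp only
      rw [hs]
      rfl
    refine ⟨_, List.mem_append_right _ ((hL' _).2 ⟨?_, ?_⟩), hd⟩
    · refine List.mem_flatMap.2 ⟨j.1, List.mem_range.2 j.2, List.mem_flatMap.2 ⟨j'.1,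
        List.mem_range.2 j'.2, List.mem_flatMap.2 ⟨(s.1.val, s.2), mem_letters.2 s.1.2, ?_⟩⟩⟩
      cases b <;> simp
    · rw [vanishes_iff hi, ← hd]
      exact h

end

end

/-! ### Computability -/

section Computability
open Primrec

/-- Reduction is a right fold in which each letter either cancels the head of the reduced tail or is
prepended to it. -/
theorem primrec_reduce : Primrec (FreeGroup.reduce : Word → Word) := by
  have h1 : PrimrecPred fun p : Word × (ℕ × Bool) × Word =>
      p.2.2.head? = some (p.2.1.1, !p.2.1.2) :=
    Primrec.eq.comp (list_head?.comp (snd.comp snd)) (option_some.comp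
      ((fst.comp (fst.comp snd)).pair (Primrec.not.comp (snd.comp (fst.comp snd)))))
  have h2 : Primrec₂ fun (_ : Word) (p : (ℕ × Bool) × Word) =>
      if p.2.head? = some (p.1.1, !p.1.2) then p.2.tail else p.1 :: p.2 :=
    Primrec.ite h1 (list_tail.comp (snd.comp snd))
      (list_cons.comp (fst.comp snd) (snd.comp snd))
  refine (list_foldr .id (const []) h2).of_eq fun L => ?_
  induction L with
  | nil => rfl
  | cons s L ih =>
    simp only [id_eq, List.foldr_cons] at ih ⊢
    rw [ih, FreeGroup.reduce.cons]
    cases FreeGroup.reduce L with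
    | nil => rfl
    | cons t M =>
      obtain ⟨i, b⟩ := s
      obtain ⟨j, b'⟩ := t
      simp only [List.head?_cons, Option.some.injEq, Prod.mk.injEq, List.tail_cons]
      refine if_congr ?_ rfl rfl
      cases b <;> cases b' <;> simp [eq_comm]

theorem primrec_nf : Primrec₂ nf := by
  have h : PrimrecRel fun (s : ℕ × Bool) (n : ℕ) => s.1 < n := nat_lt.comp (fst.comp fst) snd
  exact primrec_reduce.comp ((PrimrecRel.listFilter h).comp snd fst)

theorem primrec_wordPow : Primrec₂ wordPow :=
  list_flatMap (list_range.comp fst) (snd.comp fst)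

theorem primrec_invRev : Primrec (FreeGroup.invRev : Word → Word) :=
  list_reverse.comp (list_map .id ((fst.comp snd).pair (Primrec.not.comp (snd.comp snd))))

theorem primrec_letters : Primrec letters :=
  list_flatMap list_range (list_cons.comp (snd.pair (const true))
    (list_cons.comp (snd.pair (const false)) (const [])))

theorem primrec_wordsUpTo : Primrec₂ wordsUpTo := by
  have h1 : Primrec₂ fun (q : (ℕ × ℕ × List Word) × Word) (s : ℕ × Bool) => s :: q.2 :=
    list_cons.comp snd (snd.comp fst)
  have h2 : Primrec₂ fun (q : ℕ × ℕ × List Word) (w : Word) =>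
      (letters q.1).map fun s => s :: w :=
    list_map (primrec_letters.comp (fst.comp fst)) h1
  have h3 : Primrec₂ fun (n : ℕ) (p : ℕ × List Word) =>
      [] :: p.2.flatMap fun w => (letters n).map fun s => s :: w :=
    list_cons.comp (const []) (list_flatMap (snd.comp snd) h2)
  exact Primrec.nat_rec (const [[]]) h3

theorem primrec_lengthBound : Primrec lengthBound := list_length.comp list_flatten

theorem primrec_signedWord : Primrec₂ signedWord :=
  Primrec.ite (Primrec.eq.comp fst (const true)) snd (primrec_invRev.comp snd)

theorem primrec_exitWord :
    Primrec fun p : (ℕ × ℕ) × Word × Word => exitWord p.1.1 p.1.2 p.2.1 p.2.2 := by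
  have hr : Primrec fun p : (ℕ × ℕ) × Word × Word => p.1.2 + 1 := succ.comp (snd.comp fst)
  exact list_take.comp hr (primrec_nf.comp (fst.comp fst) (list_append.comp (fst.comp snd)
    (primrec_wordPow.comp (nat_add.comp (list_length.comp (fst.comp snd)) hr) (snd.comp snd))))

theorem primrec_passage : Primrec fun p : ((ℕ × ℕ) × Bool) × Word × Word =>
    passage p.1.1.1 p.1.1.2 p.1.2 p.2.1 p.2.2 := by
  refine Primrec.pair ?_ ?_
  · exact primrec_exitWord.comp ((fst.comp fst).pair ((fst.comp snd).pair
      (primrec_signedWord.comp (snd.comp fst) (snd.comp snd))))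
  · exact primrec_exitWord.comp ((fst.comp fst).pair ((fst.comp snd).pair
      (primrec_signedWord.comp (Primrec.not.comp (snd.comp fst)) (snd.comp snd))))

theorem primrec_lineWords : Primrec lineWords :=
  list_flatMap (primrec_wordsUpTo.comp (fst.comp fst) (nat_add.comp snd
    (primrec_lengthBound.comp (snd.comp fst)))) (list_map (snd.comp (fst.comp fst))
      ((snd.comp fst).pair snd))

theorem primrecRel_mem {α : Type*} [Primcodable α] : PrimrecRel fun (l : List α) (a : α) => a ∈ l :=
  (PrimrecRel.exists_mem_list Primrec.eq).of_eq fun l a => by simp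

theorem primrec_dedupPairs : Primrec dedupPairs := by
  have h1 : PrimrecPred fun q : List (Word × Word) × (Word × Word) × List (Word × Word) =>
      q.2.1 ∈ q.2.2 ∨ q.2.1.swap ∈ q.2.2 :=
    (primrecRel_mem.comp (snd.comp snd) (fst.comp snd)).or (primrecRel_mem.comp (snd.comp snd)
      ((snd.comp (fst.comp snd)).pair (fst.comp (fst.comp snd))))
  have h2 : Primrec₂ fun (_ : List (Word × Word)) (p : (Word × Word) × List (Word × Word)) =>
      if p.1 ∈ p.2 ∨ p.1.swap ∈ p.2 then p.2 else p.1 :: p.2 :=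
    Primrec.ite h1 (snd.comp snd) (list_cons.comp (fst.comp snd) (snd.comp snd))
  exact list_foldr .id (const []) h2

theorem primrec_edgeList : Primrec edgeList := by
  have h1 : PrimrecPred fun e : Word × Word => e.1 ≠ e.2 := (Primrec.eq.comp fst snd).not
  refine primrec_dedupPairs.comp ((listFilter h1).comp (list_map primrec_lineWords ?_))
  exact primrec_passage.comp ((((fst.comp (fst.comp fst)).pair (snd.comp fst)).pair
    (const true)).pair snd)

theorem primrecRel_hits : PrimrecRel fun (t : Term) (p : Input × Bool × Word × Word) =>
    Hits p.1 p.2.1 p.2.2.1 p.2.2.2 t := by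
  have hc : Primrec fun q : Term × Input × Bool × Word × Word => q.2.1 := fst.comp snd
  have ht : Primrec fun q : Term × Input × Bool × Word × Word => q.1 := fst
  have hg : Primrec fun q : Term × Input × Bool × Word × Word => q.2.2.2.1 :=
    fst.comp (snd.comp (snd.comp snd))
  have hw : Primrec fun q : Term × Input × Bool × Word × Word => q.2.2.2.2 :=
    snd.comp (snd.comp (snd.comp snd))
  have hb : Primrec fun q : Term × Input × Bool × Word × Word => q.1.1 == q.2.2.1 :=
    Primrec.beq.comp (fst.comp fst) (fst.comp (snd.comp snd))
  exact Primrec.eq.comp (list_getElem?.comp (primrec_edgeList.comp hc) (fst.comp (snd.comp ht)))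
    (option_some.comp (primrec_passage.comp ((((fst.comp (fst.comp hc)).pair (snd.comp hc)).pair
      hb).pair ((list_append.comp (snd.comp (snd.comp ht)) hg).pair hw))))

theorem primrec_length_filter {α β : Type*} [Primcodable α] [Primcodable β] {R : α → β → Prop}
    [DecidableRel R] (hR : PrimrecRel R) :
    Primrec fun p : List α × β => (p.1.filter fun a => R a p.2).length :=
  list_length.comp ((PrimrecRel.listFilter hR).comp fst snd)

theorem primrec_hitCount : Primrec fun p : (Input × List Term) × Bool × Word × Word =>
    hitCount p.1.1 p.1.2 p.2.1 p.2.2.1 p.2.2.2 := by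
  let : DecidableRel fun (t : Term) (p : Input × Bool × Word × Word) =>
      Hits p.1 p.2.1 p.2.2.1 p.2.2.2 t := fun t p => inferInstance
  have h : Primrec fun p : (Input × List Term) × Bool × Word × Word =>
      (p.1.2, p.1.1, p.2) := (snd.comp fst).pair ((fst.comp fst).pair snd)
  refine ((primrec_length_filter primrecRel_hits).comp h).of_eq fun p => ?_
  rw [hitCount]

attribute [local irreducible] hitCount lineWords edgeList

theorem primrecRel_vanishes : PrimrecRel Vanishes := by
  have h1 : PrimrecRel fun (p : Word × Word) (q : Term × Input × List Term) =>
      hitCount q.2.1 q.2.2 true (FreeGroup.invRev q.1.2.2 ++ p.1) p.2 =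
        hitCount q.2.1 q.2.2 false (FreeGroup.invRev q.1.2.2 ++ p.1) p.2 := by
    have hg : Primrec fun x : (Word × Word) × Term × Input × List Term =>
        FreeGroup.invRev x.2.1.2.2 ++ x.1.1 :=
      list_append.comp (primrec_invRev.comp (snd.comp (snd.comp (fst.comp snd)))) (fst.comp fst)
    have hb : ∀ b : Bool, Primrec fun x : (Word × Word) × Term × Input × List Term =>
        hitCount x.2.2.1 x.2.2.2 b (FreeGroup.invRev x.2.1.2.2 ++ x.1.1) x.1.2 := fun b =>
      primrec_hitCount.comp ((snd.comp snd).pair ((const b).pair (hg.pair (snd.comp fst))))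
    exact Primrec.eq.comp (hb true) (hb false)
  have h2 : PrimrecRel fun (t : Term) (q : Input × List Term) => ∀ p ∈ lineWords q.1,
      hitCount q.1 q.2 true (FreeGroup.invRev t.2.2 ++ p.1) p.2 =
        hitCount q.1 q.2 false (FreeGroup.invRev t.2.2 ++ p.1) p.2 :=
    (PrimrecRel.forall_mem_list h1).comp (primrec_lineWords.comp (fst.comp snd)) .id
  exact (PrimrecRel.forall_mem_list h2).comp snd .id

theorem primrecRel_centralIndex : PrimrecRel CentralIndex := by
  have h : Primrec fun p : Input × ℕ => (edgeList p.1).getD p.2 ([], []) :=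
    (list_getD ([], [])).comp (primrec_edgeList.comp fst) snd
  exact (Primrec.eq.comp (list_head?.comp (fst.comp h)) (list_head?.comp (snd.comp h))).not

theorem primrecRel_expresses : PrimrecRel Expresses := by
  have h1 : PrimrecRel fun (l : List Term) (c : Input) => Vanishes c l :=
    primrecRel_vanishes.comp snd fst
  have h2 : PrimrecRel fun (l : List Term) (q : ℕ × Input) =>
      l.head? = some (true, q.1, []) ∧ ∀ t ∈ l.tail, CentralIndex q.2 t.2.1 := by
    refine PrimrecPred.and (Primrec.eq.comp (list_head?.comp fst) (option_some.comp
      ((const true).pair ((fst.comp snd).pair (const []))))) ?_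
    have h3 : PrimrecRel fun (t : Term) (c : Input) => CentralIndex c t.2.1 :=
      primrecRel_centralIndex.comp snd (fst.comp (snd.comp fst))
    exact (PrimrecRel.forall_mem_list h3).comp (list_tail.comp fst) (snd.comp snd)
  have h4 : PrimrecRel fun (j : ℕ) (q : Input × List (List Term)) => ∃ l ∈ q.2,
      l.head? = some (true, j, []) ∧ ∀ t ∈ l.tail, CentralIndex q.1 t.2.1 :=
    (PrimrecRel.exists_mem_list h2).comp (snd.comp snd) (fst.pair (fst.comp snd))
  have h5 : PrimrecRel fun (k : ℕ) (q : Input × List (List Term)) => ∀ j < k, ∃ l ∈ q.2,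
      l.head? = some (true, j, []) ∧ ∀ t ∈ l.tail, CentralIndex q.1 t.2.1 :=
    ((PrimrecRel.forall_mem_list h4).comp (list_range.comp fst) snd).of_eq fun p => by
      simp only [List.mem_range]
  exact ((PrimrecRel.forall_mem_list h1).comp snd fst).and
    (h5.comp (list_length.comp (primrec_edgeList.comp fst)) .id)

theorem primrec_pairCandidates : Primrec pairCandidates := by
  have hr : Primrec fun c : Input => List.range (edgeList c).length :=
    list_range.comp (list_length.comp primrec_edgeList)
  refine list_flatMap hr (list_flatMap (hr.comp fst)
    (list_flatMap (primrec_letters.comp (fst.comp (fst.comp (fst.comp fst)))) ?_))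
  have h1 : Primrec fun q : ((Input × ℕ) × ℕ) × (ℕ × Bool) => ((true, q.1.1.2, []) : Term) :=
    (const true).pair ((snd.comp (fst.comp fst)).pair (const []))
  have h2 : ∀ b : Bool, Primrec fun q : ((Input × ℕ) × ℕ) × (ℕ × Bool) =>
      [((true, q.1.1.2, []) : Term), (b, q.1.2, [q.2])] := fun b =>
    list_cons.comp h1 (list_cons.comp ((const b).pair ((snd.comp fst).pair
      (list_cons.comp snd (const [])))) (const []))
  exact list_cons.comp (h2 true) (list_cons.comp (h2 false) (const []))

theorem primrec_encode : Primrec Term.encode :=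
  (Primrec.ite (Primrec.eq.comp fst (const true)) (const 1) (const (-1))).pair snd

/-- The condition that ends the search for relators. It holds at once if the ball is too small. -/
def SearchCondition (c : Input) (L : List (List Term)) : Prop :=
  c.2 + 1 < 2 * lengthBound c.1.2 ∨ Expresses c L

theorem exists_searchCondition (c : Input) : ∃ L, SearchCondition c L := by
  by_cases h : c.2 + 1 < 2 * lengthBound c.1.2
  · exact ⟨[], .inl h⟩
  · obtain ⟨L, hL⟩ := exists_expresses c.1.1 c.1.2 c.2 (by omega)
    exact ⟨L, .inr hL⟩

theorem primrecRel_searchCondition : PrimrecRel SearchCondition :=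
  (nat_lt.comp (succ.comp (snd.comp fst)) (nat_mul.comp (const 2)
    (primrec_lengthBound.comp (snd.comp (fst.comp fst))))).or primrecRel_expresses

/-- A total relation that is decidable contains the graph of a computable function. -/
theorem exists_computable_of_primrecRel {α β : Type*} [Primcodable α] [Primcodable β]
    {R : α → β → Prop} (hR : PrimrecRel R) (h : ∀ a, ∃ b, R a b) :
    ∃ f : α → β, Computable f ∧ ∀ a, R a (f a) := by
  classical
  -- Unbounded search: `F a k` is the candidate with code `k`, provided that it satisfies the
  -- relation.
  let F : α → ℕ → Option β := fun a k =>
    (Encodable.decode k : Option β).bind fun b => if R a b then some b else none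
  have hF : Primrec₂ F :=
    option_bind (Primrec.decode.comp snd)
      (Primrec.ite (hR.comp (fst.comp fst) snd) (option_some.comp snd) (const none))
  have hdom : ∀ a, (Nat.rfindOpt (F a)).Dom := fun a => by
    obtain ⟨b, hb⟩ := h a
    exact Nat.rfindOpt_dom.2 ⟨Encodable.encode b, b, by simp [F, hb]⟩
  refine ⟨fun a => (Nat.rfindOpt (F a)).get (hdom a),
    (Partrec.rfindOpt hF.to_comp).of_eq_tot fun a => Part.get_mem _, fun a => ?_⟩
  obtain ⟨k, hk⟩ := Nat.rfindOpt_spec (Part.get_mem (hdom a))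
  simp only [F, Option.mem_def, Option.bind_eq_some_iff] at hk
  obtain ⟨b, -, hb⟩ := hk
  split_ifs at hb with hab
  have e : b = (Nat.rfindOpt (F a)).get (hdom a) := Option.some.inj hb
  show R a ((Nat.rfindOpt (F a)).get (hdom a))
  rwa [← e]

/-- The relators are computable. -/
theorem exists_computable_relators : ∃ f : Input → List (List Term), Computable f ∧
    ∀ c, ∃ L L', SearchCondition c L ∧ (∀ l, l ∈ L' ↔ l ∈ pairCandidates c ∧ Vanishes c l) ∧
      f c = L ++ L' := by
  classical
  obtain ⟨f, hf, hfc⟩ :=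
    exists_computable_of_primrecRel primrecRel_searchCondition exists_searchCondition
  have h1 : PrimrecRel fun (l : List Term) (c : Input) => Vanishes c l :=
    primrecRel_vanishes.comp snd fst
  have h2 : Primrec fun c : Input => (pairCandidates c).filter fun l => Vanishes c l :=
    (PrimrecRel.listFilter h1).comp primrec_pairCandidates .id
  exact ⟨_, (list_append.to_comp.comp hf h2.to_comp : Computable _), fun c => ⟨f c, _, hfc c,
    fun l => by rw [List.mem_filter, decide_eq_true_iff], rfl⟩⟩

/-- The bound for the size of the supports and the radius of the balls. -/
def sizeBound (c : ℕ × List Word) : ℕ :=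
  (wordsUpTo c.1 (2 * lengthBound c.2)).length + 2 * lengthBound c.2 + 1

theorem primrec_sizeBound : Primrec sizeBound := by
  have h : Primrec fun c : ℕ × List Word => 2 * lengthBound c.2 :=
    nat_mul.comp (const 2) (primrec_lengthBound.comp snd)
  exact succ.comp (nat_add.comp (list_length.comp (primrec_wordsUpTo.comp fst h)) h)

end Computability

end LinePattern
end

/-! ### The main theorem. -/

theorem mainTheorem10 :
    ∃ (N : ℕ × List Word → ℕ)
      (edges : (ℕ × List Word) × ℕ → List (Word × Word))
      (relators : (ℕ × List Word) × ℕ → List (List (ℤ × ℕ × Word))),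
      Computable N ∧ Computable edges ∧ Computable relators ∧
      ∀ (n : ℕ) (ws : List Word),
        AddSubgroup.closure {m : CochainModule (wordSet n ws) |
            ∃ X : Set (Gp n), IsFiniteSubtree X ∧ X.ncard < N (n, ws) ∧ SupportedOn m X} = ⊤ ∧
        ∀ r : ℕ, N (n, ws) ≤ r →
          ((edges ((n, ws), r)).map fun e => s(e.1.eval n, e.2.eval n)).Nodup ∧
          (∀ e, e ∈ (edges ((n, ws), r)).map (fun e => s(e.1.eval n, e.2.eval n)) ↔
            e ∈ (whitehead (wordSet n ws) (ball n r)).edgeSet) ∧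
          (∃ i : AssociatedCover (wordSet n ws), i.X = ball n r) ∧
          ∀ i : AssociatedCover (wordSet n ws), i.X = ball n r →
            Function.Surjective (presentationMap i (edges ((n, ws), r))) ∧
            Submodule.span (GroupRing n)
                {x | ∃ l ∈ relators ((n, ws), r),
                  x = decodeRelator n (edges ((n, ws), r)).length l} =
              LinearMap.ker (presentationMap i (edges ((n, ws), r))) := by
  obtain ⟨f, hf, hfc⟩ := exists_computable_relators
  have henc : Primrec fun L : List (List Term) => L.map fun l => l.map Term.encode :=
    Primrec.list_map .id (Primrec.list_map .snd (primrec_encode.comp .snd))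
  refine ⟨sizeBound, edgeList, fun c => (f c).map fun l => l.map Term.encode,
    primrec_sizeBound.to_comp, primrec_edgeList.to_comp, henc.to_comp.comp hf,
    fun n ws => ⟨?_, fun r hr => ?_⟩⟩
  -- The translates of the ball of radius `2ℓ` serve as supports; `sizeBound` exceeds the number of
  -- its vertices.
  · refine closure_supportedOn norm_le_lengthBound (r := 2 * lengthBound ws) (by omega) ?_
    have := ncard_ball_le n (2 * lengthBound ws)
    simp only [sizeBound]
    omega
  · have hr' : 2 * lengthBound ws ≤ r + 1 := by
      simp only [sizeBound] at hr
      omega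
    refine ⟨nodup_edgeList ws r, mem_map_edgeList_iff ws r,
      exists_cover_ball norm_le_lengthBound r, fun i hi => ⟨?_, ?_⟩⟩
    · exact edgeMap_surjective norm_le_lengthBound hr' hi (enumeratesEdges n ws r)
    · obtain ⟨L, L', hL, hL', hLf⟩ := hfc ((n, ws), r)
      -- For `r ≥ N` the search cannot have ended through the alternative for small balls, so its
      -- result is a genuine set of relators.
      have hE : Expresses ((n, ws), r) L := hL.resolve_left (by simpa using hr')
      have key := span_eq_ker norm_le_lengthBound hr' (enumeratesEdges n ws r) hi
        (isRelatorSet hi hE hL')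
      refine Eq.trans ?_ key
      congr 1
      ext x
      rw [← hLf]
      simp only [List.mem_map, exists_exists_and_eq_and]
      rfl
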